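/- **Setting.** Use coordinates $(x_1,x_2,z)$ on $\mathbb{R}^3$. A generalized link (all of whose components are arcs) is a finite family $L$ of disjoint arcs, each endpoint $x$ being constrained to an affine subspace $M_x$, which avoids obstacles $\{g_j<0\}$, where finitely many $C^1$ functions $g_j$ with regular value $0$ are given. Its Gehring thickness $\mathrm{Thi}(L)$ is the minimal distance between points on different components; a strut is a pair of points on different components at distance $\mathrm{Thi}(L)$; $O(L)=\min_j\min_{L}g_j$. A continuous vector field $\xi$ along $L$ is compatible if $\xi_x$ is tangent to $M_x$ at each endpoint $x$. If $L$ has finite total curvature, $\delta_\xi\mathrm{Len}(L)$ denotes the first variation of length, extended as a Radon measure to all continuous $\xi$. $L$ is (strongly) critical for Gehring ropelength if it has finite total curvature and there is $\varepsilon>0$ with $\min(\delta^+_\xi\mathrm{Thi}(L),\delta^+_\xi O(L))\le-\varepsilon$ for all compatible $\xi$ with $\delta_\xi\mathrm{Len}(L)=-1$, where $\delta^+_\xi$ is the one-sided derivative at $h=0^+$ along $L+h\xi$. **Clasp curves.** For $\sigma,\rho\in[0,1]$ let $K(\sigma,\rho)$ be the planar convex curve, symmetric in a vertical axis, with tip at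 the origin and opening upwards, whose curved arc is parametrized by the vertical component $u\in[-\sigma,\sigma]$ of its unit tangent: its horizontal coordinate is the odd function of $u$ with $$x(u)=\sqrt{\frac{u^2(1-w^2)}{1-u^2w^2}},\qquad w=\rho\,(1-u/\sigma),\qquad 0\le u\le\sigma,$$ its height is determined by $dz/dx=u/\sqrt{1-u^2}$, and it is prolonged at both ends by tangent straight segments. (If $\sigma=0$ the curved arc is a point.) By $K(\sigma,\rho)$ split at the tip we mean that the two halves are translated horizontally apart and a horizontal unit segment is inserted between them. **Configurations.** Let $m\in\{1,2\}$, $0\le\tau\le m$, $\tau_1=\tau/2$, $\tau_2=\tau/m$, and let $a,b>0$. $L^m(\tau)$ consists of two $\beta$ curves in the planes $x_2=\pm\frac12$, translates of each other, and $m$ translates of one $\gamma$ curve, in the plane $x_1=0$ if $m=1$ and in the planes $x_1=\pm\frac12$ if $m=2$. The $\beta$ curves are congruent to $K(\tau_1,\tau_2)$ turned upside down, with straight ends of length $a$, split at the tip if $m=2$ but not if $m=1$. The $\gamma$ curves are congruent to $K(\tau_2,\tau_1)$ with straight ends of length $b$, split at the tip. All are symmetric about the $z$-axis (the $\beta$ curves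 in the $x_1$-direction, the $\gamma$ curves in the $x_2$-direction), and the tips of the $\beta$ curves lie above those of the $\gamma$ curves by $\sqrt{1-\tau_2^2}$ plus the height of the curved arc of $\gamma$, so that an end of the curved arc of a $\gamma$ has distance $1$ from the tip (or the corresponding point beside the inserted segment) of the nearest $\beta$. Thus for $m=2$ all four curves are congruent to split ordinary $\tau/2$-clasp curves. For the generalized link problem $C^m_{0,2}(\tau)$, the four bounding planes are perpendicular to the ends of the curves, at angle $\arcsin\tau_1$ from the vertical for the left and right ends of the $\beta$ curves and $\arcsin\tau_2$ for those of the $\gamma$ curves; the ends are constrained to these planes, and the complement of the tetrahedral region they bound is an obstacle. **Theorem 5.1.** For $m=1$, $0\le\tau\le1$ and for $m=2$, $0\le\tau\le2$, the configuration $L^m(\tau)$ is a generalized link satisfying these constraints, has Gehring thickness $1$, and is critical for Gehring ropelength. Moreover, if $\tau>0$, its curvature force is balanced, as a functional on compatible fields, by positive strut forces which close into hexagons if $m=1$ and octagons if $m=2$: there are a continuous family, indexed by $r\in(0,1)$, of closed $N$-gons ($N=6$ for $m=1$, $N=8$ for $m=2$) with vertices on $L^m(\tau)$, no two of the vertices coinciding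 (whether of the same or of different polygons), all of whose edges are struts, and positive integrable force densities in $r$ on the $N$ edges, such that for every compatible $\xi$, $\delta_\xi\mathrm{Len}$ is the integral over $r$ of the sum over the edges $\{x,y\}$ of the force density times $\langle\xi_x-\xi_y,\,x-y\rangle$. -/

import Mathlib

open scoped RealInnerProductSpace

noncomputable section

namespace Gehring

/-! ### Generalized links made of arcs -/

/-- Euclidean three-space with coordinates `(x₁, x₂, z)`. -/
abbrev E3 : Type := EuclideanSpace ℝ (Fin 3)

/-- The data of a generalized link problem, all of whose components are arcs: parameter intervals
of the components (indexed by `ι`), the affine subspaces on which the two endpoints of each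
component are constrained to stay, and the functions whose negativity sets are the obstacles. -/
structure LinkProblem (ι κ : Type) where
  lo : ι → ℝ
  hi : ι → ℝ
  startSpace : ι → AffineSubspace ℝ E3
  endSpace : ι → AffineSubspace ℝ E3
  obstacle : κ → E3 → ℝ

variable {ι κ : Type}

/-- The parameter interval of the component `i`. -/
abbrev LinkProblem.Dom (P : LinkProblem ι κ) (i : ι) : Type := Set.Icc (P.lo i) (P.hi i)

/-- Points of the abstract curve: a component together with a parameter on it. -/
abbrev LinkProblem.Point (P : LinkProblem ι κ) : Type := Σ i, P.Dom i

/-- A family of parametrized arcs in space. -/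
abbrev LinkProblem.Arcs (P : LinkProblem ι κ) : Type := ∀ i, P.Dom i → E3

/-- Continuous vector fields along the arcs. -/
abbrev LinkProblem.Field (P : LinkProblem ι κ) : Type := ∀ i, C(P.Dom i, E3)

/-- `L` is a generalized link for the problem `P`: the components are disjoint continuous arcs,
the endpoints lie on their constraint spaces, the obstacle functions are `C¹` with regular
value `0`, and `L` stays where all of them are nonnegative. -/
structure IsGeneralizedLink (P : LinkProblem ι κ) (L : P.Arcs) : Prop where
  lo_lt_hi : ∀ i, P.lo i < P.hi i
  continuous : ∀ i, Continuous (L i)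
  disjoint : ∀ x y : P.Point, x.1 ≠ y.1 → L x.1 x.2 ≠ L y.1 y.2
  start_mem : ∀ i (t : P.Dom i), (t : ℝ) = P.lo i → L i t ∈ P.startSpace i
  end_mem : ∀ i (t : P.Dom i), (t : ℝ) = P.hi i → L i t ∈ P.endSpace i
  obstacle_contDiff : ∀ j, ContDiff ℝ 1 (P.obstacle j)
  obstacle_regular : ∀ j p, P.obstacle j p = 0 → fderiv ℝ (P.obstacle j) p ≠ 0
  avoids : ∀ j (x : P.Point), 0 ≤ P.obstacle j (L x.1 x.2)

/-- The Gehring thickness: the minimal distance between points on different components. -/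
def gThi (P : LinkProblem ι κ) (L : P.Arcs) : ℝ :=
  ⨅ q : {q : P.Point × P.Point // q.1.1 ≠ q.2.1},
    dist (L q.1.1.1 q.1.1.2) (L q.1.2.1 q.1.2.2)

/-- The minimal value `O(L)` of the obstacle functions on the link. -/
def obstacleMin (P : LinkProblem ι κ) (L : P.Arcs) : ℝ :=
  ⨅ q : κ × P.Point, P.obstacle q.1 (L q.2.1 q.2.2)

/-- The points `x` and `y` form a Gehring strut. -/
def IsGStrut (P : LinkProblem ι κ) (L : P.Arcs) (x y : P.Point) : Prop :=
  x.1 ≠ y.1 ∧ dist (L x.1 x.2) (L y.1 y.2) = gThi P L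

/-- The total length. -/
def len [Fintype ι] (P : LinkProblem ι κ) (L : P.Arcs) : ℝ :=
  ∑ i, (eVariationOn (L i) Set.univ).toReal

/-- The arcs `L + h ξ`. -/
def move (P : LinkProblem ι κ) (L : P.Arcs) (ξ : P.Field) (h : ℝ) : P.Arcs :=
  fun i t => L i t + h • ξ i t

/-- The field `ξ` is continuously differentiable on each (closed) parameter interval. -/
def IsC1Field (P : LinkProblem ι κ) (ξ : P.Field) : Prop :=
  ∀ i, ∃ η : ℝ → E3, ContDiff ℝ 1 η ∧ ∀ t : P.Dom i, ξ i t = η t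

/-- `L` has finite total curvature, and `D` is the first variation of its length, as a continuous
linear functional on all continuous vector fields along `L` (that is, by the Riesz representation
theorem, a vector-valued Radon measure along `L`, namely minus the curvature force, with its atoms
at the endpoints). Since `C¹` fields are dense, `D` is unique. -/
def IsLengthVariation [Fintype ι] (P : LinkProblem ι κ) (L : P.Arcs) (D : P.Field →L[ℝ] ℝ) :
    Prop :=
  ∀ ξ : P.Field, IsC1Field P ξ → HasDerivAt (fun h => len P (move P L ξ h)) (D ξ) 0

/-- The continuous field `ξ` is compatible with the endpoint constraints: it is tangent to the
constraint space at each endpoint. -/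
def IsCompatible (P : LinkProblem ι κ) (ξ : P.Field) : Prop :=
  ∀ i (t : P.Dom i),
    ((t : ℝ) = P.lo i → ξ i t ∈ (P.startSpace i).direction) ∧
    ((t : ℝ) = P.hi i → ξ i t ∈ (P.endSpace i).direction)

/-- `L` is strongly critical for minimizing length when constrained by Gehring thickness (and by
the obstacles and endpoint constraints): there is `ε > 0` such that every compatible `ξ` with
`δ_ξ Len = -1` has `min (δ⁺_ξ gThi) (δ⁺_ξ O) ≤ -ε`, with one-sided first variations. -/
def StronglyCritical [Fintype ι] (P : LinkProblem ι κ) (L : P.Arcs) : Prop :=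
  ∃ D : P.Field →L[ℝ] ℝ, IsLengthVariation P L D ∧
    ∃ ε : ℝ, 0 < ε ∧ ∀ ξ : P.Field, IsCompatible P ξ → D ξ = -1 →
      ∃ dThi dO : ℝ,
        HasDerivWithinAt (fun h => gThi P (move P L ξ h)) dThi (Set.Ici 0) 0 ∧
        HasDerivWithinAt (fun h => obstacleMin P (move P L ξ h)) dO (Set.Ici 0) 0 ∧
        min dThi dO ≤ -ε

/-- The curvature force of `L` is balanced by strut forces which close into `N`-gons: there is a
continuous family of closed `N`-gons `v 0 r, …, v (N - 1) r`, `0 < r < 1`, no two of which share a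
vertex, all of whose edges are Gehring struts, and there are positive integrable force densities
`w k` on the `k`-th edges, such that for every compatible `ξ` the first variation of length is the
total first variation of the strut lengths weighted by the `w k` (where
`⟪ξ_x - ξ_y, x - y⟫` is the first variation of the length of a strut `x y` of length `1`). -/
def BalancedByPolygons [Fintype ι] (P : LinkProblem ι κ) (L : P.Arcs) (N : ℕ) [NeZero N] : Prop :=
  ∃ D : P.Field →L[ℝ] ℝ, IsLengthVariation P L D ∧
    ∃ (v : Fin N → ℝ → P.Point) (w : Fin N → ℝ → ℝ),
      (∀ k, ContinuousOn (v k) (Set.Ioo 0 1)) ∧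
      Set.InjOn (fun q : Fin N × ℝ => v q.1 q.2) (Set.univ ×ˢ Set.Ioo 0 1) ∧
      (∀ k, ∀ r ∈ Set.Ioo (0 : ℝ) 1, IsGStrut P L (v k r) (v (k + 1) r)) ∧
      (∀ k, ∀ r ∈ Set.Ioo (0 : ℝ) 1, 0 < w k r) ∧
      (∀ k, MeasureTheory.IntegrableOn (w k) (Set.Ioo 0 1)) ∧
      ∀ ξ : P.Field, IsCompatible P ξ →
        D ξ = ∫ r in Set.Ioo (0 : ℝ) 1, ∑ k, w k r *
          ⟪ξ (v k r).1 (v k r).2 - ξ (v (k + 1) r).1 (v (k + 1) r).2,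
            L (v k r).1 (v k r).2 - L (v (k + 1) r).1 (v (k + 1) r).2⟫

/-! ### Weighted clasp curves

A convex clasp curve is drawn here with its tip at the origin and opening upwards. `σ` is its own
parameter and `ρ` the one of the curve it is clasped with. It is parametrized by the angle `θ` of
its tangent with the horizontal, so that the vertical component of the unit tangent is
`u = sin θ`, with `|u| ≤ σ` along the curved arc. -/

/-- The horizontal coordinate as an (odd) function of `u`: for `u ≥ 0` it equals
`√(u² (1 - w²) / (1 - u² w²))` with `u / σ + w / ρ = 1`. -/
def claspX (σ ρ u : ℝ) : ℝ :=
  u * √((1 - (ρ * (1 - |u| / σ)) ^ 2) / (1 - u ^ 2 * (ρ * (1 - |u| / σ)) ^ 2))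

/-- The height above the tip, determined by `dz / dx = u / √(1 - u²)`. With `u = sin φ` this
reads `dz = tan φ dx = x'(sin φ) sin φ dφ`. -/
def claspRise (σ ρ θ : ℝ) : ℝ :=
  ∫ φ in (0 : ℝ)..θ, deriv (claspX σ ρ) (Real.sin φ) * Real.sin φ

/-- The point of `[-r, r]` closest to `t`. -/
def clamp (r t : ℝ) : ℝ := max (-r) (min r t)

/-- Horizontal coordinate of the clasp curve prolonged by straight ends, at the parameter `t`: the
curved arc is `|t| ≤ arcsin σ`, with `t` the tangent angle; beyond it `t` is arclength. -/
def armX (σ ρ t : ℝ) : ℝ :=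
  claspX σ ρ (Real.sin (clamp (Real.arcsin σ) t)) + √(1 - σ ^ 2) * (t - clamp (Real.arcsin σ) t)

/-- Height of the clasp curve prolonged by straight ends. -/
def armZ (σ ρ t : ℝ) : ℝ :=
  claspRise σ ρ (clamp (Real.arcsin σ) t) + σ * |t - clamp (Real.arcsin σ) t|

/-- Horizontal coordinate of the clasp curve split apart at its tip, with a horizontal segment of
length `g` inserted (`|t| ≤ g / 2`). For `g = 0` this is the curve itself. -/
def splitX (g σ ρ t : ℝ) : ℝ := clamp (g / 2) t + armX σ ρ (t - clamp (g / 2) t)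

/-- Height of the split clasp curve. -/
def splitZ (g σ ρ t : ℝ) : ℝ := armZ σ ρ (t - clamp (g / 2) t)

/-- The height of the tip of the upper clasped curve (parameter `σ`, opening downwards) above the
tip of the lower one (parameter `ρ`, opening upwards), fixed by the condition that the strut from
the tip of the former to the end of the curved arc of the latter has length `1`. -/
def tipGap (σ ρ : ℝ) : ℝ := √(1 - ρ ^ 2) + claspRise ρ σ (Real.arcsin ρ)

/-! ### The problem `C^m_{0,2}(τ)` and the configuration `L^m(τ)`, for `m = 1, 2`

There are two components `β` (`Sum.inl`), parallel to the `x₁z`-plane and opening downwards, and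
`m` components `γ` (`Sum.inr`), parallel to the `x₂z`-plane and opening upwards. The straight ends
have length `a` on the `β`s and `b` on the `γ`s. -/

/-- The position of the `i`-th of `n` objects spaced at distance `1` symmetrically about `0`. -/
def offset (n : ℕ) (i : Fin n) : ℝ := (i : ℝ) - ((n : ℝ) - 1) / 2

/-- Half the length of the parameter interval of the `β`s; the segment inserted in them has
length `m - 1`. -/
def betaEnd (m : ℕ) (τ a : ℝ) : ℝ := ((m : ℝ) - 1) / 2 + Real.arcsin (τ / 2) + a

/-- Half the length of the parameter interval of the `γ`s; the segment inserted in them has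
length `1`. -/
def gammaEnd (m : ℕ) (τ b : ℝ) : ℝ := 1 / 2 + Real.arcsin (τ / m) + b

/-- The `β` curve in the plane `x₂ = y`. -/
def beta (m : ℕ) (τ y t : ℝ) : E3 :=
  !₂[splitX ((m : ℝ) - 1) (τ / 2) (τ / m) t, y,
    tipGap (τ / 2) (τ / m) - splitZ ((m : ℝ) - 1) (τ / 2) (τ / m) t]

/-- The `γ` curve in the plane `x₁ = y`. -/
def gamma (m : ℕ) (τ y t : ℝ) : E3 :=
  !₂[y, splitX 1 (τ / m) (τ / 2) t, splitZ 1 (τ / m) (τ / 2) t]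

/-- The outer unit normals of the four bounding planes: at angle `arcsin (τ / 2)` from the vertical
for the left and right ends of the `β`s, at angle `arcsin (τ / m)` for those of the `γ`s. -/
def wallNormal (m : ℕ) (τ : ℝ) : Fin 4 → E3 :=
  ![!₂[-√(1 - (τ / 2) ^ 2), 0, -(τ / 2)], !₂[√(1 - (τ / 2) ^ 2), 0, -(τ / 2)],
    !₂[0, -√(1 - (τ / m) ^ 2), τ / m], !₂[0, √(1 - (τ / m) ^ 2), τ / m]]

/-- The signed distances of the four bounding planes from the origin, in the direction of their
normals. By mirror symmetry each is found from the right end of a `β` or of a `γ`. -/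
def wallDist (m : ℕ) (τ a b : ℝ) : Fin 4 → ℝ :=
  ![⟪wallNormal m τ 1, beta m τ 0 (betaEnd m τ a)⟫,
    ⟪wallNormal m τ 1, beta m τ 0 (betaEnd m τ a)⟫,
    ⟪wallNormal m τ 3, gamma m τ 0 (gammaEnd m τ b)⟫,
    ⟪wallNormal m τ 3, gamma m τ 0 (gammaEnd m τ b)⟫]

/-- The `j`-th bounding plane. -/
def wall (m : ℕ) (τ a b : ℝ) (j : Fin 4) : AffineSubspace ℝ E3 :=
  AffineSubspace.mk' (wallDist m τ a b j • wallNormal m τ j) (ℝ ∙ wallNormal m τ j)ᗮ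

/-- The generalized link problem: the ends of the arcs are constrained to the four bounding planes,
and the complement of the tetrahedron they bound is an obstacle. -/
def claspProblem (m : ℕ) (τ a b : ℝ) : LinkProblem (Fin 2 ⊕ Fin m) (Fin 4) where
  lo := Sum.elim (fun _ => -betaEnd m τ a) (fun _ => -gammaEnd m τ b)
  hi := Sum.elim (fun _ => betaEnd m τ a) (fun _ => gammaEnd m τ b)
  startSpace := Sum.elim (fun _ => wall m τ a b 0) (fun _ => wall m τ a b 2)
  endSpace := Sum.elim (fun _ => wall m τ a b 1) (fun _ => wall m τ a b 3)
  obstacle := fun j p => wallDist m τ a b j - ⟪wallNormal m τ j, p⟫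

/-- The configuration `L^m(τ)`: two translates of the `β` curve in the planes `x₂ = ±1/2`, and `m`
translates of the `γ` curve in the plane `x₁ = 0` (for `m = 1`) or the planes `x₁ = ±1/2`
(for `m = 2`). -/
def splitClasp (m : ℕ) (τ a b : ℝ) : (claspProblem m τ a b).Arcs
  | .inl i => fun t => beta m τ (offset 2 i) t
  | .inr i => fun t => gamma m τ (offset m i) t

end Gehring

end

/-!
A compatible field is tangent to the planes that the curves meet perpendicularly, so the ends do not
contribute to the first variation of length, which is minus the work of the curvature force along
the curved arcs.  The points of a curve `K(σ, ρ)` at which the tangent has vertical component `±u`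
are joined by unit segments to points with vertical component `±ρ (1 - u / σ)` of the curves
`K(ρ, σ)` clasped with it.  The balance of vertical forces fixes the force densities on these
segments; the horizontal forces that remain are cancelled along unit struts between two translates
of the same curve.  Together these struts close into hexagons or octagons.

All other distances are at least `1`, by an inequality for two clasped arcs.  Balance implies
criticality by Danskin's theorem: the one-sided derivative of thickness is at most the rate of
change of each strut, and if length decreases then the average of these rates against the force
measure is negative.  For `τ = 0` the curves are straight, and length is stationary under
compatible fields.
-/

noncomputable section

namespace Gehring

open MeasureTheory Set Filter Topology

/-! ### The first variation of length -/

section Variation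

theorem eVariationOn_comp_val_univ {α E : Type*} [LinearOrder α] [PseudoEMetricSpace E]
    (f : α → E) (s : Set α) : eVariationOn (fun t : s => f t) univ = eVariationOn f s := by
  have h := eVariationOn.comp_eq_of_monotoneOn f (t := univ) (Subtype.val : s → α)
    fun _ _ _ _ h => h
  rwa [image_univ, Subtype.range_coe] at h

variable {E : Type*} [NormedAddCommGroup E] [NormedSpace ℝ E] {f f' : ℝ → E} {a b : ℝ} {S : Set ℝ}

theorem norm_sub_le_integral_norm_deriv [CompleteSpace E] {x y : ℝ}
    (hS : S.Countable) (hc : ContinuousOn f (Icc a b))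
    (hd : ∀ t ∈ Ioo a b \ S, HasDerivAt f (f' t) t) (hi : IntervalIntegrable f' volume a b)
    (hax : a ≤ x) (hxy : x ≤ y) (hyb : y ≤ b) :
    ‖f y - f x‖ ≤ ∫ t in x..y, ‖f' t‖ := by
  have hi' : IntervalIntegrable f' volume x y := hi.mono_set (by
    rw [uIcc_of_le hxy, uIcc_of_le (hax.trans (hxy.trans hyb))]
    exact Icc_subset_Icc hax hyb)
  rw [← integral_eq_of_hasDerivAt_off_countable_of_le f f' hxy hS
    (hc.mono (Icc_subset_Icc hax hyb))
    (fun t ht => hd t ⟨⟨hax.trans_lt ht.1.1, ht.1.2.trans_le hyb⟩, ht.2⟩) hi']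
  exact intervalIntegral.norm_integral_le_integral_norm hxy

theorem eVariationOn_le_integral_norm_deriv [CompleteSpace E]
    (hS : S.Countable) (hc : ContinuousOn f (Icc a b))
    (hd : ∀ t ∈ Ioo a b \ S, HasDerivAt f (f' t) t) (hi : IntervalIntegrable f' volume a b) :
    eVariationOn f (Icc a b) ≤ ENNReal.ofReal (∫ t in a..b, ‖f' t‖) := by
  have hint : ∀ x y, a ≤ x → x ≤ y → y ≤ b →
      IntervalIntegrable (fun t => ‖f' t‖) volume x y := fun x y hx hxy hy =>
    hi.norm.mono_set (by
      rw [uIcc_of_le hxy, uIcc_of_le (hx.trans (hxy.trans hy))]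
      exact Icc_subset_Icc hx hy)
  refine iSup_le fun ⟨n, u, hu, hus⟩ => ?_
  have hsum : ∑ i ∈ Finset.range n, ‖f (u (i + 1)) - f (u i)‖ ≤ ∫ t in u 0..u n, ‖f' t‖ := by
    rw [← intervalIntegral.sum_integral_adjacent_intervals fun i _ =>
      hint (u i) (u (i + 1)) (hus i).1 (hu i.le_succ) (hus (i + 1)).2]
    exact Finset.sum_le_sum fun i _ => norm_sub_le_integral_norm_deriv hS hc hd hi
      (hus i).1 (hu i.le_succ) (hus (i + 1)).2
  have hmono : ∫ t in u 0..u n, ‖f' t‖ ≤ ∫ t in a..b, ‖f' t‖ :=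
    intervalIntegral.integral_mono_interval (hus 0).1 (hu n.zero_le) (hus n).2
      (Eventually.of_forall fun _ => norm_nonneg _) hi.norm
  simp only [edist_dist, dist_eq_norm]
  rw [← ENNReal.ofReal_sum_of_nonneg fun _ _ => norm_nonneg _]
  exact ENNReal.ofReal_le_ofReal (hsum.trans hmono)

theorem norm_le_of_hasDerivAt_variationOnFromTo {x v : ℝ} {w : E}
    (hf : LocallyBoundedVariationOn f (Icc a b)) (hx : x ∈ Ioo a b)
    (hv : HasDerivAt (variationOnFromTo f (Icc a b) a) v x) (hw : HasDerivAt f w x) :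
    ‖w‖ ≤ v := by
  have hle : 𝓝[>] x ≤ 𝓝[≠] x := nhdsWithin_mono _ fun y hy => ne_of_gt hy
  refine le_of_tendsto_of_tendsto (hw.tendsto_slope.norm.mono_left hle)
    (hv.tendsto_slope.mono_left hle) ?_
  filter_upwards [Ioo_mem_nhdsGT hx.2] with y hy
  have hyI : y ∈ Icc a b := ⟨(hx.1.trans hy.1).le, hy.2.le⟩
  have hxI : x ∈ Icc a b := ⟨hx.1.le, hx.2.le⟩
  have haI : a ∈ Icc a b := ⟨le_rfl, (hx.1.trans hx.2).le⟩
  rw [slope_def_module, slope_def_field, norm_smul, norm_inv, Real.norm_eq_abs,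
    abs_of_pos (sub_pos.2 hy.1), div_eq_inv_mul]
  refine mul_le_mul_of_nonneg_left ?_ (inv_nonneg.2 (sub_pos.2 hy.1).le)
  rw [variationOnFromTo.sub_right hf haI hyI hxI, variationOnFromTo.eq_of_le _ _ hy.1.le,
    ← dist_eq_norm, ← ENNReal.ofReal_le_iff_le_toReal (hf x y hxI hyI), ← edist_dist]
  exact eVariationOn.edist_le f ⟨hyI, hy.1.le, le_rfl⟩ ⟨hxI, le_rfl, hy.1.le⟩

theorem integral_norm_deriv_le_eVariationOn
    (hab : a ≤ b) (hS : S.Countable) (hd : ∀ t ∈ Ioo a b \ S, HasDerivAt f (f' t) t)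
    (hi : IntervalIntegrable f' volume a b) (hf : BoundedVariationOn f (Icc a b)) :
    ∫ t in a..b, ‖f' t‖ ≤ (eVariationOn f (Icc a b)).toReal := by
  set V : ℝ → ℝ := variationOnFromTo f (Icc a b) a with hV
  have ha : a ∈ Icc a b := left_mem_Icc.2 hab
  have hm : MonotoneOn V (uIcc a b) := by
    rw [uIcc_of_le hab]
    exact variationOnFromTo.monotoneOn hf.locallyBoundedVariationOn ha
  have hVab : V b - V a = (eVariationOn f (Icc a b)).toReal := by
    rw [hV, variationOnFromTo.self, variationOnFromTo.eq_of_le _ _ hab, inter_self, sub_zero]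
  have hVle : V a ≤ V b := hm left_mem_uIcc right_mem_uIcc hab
  have hderiv : ∫ t in a..b, deriv V t ≤ V b - V a := by
    have := hm.intervalIntegral_deriv_mem_uIcc
    rw [uIcc_of_le (sub_nonneg.2 hVle)] at this
    exact this.2
  refine le_trans ?_ (hderiv.trans_eq hVab)
  refine intervalIntegral.integral_mono_ae_restrict hab hi.norm hm.intervalIntegrable_deriv ?_
  rw [← restrict_Ioo_eq_restrict_Icc]
  have hdiff : ∀ᵐ x ∂(volume.restrict (Ioo a b)), DifferentiableWithinAt ℝ V (Ioo a b) x :=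
    (hm.mono (Ioo_subset_Icc_self.trans Icc_subset_uIcc)).ae_differentiableWithinAt
      measurableSet_Ioo
  filter_upwards [ae_restrict_of_ae (hS.ae_notMem volume), hdiff,
    ae_restrict_mem measurableSet_Ioo] with x hxS hxd hx
  exact norm_le_of_hasDerivAt_variationOnFromTo hf.locallyBoundedVariationOn hx
    (hxd.differentiableAt (Ioo_mem_nhds hx.1 hx.2)).hasDerivAt (hd x ⟨hx, hxS⟩)

theorem toReal_eVariationOn_eq_integral [CompleteSpace E]
    (hab : a ≤ b) (hS : S.Countable) (hc : ContinuousOn f (Icc a b))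
    (hd : ∀ t ∈ Ioo a b \ S, HasDerivAt f (f' t) t) (hi : IntervalIntegrable f' volume a b) :
    (eVariationOn f (Icc a b)).toReal = ∫ t in a..b, ‖f' t‖ := by
  have hle := eVariationOn_le_integral_norm_deriv hS hc hd hi
  have hfin : BoundedVariationOn f (Icc a b) := ne_top_of_le_ne_top ENNReal.ofReal_ne_top hle
  exact le_antisymm (ENNReal.toReal_le_of_le_ofReal
    (intervalIntegral.integral_nonneg hab fun _ _ => norm_nonneg _) hle)
    (integral_norm_deriv_le_eVariationOn hab hS hd hi hfin)

end Variation

/-- A continuous curve `γ` with unit tangent `T` turning at the rate `ν = T'`, of norm at most `1`,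
in a parametrization of bounded speed which need not be by arclength. The derivatives are only
required off a countable set, so that straight segments and arcs may be joined tangentially. -/
structure IsTurningCurve {E : Type*} [NormedAddCommGroup E] [InnerProductSpace ℝ E]
    (γ T ν : ℝ → E) (S : Set ℝ) : Prop where
  countable : S.Countable
  continuous : Continuous γ
  velocity : ∃ C : ℝ, ∀ t ∉ S, ∃ s : ℝ, 0 < s ∧ s ≤ C ∧ HasDerivAt γ (s • T t) t
  norm_tangent : ∀ t, ‖T t‖ = 1
  continuous_tangent : Continuous T
  hasDerivAt_tangent : ∀ t ∉ S, HasDerivAt T (ν t) t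
  stronglyMeasurable_normal : StronglyMeasurable ν
  norm_normal_le : ∀ t, ‖ν t‖ ≤ 1

section FirstVariation

variable {E : Type*} [NormedAddCommGroup E] [InnerProductSpace ℝ E]

theorem hasDerivAt_norm_add_smul {v : E} (hv : v ≠ 0) (w : E) :
    HasDerivAt (fun h : ℝ => ‖v + h • w‖) (⟪v, w⟫ / ‖v‖) 0 := by
  have hline : HasDerivAt (fun h : ℝ => v + h • w) w 0 := by
    simpa only [id_eq, one_smul] using ((hasDerivAt_id (0 : ℝ)).smul_const w).const_add v
  have h := hline.norm_sq.sqrt (by simpa using hv)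
  simp only [Real.sqrt_sq (norm_nonneg _), zero_smul, add_zero] at h
  convert h using 1
  field_simp

variable {γ T ν : ℝ → E} {S : Set ℝ} {a b : ℝ}

namespace IsTurningCurve

theorem hasDerivAt_norm_velocity (hγ : IsTurningCurve γ T ν S) {t : ℝ} (ht : t ∉ S) (w : E) :
    HasDerivAt (fun h : ℝ => ‖deriv γ t + h • w‖) ⟪T t, w⟫ 0 := by
  obtain ⟨C, hvel⟩ := hγ.velocity
  obtain ⟨s, hs, -, hd⟩ := hvel t ht
  have hT : T t ≠ 0 := norm_ne_zero_iff.1 (by rw [hγ.norm_tangent]; exact one_ne_zero)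
  rw [hd.deriv]
  convert hasDerivAt_norm_add_smul (smul_ne_zero hs.ne' hT) w using 1
  rw [norm_smul, hγ.norm_tangent, mul_one, Real.norm_of_nonneg hs.le, real_inner_smul_left,
    mul_div_cancel_left₀ _ hs.ne']

theorem intervalIntegrable_inner_normal [SecondCountableTopology E]
    (hγ : IsTurningCurve γ T ν S) {ξ : ℝ → E} (hξ : Continuous ξ) (a b : ℝ) :
    IntervalIntegrable (fun t => ⟪ν t, ξ t⟫) volume a b := by
  refine (hξ.norm.intervalIntegrable a b).mono_fun
    (hγ.stronglyMeasurable_normal.inner hξ.stronglyMeasurable).aestronglyMeasurable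
    (Eventually.of_forall fun t => ?_)
  simp only [norm_norm]
  exact (norm_inner_le_norm _ _).trans
    (mul_le_of_le_one_left (norm_nonneg _) (hγ.norm_normal_le t))

theorem exists_lengthVariation [SecondCountableTopology E]
    (hγ : IsTurningCurve γ T ν S) (hab : a ≤ b) :
    ∃ D : C(Icc a b, E) →L[ℝ] ℝ, ∀ ξ : C(Icc a b, E), D ξ =
      ⟪T b, ξ ⟨b, right_mem_Icc.2 hab⟩⟫ - ⟪T a, ξ ⟨a, left_mem_Icc.2 hab⟩⟫ -
        ∫ t in a..b, ⟪ν t, ξ (projIcc a b hab t)⟫ := by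
  have hint : ∀ ξ : C(Icc a b, E),
      IntervalIntegrable (fun t => ⟪ν t, ξ (projIcc a b hab t)⟫) volume a b := fun ξ =>
    hγ.intervalIntegrable_inner_normal (ξ.continuous.comp continuous_projIcc) a b
  let work : C(Icc a b, E) →ₗ[ℝ] ℝ :=
    { toFun := fun ξ => ∫ t in a..b, ⟪ν t, ξ (projIcc a b hab t)⟫
      map_add' := fun ξ ζ => by
        simp only [ContinuousMap.add_apply, inner_add_right]
        exact intervalIntegral.integral_add (hint ξ) (hint ζ)
      map_smul' := fun c ξ => by
        simp only [ContinuousMap.smul_apply, inner_smul_right, RingHom.id_apply, smul_eq_mul]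
        exact intervalIntegral.integral_const_mul _ _ }
  have hwork : ∀ ξ, ‖work ξ‖ ≤ |b - a| * ‖ξ‖ := fun ξ => by
    rw [mul_comm]
    exact intervalIntegral.norm_integral_le_of_norm_le_const fun t _ =>
      ((norm_inner_le_norm _ _).trans (mul_le_of_le_one_left (norm_nonneg _)
        (hγ.norm_normal_le t))).trans (ξ.norm_coe_le_norm _)
  exact ⟨(innerSL ℝ (T b)).comp (ContinuousMap.evalCLM ℝ (⟨b, right_mem_Icc.2 hab⟩ : Icc a b)) -
    (innerSL ℝ (T a)).comp (ContinuousMap.evalCLM ℝ (⟨a, left_mem_Icc.2 hab⟩ : Icc a b)) -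
    work.mkContinuous _ hwork, fun ξ => rfl⟩

theorem integral_inner_tangent_deriv [SecondCountableTopology E]
    (hγ : IsTurningCurve γ T ν S) (hab : a ≤ b) {η : ℝ → E} (hη : ContDiff ℝ 1 η) :
    ∫ t in a..b, ⟪T t, deriv η t⟫ =
      ⟪T b, η b⟫ - ⟪T a, η a⟫ - ∫ t in a..b, ⟪ν t, η t⟫ := by
  have hν := hγ.intervalIntegrable_inner_normal hη.continuous a b
  have hT : IntervalIntegrable (fun t => ⟪T t, deriv η t⟫) volume a b :=
    (hγ.continuous_tangent.inner (hη.continuous_deriv le_rfl)).intervalIntegrable a b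
  have hftc := integral_eq_of_hasDerivAt_off_countable_of_le (fun t => ⟪T t, η t⟫)
    (fun t => ⟪T t, deriv η t⟫ + ⟪ν t, η t⟫) hab hγ.countable
    (hγ.continuous_tangent.inner hη.continuous).continuousOn
    (fun t ht => (hγ.hasDerivAt_tangent t ht.2).inner ℝ
      (hη.differentiable one_ne_zero t).hasDerivAt) (hT.add hν)
  rw [intervalIntegral.integral_add hT hν] at hftc
  linarith

variable [CompleteSpace E]

theorem intervalIntegrable_deriv [SecondCountableTopology E]
    (hγ : IsTurningCurve γ T ν S) (a b : ℝ) : IntervalIntegrable (deriv γ) volume a b := by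
  obtain ⟨C, hvel⟩ := hγ.velocity
  refine (intervalIntegrable_const (c := C)).mono_fun
    (stronglyMeasurable_deriv γ).aestronglyMeasurable ?_
  filter_upwards [ae_restrict_of_ae (hγ.countable.ae_notMem volume)] with t ht
  obtain ⟨s, hs, hsC, hd⟩ := hvel t ht
  rw [hd.deriv, norm_smul, hγ.norm_tangent, mul_one, Real.norm_of_nonneg hs.le]
  exact hsC.trans (le_abs_self C)

theorem length_add_smul [SecondCountableTopology E]
    (hγ : IsTurningCurve γ T ν S) (hab : a ≤ b) {η : ℝ → E} (hη : ContDiff ℝ 1 η) (h : ℝ) :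
    (eVariationOn (fun t => γ t + h • η t) (Icc a b)).toReal =
      ∫ t in a..b, ‖deriv γ t + h • deriv η t‖ := by
  obtain ⟨C, hvel⟩ := hγ.velocity
  refine toReal_eVariationOn_eq_integral hab hγ.countable
    (hγ.continuous.add (hη.continuous.const_smul h)).continuousOn (fun t ht => ?_)
    ((hγ.intervalIntegrable_deriv a b).add
      (((hη.continuous_deriv le_rfl).const_smul h).intervalIntegrable a b))
  obtain ⟨s, -, -, hd⟩ := hvel t ht.2
  exact hd.differentiableAt.hasDerivAt.add
    ((hη.differentiable one_ne_zero t).hasDerivAt.const_smul h)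

theorem hasDerivAt_length [SecondCountableTopology E]
    (hγ : IsTurningCurve γ T ν S) (hab : a ≤ b) {η : ℝ → E} (hη : ContDiff ℝ 1 η) :
    HasDerivAt (fun h : ℝ => (eVariationOn (fun t => γ t + h • η t) (Icc a b)).toReal)
      (⟪T b, η b⟫ - ⟪T a, η a⟫ - ∫ t in a..b, ⟪ν t, η t⟫) 0 := by
  have hη' : Continuous (deriv η) := hη.continuous_deriv le_rfl
  have hlip : ∀ t : ℝ, LipschitzOnWith (Real.nnabs ‖deriv η t‖)
      (fun h : ℝ => ‖deriv γ t + h • deriv η t‖) univ := fun t => by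
    refine (LipschitzWith.of_dist_le_mul fun x y => ?_).lipschitzOnWith
    rw [Real.coe_nnabs, abs_norm, Real.dist_eq, Real.dist_eq]
    refine (abs_norm_sub_norm_le _ _).trans ?_
    rw [add_sub_add_left_eq_sub, ← sub_smul, norm_smul, Real.norm_eq_abs, mul_comm]
  simp only [hγ.length_add_smul hab hη, ← hγ.integral_inner_tangent_deriv hab hη]
  refine (intervalIntegral.hasDerivAt_integral_of_dominated_loc_of_lip
    (bound := fun t => ‖deriv η t‖) univ_mem
    (Eventually.of_forall fun h => ((stronglyMeasurable_deriv γ).add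
      (hη'.stronglyMeasurable.const_smul h)).norm.aestronglyMeasurable)
    (by simpa using (hγ.intervalIntegrable_deriv a b).norm)
    (hγ.continuous_tangent.inner hη').aestronglyMeasurable
    (Eventually.of_forall fun t _ => hlip t) (hη'.norm.intervalIntegrable a b) ?_).2
  filter_upwards [hγ.countable.ae_notMem volume] with t ht _
  exact hγ.hasDerivAt_norm_velocity ht (deriv η t)

end IsTurningCurve

theorem exists_isLengthVariation {ι κ : Type} [Fintype ι] {P : LinkProblem ι κ} {L : P.Arcs}
    {γ T ν : ι → ℝ → E3} {S : ι → Set ℝ} (hγ : ∀ i, IsTurningCurve (γ i) (T i) (ν i) (S i))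
    (hP : ∀ i, P.lo i ≤ P.hi i) (hL : ∀ i (t : P.Dom i), L i t = γ i t) :
    ∃ D : P.Field →L[ℝ] ℝ, IsLengthVariation P L D ∧ ∀ ξ : P.Field, D ξ =
      ∑ i, (⟪T i (P.hi i), ξ i ⟨P.hi i, right_mem_Icc.2 (hP i)⟩⟫ -
        ⟪T i (P.lo i), ξ i ⟨P.lo i, left_mem_Icc.2 (hP i)⟩⟫ -
        ∫ t in P.lo i..P.hi i, ⟪ν i t, ξ i (projIcc (P.lo i) (P.hi i) (hP i) t)⟫) := by
  choose D hD using fun i => (hγ i).exists_lengthVariation (hP i)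
  refine ⟨∑ i, (D i).comp (ContinuousLinearMap.proj i), fun ξ hξ => ?_, fun ξ => ?_⟩
  · simp only [len, _root_.sum_apply, ContinuousLinearMap.comp_apply,
      ContinuousLinearMap.proj_apply]
    refine HasDerivAt.fun_sum fun i _ => ?_
    obtain ⟨η, hη, hξη⟩ := hξ i
    have hmove : ∀ h, eVariationOn (move P L ξ h i) univ =
        eVariationOn (fun t => γ i t + h • η t) (Icc (P.lo i) (P.hi i)) := fun h => by
      rw [← eVariationOn_comp_val_univ fun t => γ i t + h • η t]
      refine congrArg (eVariationOn · univ) (funext fun t => ?_)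
      rw [move, hL, hξη]
    have hint : ∫ t in P.lo i..P.hi i, ⟪ν i t, ξ i (projIcc (P.lo i) (P.hi i) (hP i) t)⟫ =
        ∫ t in P.lo i..P.hi i, ⟪ν i t, η t⟫ := by
      refine intervalIntegral.integral_congr fun t ht => ?_
      rw [uIcc_of_le (hP i)] at ht
      simp only [hξη, projIcc_of_mem (hP i) ht]
    simp only [hmove]
    rw [hD, hint, hξη, hξη]
    exact (hγ i).hasDerivAt_length (hP i) hη
  · simp only [_root_.sum_apply, ContinuousLinearMap.comp_apply, ContinuousLinearMap.proj_apply, hD]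

end FirstVariation

/-! ### Balance implies criticality -/

section Minimum

variable {K : Type*} {F G : K → ℝ}

theorem concaveOn_iInf_add_mul [Nonempty K] (hbdd : ∀ h, BddBelow (range fun q => F q + h * G q)) :
    ConcaveOn ℝ univ fun h => ⨅ q, (F q + h * G q) := by
  refine ⟨convex_univ, fun x _ y _ c d hc hd hcd => le_ciInf fun q => ?_⟩
  have hx := mul_le_mul_of_nonneg_left (ciInf_le (hbdd x) q) hc
  have hy := mul_le_mul_of_nonneg_left (ciInf_le (hbdd y) q) hd
  simp only [smul_eq_mul]
  linear_combination hx + hy + F q * hcd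

theorem exists_hasDerivWithinAt_iInf_add_mul [Nonempty K]
    (hbdd : ∀ h, BddBelow (range fun q => F q + h * G q)) :
    ∃ d : ℝ, HasDerivWithinAt (fun h => ⨅ q, (F q + h * G q)) d (Ici 0) 0 ∧
      ∀ q, (∀ q', F q ≤ F q') → d ≤ G q := by
  have hdiff := (concaveOn_iInf_add_mul hbdd).neg.differentiableWithinAt_Ioi_of_mem_interior
    (x := 0) (by simp only [interior_univ, mem_univ])
  have hd := hdiff.neg.hasDerivWithinAt
  simp only [neg_neg] at hd
  refine ⟨_, hasDerivWithinAt_Ioi_iff_Ici.1 hd, fun q hq => ?_⟩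
  rw [hasDerivWithinAt_iff_tendsto_slope' self_notMem_Ioi] at hd
  refine le_of_tendsto hd (eventually_nhdsWithin_of_forall fun h (hh : 0 < h) => ?_)
  have hle := ciInf_le (hbdd h) q
  have hmin : F q ≤ ⨅ q', (F q' + 0 * G q') := le_ciInf fun q' => by
    simpa only [zero_mul, add_zero] using hq q'
  rw [slope_def_field, sub_zero, div_le_iff₀ hh]
  linarith

/-- A one-sided form of Danskin's theorem. The minimum of the first order approximations is concave
in `h`, so no compactness is needed. -/
theorem exists_hasDerivWithinAt_iInf {F : ℝ → K → ℝ}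
    (hbdd : ∀ h, BddBelow (range fun q => F 0 q + h * G q))
    (hFG : ∀ ε > 0, ∀ᶠ h in 𝓝 (0 : ℝ), ∀ q, |F h q - F 0 q - h * G q| ≤ ε * |h|) :
    ∃ d : ℝ, HasDerivWithinAt (fun h => ⨅ q, F h q) d (Ici 0) 0 ∧
      ∀ q, (∀ q', F 0 q ≤ F 0 q') → d ≤ G q := by
  cases isEmpty_or_nonempty K
  · simp only [Real.iInf_of_isEmpty]
    exact ⟨0, hasDerivWithinAt_const _ _ _, isEmptyElim⟩
  obtain ⟨d, hd, hdG⟩ := exists_hasDerivWithinAt_iInf_add_mul hbdd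
  have hF0 : ⨅ q, F 0 q = ⨅ q, (F 0 q + 0 * G q) := by simp only [zero_mul, add_zero]
  have herr : HasDerivWithinAt (fun h => (⨅ q, F h q) - ⨅ q, (F 0 q + h * G q)) 0 (Ici 0) 0 := by
    refine HasDerivAt.hasDerivWithinAt ?_
    rw [hasDerivAt_iff_isLittleO, Asymptotics.isLittleO_iff]
    intro ε hε
    filter_upwards [hFG ε hε] with h hh
    simp only [hF0, sub_self, sub_zero, smul_zero, Real.norm_eq_abs, abs_le]
    have hlow : ∀ q, (⨅ q, (F 0 q + h * G q)) - ε * |h| ≤ F h q := fun q => by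
      linarith [ciInf_le (hbdd h) q, (abs_le.1 (hh q)).1]
    have hup : (⨅ q, F h q) - ε * |h| ≤ ⨅ q, (F 0 q + h * G q) := le_ciInf fun q => by
      linarith [ciInf_le ⟨_, forall_mem_range.2 hlow⟩ q, (abs_le.1 (hh q)).2]
    exact ⟨by linarith [le_ciInf hlow], by linarith⟩
  exact ⟨d, by simpa only [sub_add_cancel, zero_add] using herr.fun_add hd, hdG⟩

end Minimum

section Expansion

variable {E : Type*} [NormedAddCommGroup E]

theorem eventually_nhds_abs_comp_add_smul_sub_le [NormedSpace ℝ E] {K : Type*} [TopologicalSpace K]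
    {f g : K → E} (hf : Continuous f) (hg : Continuous g) {φ : E → ℝ} (hφ : ContDiff ℝ 1 φ)
    {ε : ℝ} (hε : 0 < ε) (q₀ : K) :
    ∀ᶠ z in 𝓝 ((0 : ℝ), q₀), |φ (f z.2 + z.1 • g z.2) - φ (f z.2) -
      z.1 * fderiv ℝ φ (f z.2) (g z.2)| ≤ ε * |z.1| := by
  set c : ℝ := ‖g q₀‖ + 1
  have hc : 0 < c := by positivity
  have hε' : 0 < ε / (2 * c) := by positivity
  have hmoved : Tendsto (fun z : ℝ × K => f z.2 + z.1 • g z.2) (𝓝 (0, q₀)) (𝓝 (f q₀)) := by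
    have : Continuous fun z : ℝ × K => f z.2 + z.1 • g z.2 := by fun_prop
    simpa only [zero_smul, add_zero] using this.tendsto (0, q₀)
  have hstrict := (hφ.contDiffAt.hasStrictFDerivAt one_ne_zero).isLittleO.comp_tendsto
    (hmoved.prodMk_nhds ((hf.comp continuous_snd).tendsto (0, q₀)))
  have hg' : ∀ᶠ z in 𝓝 ((0 : ℝ), q₀), ‖g z.2‖ < c :=
    ((hg.comp continuous_snd).norm.tendsto (0, q₀)).eventually_lt_const (lt_add_one ‖g q₀‖)
  have hφ' : ∀ᶠ z in 𝓝 ((0 : ℝ), q₀), dist (fderiv ℝ φ (f z.2)) (fderiv ℝ φ (f q₀)) <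
      ε / (2 * c) := Metric.tendsto_nhds.1 ((((hφ.continuous_fderiv one_ne_zero).comp hf).comp
        continuous_snd).tendsto (0, q₀)) _ hε'
  filter_upwards [hstrict.def hε', hg', hφ'] with ⟨h, q⟩ h₁ h₂ h₃
  simp only [Function.comp_apply, add_sub_cancel_left, map_smul, smul_eq_mul, norm_smul,
    Real.norm_eq_abs, dist_eq_norm] at h₁ h₂ h₃
  have h₄ : |h * (fderiv ℝ φ (f q) - fderiv ℝ φ (f q₀)) (g q)| ≤ ε / (2 * c) * (|h| * ‖g q‖) := by
    rw [abs_mul, mul_left_comm]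
    exact mul_le_mul_of_nonneg_left ((ContinuousLinearMap.le_opNorm _ _).trans
      (mul_le_mul_of_nonneg_right h₃.le (norm_nonneg _))) (abs_nonneg h)
  rw [_root_.sub_apply, mul_sub, abs_sub_comm] at h₄
  calc _ ≤ ε / (2 * c) * (|h| * ‖g q‖) + ε / (2 * c) * (|h| * ‖g q‖) :=
        (abs_sub_le _ _ _).trans (add_le_add h₁ h₄)
    _ = ε / c * |h| * ‖g q‖ := by field_simp; ring
    _ ≤ ε / c * |h| * c := by gcongr
    _ = ε * |h| := by field_simp

variable [InnerProductSpace ℝ E]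

theorem abs_norm_add_smul_sub_le {f g : E} (hf : f ≠ 0) (h : ℝ) :
    |‖f + h • g‖ - ‖f‖ - h * (⟪g, f⟫ / ‖f‖)| ≤ ‖g‖ ^ 2 / ‖f‖ * h ^ 2 := by
  have hf0 : 0 < ‖f‖ := norm_pos_iff.2 hf
  have hsq : ‖f + h • g‖ ^ 2 = ‖f‖ ^ 2 + 2 * (h * ⟪g, f⟫) + h ^ 2 * ‖g‖ ^ 2 := by
    rw [norm_add_sq_real, inner_smul_right, norm_smul, mul_pow, Real.norm_eq_abs, sq_abs,
      real_inner_comm]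
  have hinner : ‖f‖ ^ 2 + h * ⟪g, f⟫ ≤ ‖f + h • g‖ * ‖f‖ := by
    have := real_inner_le_norm (f + h • g) f
    rwa [inner_add_left, inner_smul_left, real_inner_self_eq_norm_sq, RCLike.conj_to_real] at this
  have heq : ‖f + h • g‖ - ‖f‖ - h * (⟪g, f⟫ / ‖f‖) =
      (‖f + h • g‖ * ‖f‖ - ‖f‖ ^ 2 - h * ⟪g, f⟫) / ‖f‖ := by
    field_simp
  rw [heq, abs_of_nonneg (div_nonneg (by linarith) hf0.le), div_mul_eq_mul_div]
  refine div_le_div_of_nonneg_right ?_ hf0.le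
  nlinarith [sq_nonneg (‖f + h • g‖ - ‖f‖), mul_nonneg (sq_nonneg ‖g‖) (sq_nonneg h)]

theorem exists_hasDerivWithinAt_iInf_norm {K : Type*} {f g : K → E} {c M : ℝ} (hc : 0 < c)
    (hf : ∀ q, c ≤ ‖f q‖) (hg : ∀ q, ‖g q‖ ≤ M) :
    ∃ d : ℝ, HasDerivWithinAt (fun h : ℝ => ⨅ q, ‖f q + h • g q‖) d (Ici 0) 0 ∧
      ∀ q, ‖f q‖ = c → d * c ≤ ⟪g q, f q⟫ := by
  have hbdd : ∀ h : ℝ, BddBelow (range fun q => ‖f q + (0 : ℝ) • g q‖ + h * (⟪g q, f q⟫ / ‖f q‖)) :=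
    fun h => ⟨-(|h| * M), forall_mem_range.2 fun q => by
      have hcs : |⟪g q, f q⟫ / ‖f q‖| ≤ M := by
        rw [abs_div, abs_norm, div_le_iff₀ (hc.trans_le (hf q))]
        exact (abs_real_inner_le_norm _ _).trans
          (mul_le_mul_of_nonneg_right (hg q) (norm_nonneg _))
      have hmul := mul_le_mul_of_nonneg_left hcs (abs_nonneg h)
      rw [← abs_mul] at hmul
      linarith [neg_abs_le (h * (⟪g q, f q⟫ / ‖f q‖)), norm_nonneg (f q + (0 : ℝ) • g q)]⟩
  obtain ⟨d, hd, hdmin⟩ := exists_hasDerivWithinAt_iInf (F := fun (h : ℝ) q => ‖f q + h • g q‖) hbdd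
    fun ε hε => by
      have hsmall : ∀ᶠ h in 𝓝 (0 : ℝ), M ^ 2 / c * |h| < ε :=
        Continuous.tendsto' (by fun_prop) 0 0 (by simp) |>.eventually_lt_const hε
      filter_upwards [hsmall] with h hh q
      simp only [zero_smul, add_zero]
      calc _ ≤ ‖g q‖ ^ 2 / ‖f q‖ * h ^ 2 :=
            abs_norm_add_smul_sub_le (norm_pos_iff.1 (hc.trans_le (hf q))) h
        _ ≤ M ^ 2 / c * h ^ 2 := by
            gcongr
            exacts [hg q, hf q]
        _ = M ^ 2 / c * |h| * |h| := by rw [mul_assoc, ← sq, sq_abs]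
        _ ≤ ε * |h| := by gcongr
  refine ⟨d, hd, fun q hq => ?_⟩
  have hle := hdmin q fun q' => by simpa only [zero_smul, add_zero, hq] using hf q'
  rwa [hq, le_div_iff₀ hc] at hle

end Expansion

section Links

variable {ι κ : Type} {P : LinkProblem ι κ} {L : P.Arcs} {N : ℕ}

theorem exists_hasDerivWithinAt_obstacleMin [Finite ι] [Finite κ] (hL : IsGeneralizedLink P L)
    (ξ : P.Field) :
    ∃ d : ℝ, HasDerivWithinAt (fun h => obstacleMin P (move P L ξ h)) d (Ici 0) 0 := by
  let _ : TopologicalSpace κ := ⊥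
  have : DiscreteTopology κ := ⟨rfl⟩
  have hf : Continuous fun x : P.Point => L x.1 x.2 := continuous_sigma hL.continuous
  have hg : Continuous fun x : P.Point => ξ x.1 x.2 := continuous_sigma fun i => (ξ i).continuous
  let F : ℝ → κ × P.Point → ℝ := fun h q => P.obstacle q.1 (move P L ξ h q.2.1 q.2.2)
  let G : κ × P.Point → ℝ := fun q => fderiv ℝ (P.obstacle q.1) (L q.2.1 q.2.2) (ξ q.2.1 q.2.2)
  have hbdd : ∀ h, BddBelow (range fun q => F 0 q + h * G q) := fun h => by
    refine (isCompact_range (continuous_prod_of_discrete_left.2 fun j => ?_)).bddBelow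
    have hj := hL.obstacle_contDiff j
    simp only [F, G, move, zero_smul, add_zero]
    exact (hj.continuous.comp hf).add
      ((((hj.continuous_fderiv one_ne_zero).comp hf).clm_apply hg).const_mul h)
  have hrem : ∀ ε > 0, ∀ᶠ h in 𝓝 (0 : ℝ), ∀ q, |F h q - F 0 q - h * G q| ≤ ε * |h| :=
    fun ε hε => by
      have hj : ∀ j, ∀ᶠ h in 𝓝 (0 : ℝ), ∀ x ∈ univ, |F h (j, x) - F 0 (j, x) - h * G (j, x)| ≤
          ε * |h| := fun j => by
        simp only [F, G, move, zero_smul, add_zero]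
        exact isCompact_univ.eventually_forall_of_forall_eventually fun x _ =>
          eventually_nhds_abs_comp_add_smul_sub_le hf hg (hL.obstacle_contDiff j) hε x
      filter_upwards [eventually_all.2 hj] with h hh q using hh q.1 q.2 (mem_univ _)
  obtain ⟨d, hd, -⟩ := exists_hasDerivWithinAt_iInf hbdd hrem
  exact ⟨d, hd⟩

theorem gThi_le_dist {x y : P.Point} (hxy : x.1 ≠ y.1) :
    gThi P L ≤ dist (L x.1 x.2) (L y.1 y.2) :=
  ciInf_le (f := fun q : {q : P.Point × P.Point // q.1.1 ≠ q.2.1} =>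
    dist (L q.1.1.1 q.1.1.2) (L q.1.2.1 q.1.2.2))
    ⟨0, forall_mem_range.2 fun _ => dist_nonneg⟩ ⟨(x, y), hxy⟩

theorem norm_field_sub_le [Fintype ι] (ξ : P.Field) (x y : P.Point) :
    ‖ξ x.1 x.2 - ξ y.1 y.2‖ ≤ 2 * ‖ξ‖ := by
  have hle : ∀ x : P.Point, ‖ξ x.1 x.2‖ ≤ ‖ξ‖ := fun x =>
    ((ξ x.1).norm_coe_le_norm x.2).trans (norm_le_pi_norm ξ x.1)
  linarith [norm_sub_le (ξ x.1 x.2) (ξ y.1 y.2), hle x, hle y]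

theorem exists_hasDerivWithinAt_gThi [Finite ι] (hthi : 0 < gThi P L) (ξ : P.Field) :
    ∃ d : ℝ, HasDerivWithinAt (fun h => gThi P (move P L ξ h)) d (Ici 0) 0 ∧
      ∀ x y : P.Point, IsGStrut P L x y →
        d * gThi P L ≤ ⟪ξ x.1 x.2 - ξ y.1 y.2, L x.1 x.2 - L y.1 y.2⟫ := by
  cases nonempty_fintype ι
  obtain ⟨d, hd, hdle⟩ := exists_hasDerivWithinAt_iInf_norm
    (f := fun q : {q : P.Point × P.Point // q.1.1 ≠ q.2.1} => L q.1.1.1 q.1.1.2 - L q.1.2.1 q.1.2.2)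
    (g := fun q => ξ q.1.1.1 q.1.1.2 - ξ q.1.2.1 q.1.2.2) hthi
    (fun q => (gThi_le_dist q.2).trans_eq (dist_eq_norm _ _))
    fun q => norm_field_sub_le ξ q.1.1 q.1.2
  refine ⟨d, hd.congr_of_eventuallyEq (Eventually.of_forall fun h => ?_) ?_, fun x y hxy =>
    hdle ⟨(x, y), hxy.1⟩ ((dist_eq_norm _ _).symm.trans hxy.2)⟩
  all_goals
    refine iInf_congr fun q => ?_
    rw [dist_eq_norm, move, move, add_sub_add_comm, smul_sub]

theorem integral_sum_pos [NeZero N] {w : Fin N → ℝ → ℝ} {a b : ℝ} (hab : a < b)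
    (hw : ∀ k, ∀ r ∈ Ioo a b, 0 < w k r) (hwi : ∀ k, IntegrableOn (w k) (Ioo a b)) :
    0 < ∫ r in Ioo a b, ∑ k, w k r := by
  have hpos : ∀ r ∈ Ioo a b, 0 < ∑ k, w k r := fun r hr =>
    Finset.sum_pos (fun k _ => hw k r hr) ⟨0, Finset.mem_univ _⟩
  rw [setIntegral_pos_iff_support_of_nonneg_ae _ (integrable_finsetSum _ fun k _ => hwi k)]
  · refine lt_of_lt_of_le ?_ (measure_mono fun r hr => ⟨(hpos r hr).ne', hr⟩)
    simpa using hab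
  · filter_upwards [ae_restrict_mem measurableSet_Ioo] with r hr using (hpos r hr).le

variable [Fintype ι]

/-- The one-sided derivative of the thickness is at most that of each strut, and by balance the
strut derivatives average to a negative multiple of `δ_ξ Len`. -/
theorem BalancedByPolygons.stronglyCritical [Finite κ] [NeZero N]
    (hbal : BalancedByPolygons P L N) (hL : IsGeneralizedLink P L) (hthi : 0 < gThi P L) :
    StronglyCritical P L := by
  obtain ⟨D, hD, v, w, -, -, hstrut, hw, hwi, hDw⟩ := hbal
  set W := ∫ r in Ioo (0 : ℝ) 1, ∑ k, w k r with hW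
  have hWpos : 0 < W := integral_sum_pos one_pos hw hwi
  refine ⟨D, hD, 1 / (gThi P L * W), by positivity, fun ξ hξ hDξ => ?_⟩
  obtain ⟨d, hd, hdle⟩ := exists_hasDerivWithinAt_gThi hthi ξ
  obtain ⟨d', hd'⟩ := exists_hasDerivWithinAt_obstacleMin hL ξ
  refine ⟨d, d', hd, hd', (min_le_left _ _).trans ?_⟩
  rw [hDw ξ hξ] at hDξ
  have hint := not_imp_comm.1 integral_undef (hDξ.trans_ne (by norm_num))
  have hle : d * gThi P L * W ≤ -1 := by
    rw [← hDξ, hW, ← integral_const_mul]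
    refine setIntegral_mono_on ((integrable_finsetSum _ fun k _ => hwi k).const_mul _) hint
      measurableSet_Ioo fun r hr => ?_
    rw [Finset.mul_sum]
    refine Finset.sum_le_sum fun k _ => ?_
    rw [mul_comm]
    exact mul_le_mul_of_nonneg_left (hdle _ _ (hstrut k r hr)) (hw k r hr).le
  rw [← neg_div, le_div_iff₀ (by positivity), ← mul_assoc]
  exact hle

end Links

/-! ### The curved arc of a clasp curve -/

section ClaspCurve

variable {σ ρ r u t θ : ℝ}

/-- The parameter `w` with `|u| / σ + w / ρ = 1`: the struts from the points `±u` of the clasp curve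
end at the points `±w` of the clasped one. -/
def mate (σ ρ u : ℝ) : ℝ := ρ * (1 - |u| / σ)

/-- The derivative of `claspX` along the curved arc. -/
def claspSlope (σ ρ u : ℝ) : ℝ :=
  √((1 - mate σ ρ u ^ 2) / (1 - u ^ 2 * mate σ ρ u ^ 2)) + |u| / √(1 - mate σ ρ u ^ 2) *
    ((mate σ ρ u * (ρ / σ) * (1 - u ^ 2) + |u| * mate σ ρ u ^ 2 * (1 - mate σ ρ u ^ 2)) /
      ((1 - u ^ 2 * mate σ ρ u ^ 2) * √(1 - u ^ 2 * mate σ ρ u ^ 2)))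

theorem claspX_eq (σ ρ u : ℝ) :
    claspX σ ρ u = u * √((1 - mate σ ρ u ^ 2) / (1 - u ^ 2 * mate σ ρ u ^ 2)) := rfl

theorem mate_neg (σ ρ u : ℝ) : mate σ ρ (-u) = mate σ ρ u := by rw [mate, mate, abs_neg]

theorem claspX_neg (σ ρ u : ℝ) : claspX σ ρ (-u) = -claspX σ ρ u := by
  rw [claspX_eq, claspX_eq, mate_neg, neg_sq, neg_mul]

theorem claspSlope_neg (σ ρ u : ℝ) : claspSlope σ ρ (-u) = claspSlope σ ρ u := by
  rw [claspSlope, claspSlope, mate_neg, neg_sq, abs_neg]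

theorem claspX_zero (σ ρ : ℝ) : claspX σ ρ 0 = 0 := by simp [claspX]

theorem claspX_self (ρ : ℝ) (hσ : 0 ≤ σ) : claspX σ ρ σ = σ := by
  rcases hσ.eq_or_lt with rfl | h
  · exact claspX_zero 0 ρ
  · rw [claspX, abs_of_pos h, div_self h.ne']
    simp

theorem claspRise_zero (σ ρ : ℝ) : claspRise σ ρ 0 = 0 := intervalIntegral.integral_same

theorem mate_nonneg (hσ : 0 < σ) (hρ : 0 ≤ ρ) (hu : |u| ≤ σ) : 0 ≤ mate σ ρ u :=
  mul_nonneg hρ (sub_nonneg.2 ((div_le_one hσ).2 hu))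

theorem div_le_one_sub_mate_sq (hσ : 0 < σ) (hρ : ρ ∈ Icc (0 : ℝ) 1) (hu : |u| ≤ σ) :
    |u| / σ ≤ 1 - mate σ ρ u ^ 2 := by
  have h0 := mate_nonneg hσ hρ.1 hu
  have hq0 : 0 ≤ |u| / σ := by positivity
  have hq1 : |u| / σ ≤ 1 := (div_le_one hσ).2 hu
  have h1 : mate σ ρ u ≤ 1 - |u| / σ := mul_le_of_le_one_left (sub_nonneg.2 hq1) hρ.2
  nlinarith

theorem one_sub_mate_sq_nonneg (hσ : 0 < σ) (hρ : ρ ∈ Icc (0 : ℝ) 1) (hu : |u| ≤ σ) :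
    0 ≤ 1 - mate σ ρ u ^ 2 :=
  (by positivity : (0 : ℝ) ≤ |u| / σ).trans (div_le_one_sub_mate_sq hσ hρ hu)

theorem one_sub_mate_sq_pos (hσ : 0 < σ) (hρ : ρ ∈ Icc (0 : ℝ) 1) (hu : |u| ≤ σ) (hu0 : u ≠ 0) :
    0 < 1 - mate σ ρ u ^ 2 :=
  (div_pos (abs_pos.2 hu0) hσ).trans_le (div_le_one_sub_mate_sq hσ hρ hu)

theorem one_sub_sq_nonneg_of_abs_le (hσ : σ ≤ 1) (hu : |u| ≤ σ) : 0 ≤ 1 - u ^ 2 := by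
  rw [← sq_abs, sub_nonneg]
  exact pow_le_one₀ (abs_nonneg u) (hu.trans hσ)

theorem one_sub_sq_mul_mate_sq_pos (hσ : σ ∈ Ioc (0 : ℝ) 1) (hρ : ρ ∈ Icc (0 : ℝ) 1)
    (hu : |u| ≤ σ) : 0 < 1 - u ^ 2 * mate σ ρ u ^ 2 := by
  rcases eq_or_ne u 0 with rfl | h
  · simp
  · have h1 := one_sub_mate_sq_pos hσ.1 hρ hu h
    have h2 := one_sub_sq_nonneg_of_abs_le hσ.2 hu
    nlinarith [sq_nonneg (mate σ ρ u)]

theorem claspSlope_nonneg (hσ : σ ∈ Ioc (0 : ℝ) 1) (hρ : ρ ∈ Icc (0 : ℝ) 1) (hu : |u| ≤ σ) :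
    0 ≤ claspSlope σ ρ u := by
  have := hσ.1
  have := hρ.1
  have := mate_nonneg hσ.1 hρ.1 hu
  have := one_sub_mate_sq_nonneg hσ.1 hρ hu
  have := one_sub_sq_mul_mate_sq_pos hσ hρ hu
  have := one_sub_sq_nonneg_of_abs_le hσ.2 hu
  rw [claspSlope]
  positivity

theorem claspSlope_pos (hσ : σ ∈ Ioc (0 : ℝ) 1) (hρ : ρ ∈ Icc (0 : ℝ) 1) (hu : |u| ≤ σ)
    (hu0 : u ≠ 0) : 0 < claspSlope σ ρ u := by
  have := hσ.1
  have := hρ.1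
  have := mate_nonneg hσ.1 hρ.1 hu
  have := one_sub_mate_sq_pos hσ.1 hρ hu hu0
  have := one_sub_sq_mul_mate_sq_pos hσ hρ hu
  have := one_sub_sq_nonneg_of_abs_le hσ.2 hu
  rw [claspSlope]
  positivity

theorem continuous_mate (σ ρ : ℝ) : Continuous (mate σ ρ) := by
  unfold mate
  fun_prop

theorem abs_div_sqrt_le (hσ : 0 < σ) (hρ : ρ ∈ Icc (0 : ℝ) 1) (hu : |u| ≤ σ) :
    |u| / √(1 - mate σ ρ u ^ 2) ≤ √(σ * |u|) := by
  have h : |u| ≤ (1 - mate σ ρ u ^ 2) * σ :=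
    (div_le_iff₀ hσ).1 (div_le_one_sub_mate_sq hσ hρ hu)
  refine div_le_of_le_mul₀ (Real.sqrt_nonneg _) (Real.sqrt_nonneg _) ?_
  rw [← Real.sqrt_mul (by positivity)]
  exact Real.le_sqrt_of_sq_le (by nlinarith [abs_nonneg u])

-- For `ρ = 1` this is an indeterminate `0 / 0` at the tip `u = 0`.
theorem continuousOn_abs_div_sqrt (hσ : 0 < σ) (hρ : ρ ∈ Icc (0 : ℝ) 1) :
    ContinuousOn (fun u => |u| / √(1 - mate σ ρ u ^ 2)) (Icc (-σ) σ) := by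
  intro u hu
  rcases eq_or_ne u 0 with rfl | h
  · have hlim : Tendsto (fun u => √(σ * |u|)) (𝓝[Icc (-σ) σ] 0) (𝓝 0) := by
      have : Continuous fun u : ℝ => √(σ * |u|) := by fun_prop
      simpa using (this.tendsto 0).mono_left nhdsWithin_le_nhds
    rw [ContinuousWithinAt, abs_zero, zero_div]
    refine tendsto_of_tendsto_of_tendsto_of_le_of_le' tendsto_const_nhds hlim
      (Eventually.of_forall fun u => by positivity) ?_
    filter_upwards [self_mem_nhdsWithin] with u hu using abs_div_sqrt_le hσ hρ (abs_le.2 hu)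
  · refine ContinuousAt.continuousWithinAt (continuous_abs.continuousAt.div ?_ ?_)
    · exact (continuous_const.sub ((continuous_mate σ ρ).pow 2)).sqrt.continuousAt
    · exact (Real.sqrt_pos.2 (one_sub_mate_sq_pos hσ hρ (abs_le.2 hu) h)).ne'

theorem continuousOn_claspSlope (hσ : σ ∈ Ioc (0 : ℝ) 1) (hρ : ρ ∈ Icc (0 : ℝ) 1) :
    ContinuousOn (claspSlope σ ρ) (Icc (-σ) σ) := by
  have hm := continuous_mate σ ρ
  have hB : ∀ u ∈ Icc (-σ) σ, 0 < 1 - u ^ 2 * mate σ ρ u ^ 2 := fun u hu =>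
    one_sub_sq_mul_mate_sq_pos hσ hρ (abs_le.2 hu)
  refine ContinuousOn.add (ContinuousOn.sqrt (ContinuousOn.div ?_ ?_ fun u hu => (hB u hu).ne'))
    ((continuousOn_abs_div_sqrt hσ.1 hρ).mul (ContinuousOn.div ?_ ?_ fun u hu =>
      (mul_pos (hB u hu) (Real.sqrt_pos.2 (hB u hu))).ne'))
  all_goals exact Continuous.continuousOn (by fun_prop)

theorem hasDerivAt_mate (σ ρ : ℝ) (hu : 0 < u) : HasDerivAt (mate σ ρ) (-(ρ / σ)) u := by
  have h : HasDerivAt (fun x : ℝ => ρ * (1 - x / σ)) (ρ * (-(1 / σ))) u :=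
    (((hasDerivAt_id u).div_const σ).const_sub 1).const_mul ρ
  refine (h.congr_of_eventuallyEq ?_).congr_deriv (by ring)
  filter_upwards [lt_mem_nhds hu] with x hx
  rw [mate, abs_of_pos hx]

theorem hasDerivAt_claspX_of_pos (hσ : σ ∈ Ioc (0 : ℝ) 1) (hρ : ρ ∈ Icc (0 : ℝ) 1)
    (hu0 : 0 < u) (hu : |u| ≤ σ) : HasDerivAt (claspX σ ρ) (claspSlope σ ρ u) u := by
  have hA := one_sub_mate_sq_pos hσ.1 hρ hu hu0.ne'
  have hB := one_sub_sq_mul_mate_sq_pos hσ hρ hu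
  have hdw := hasDerivAt_mate σ ρ hu0
  have hdA := (hdw.pow 2).const_sub 1
  have hdB := (((hasDerivAt_id u).pow 2).mul (hdw.pow 2)).const_sub 1
  refine ((hasDerivAt_id u).mul ((hdA.div hdB hB.ne').sqrt (div_pos hA hB).ne')).congr_deriv ?_
  simp only [id, Pi.pow_apply, Pi.mul_apply, Pi.div_apply]
  rw [claspSlope, abs_of_pos hu0, Real.sqrt_div hA.le]
  generalize mate σ ρ u = w at *
  have ha : √(1 - w ^ 2) ^ 2 = 1 - w ^ 2 := Real.sq_sqrt hA.le
  have hb : √(1 - u ^ 2 * w ^ 2) ^ 2 = 1 - u ^ 2 * w ^ 2 := Real.sq_sqrt hB.le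
  have ha0 := Real.sqrt_pos.2 hA
  have hb0 := Real.sqrt_pos.2 hB
  rw [← ha, ← hb, Real.sqrt_sq ha0.le, Real.sqrt_sq hb0.le]
  generalize √(1 - w ^ 2) = a at ha ha0 ⊢
  generalize √(1 - u ^ 2 * w ^ 2) = b at hb hb0 ⊢
  have hab : b ^ 2 - u ^ 2 * a ^ 2 = 1 - u ^ 2 := by rw [ha, hb]; ring
  rw [← hab]
  push_cast
  field_simp
  ring

theorem hasDerivAt_claspX_zero (σ ρ : ℝ) : HasDerivAt (claspX σ ρ) (claspSlope σ ρ 0) 0 := by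
  have hc : ContinuousAt
      (fun u => √((1 - mate σ ρ u ^ 2) / (1 - u ^ 2 * mate σ ρ u ^ 2))) 0 := by
    have hm := continuous_mate σ ρ
    refine ContinuousAt.sqrt (ContinuousAt.div ?_ ?_ (by simp))
    all_goals exact Continuous.continuousAt (by fun_prop)
  have h0 : claspSlope σ ρ 0 = √((1 - mate σ ρ 0 ^ 2) / (1 - 0 ^ 2 * mate σ ρ 0 ^ 2)) := by
    simp [claspSlope]
  rw [hasDerivAt_iff_tendsto_slope, h0]
  refine (hc.tendsto.mono_left nhdsWithin_le_nhds).congr' ?_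
  filter_upwards [self_mem_nhdsWithin] with x (hx : x ≠ 0)
  rw [slope_def_field, claspX_zero, claspX_eq, sub_zero, sub_zero, mul_div_cancel_left₀ _ hx]

theorem hasDerivAt_claspX (hσ : σ ∈ Ioc (0 : ℝ) 1) (hρ : ρ ∈ Icc (0 : ℝ) 1) (hu : |u| ≤ σ) :
    HasDerivAt (claspX σ ρ) (claspSlope σ ρ u) u := by
  rcases lt_trichotomy u 0 with h | rfl | h
  · have hreflect := ((hasDerivAt_claspX_of_pos hσ hρ (neg_pos.2 h) (by rwa [abs_neg])).scomp u
      (hasDerivAt_neg u)).neg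
    rw [neg_smul, one_smul, neg_neg, claspSlope_neg] at hreflect
    exact hreflect.congr_of_eventuallyEq (.of_forall fun x => by
      simp only [Pi.neg_apply, Function.comp_apply, claspX_neg, neg_neg])
  · exact hasDerivAt_claspX_zero σ ρ
  · exact hasDerivAt_claspX_of_pos hσ hρ h hu

theorem abs_clamp_le (hr : 0 ≤ r) (t : ℝ) : |clamp r t| ≤ r :=
  abs_le.2 ⟨le_max_left _ _, max_le (by linarith) (min_le_left _ _)⟩

theorem clamp_of_abs_le (h : |t| ≤ r) : clamp r t = t := by
  rw [clamp, min_eq_right (abs_le.1 h).2, max_eq_right (abs_le.1 h).1]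

theorem clamp_of_le (hr : 0 ≤ r) (h : r ≤ t) : clamp r t = r := by
  rw [clamp, min_eq_left h, max_eq_right (by linarith)]

theorem clamp_neg (hr : 0 ≤ r) (t : ℝ) : clamp r (-t) = -clamp r t := by
  rw [clamp, clamp, max_min_distrib_left, max_eq_right (by linarith : -r ≤ r), max_neg_neg,
    ← min_neg_neg, neg_neg]

theorem continuous_clamp (r : ℝ) : Continuous (clamp r) := by
  unfold clamp
  fun_prop

theorem sin_le_of_le_arcsin (hσ : σ ∈ Icc (-1 : ℝ) 1) (ht : -(Real.pi / 2) ≤ t)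
    (htσ : t ≤ Real.arcsin σ) : Real.sin t ≤ σ :=
  (Real.sin_le_sin_of_le_of_le_pi_div_two ht (Real.arcsin_le_pi_div_two σ) htσ).trans_eq
    (Real.sin_arcsin hσ.1 hσ.2)

theorem abs_sin_le (hσ : σ ∈ Icc (0 : ℝ) 1) (ht : |t| ≤ Real.arcsin σ) : |Real.sin t| ≤ σ := by
  have hσ' : σ ∈ Icc (-1 : ℝ) 1 := ⟨by linarith [hσ.1], hσ.2⟩
  have hπ := Real.arcsin_le_pi_div_two σ
  obtain ⟨h1, h2⟩ := abs_le.1 ht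
  refine abs_le'.2 ⟨sin_le_of_le_arcsin hσ' (by linarith) h2, ?_⟩
  rw [← Real.sin_neg]
  exact sin_le_of_le_arcsin hσ' (by linarith) (by linarith)

/-- The speed of the parametrization of the clasp curve by its tangent angle, extended to the real
line by its values at the ends. -/
def arcSpeed (σ ρ t : ℝ) : ℝ := claspSlope σ ρ (Real.sin (clamp (Real.arcsin σ) t))

theorem continuous_arcSpeed (hσ : σ ∈ Ioc (0 : ℝ) 1) (hρ : ρ ∈ Icc (0 : ℝ) 1) :
    Continuous (arcSpeed σ ρ) :=
  (continuousOn_claspSlope hσ hρ).comp_continuous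
    (Real.continuous_sin.comp (continuous_clamp _)) fun t => abs_le.1 <|
    abs_sin_le (Ioc_subset_Icc_self hσ) (abs_clamp_le (Real.arcsin_nonneg.2 hσ.1.le) t)

theorem claspRise_eq (hσ : σ ∈ Ioc (0 : ℝ) 1) (hρ : ρ ∈ Icc (0 : ℝ) 1)
    (hθ : |θ| ≤ Real.arcsin σ) :
    claspRise σ ρ θ = ∫ φ in (0 : ℝ)..θ, arcSpeed σ ρ φ * Real.sin φ := by
  refine intervalIntegral.integral_congr fun φ hφ => ?_
  have hφ' : |φ| ≤ Real.arcsin σ := by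
    simpa using (abs_sub_left_of_mem_uIcc hφ).trans (by simpa using hθ)
  simp only [arcSpeed, clamp_of_abs_le hφ']
  rw [(hasDerivAt_claspX hσ hρ (abs_sin_le (Ioc_subset_Icc_self hσ) hφ')).deriv]

theorem hasDerivAt_integral_arcSpeed (hσ : σ ∈ Ioc (0 : ℝ) 1) (hρ : ρ ∈ Icc (0 : ℝ) 1) (θ : ℝ) :
    HasDerivAt (fun θ => ∫ φ in (0 : ℝ)..θ, arcSpeed σ ρ φ * Real.sin φ)
      (arcSpeed σ ρ θ * Real.sin θ) θ := by
  have hc := (continuous_arcSpeed hσ hρ).mul Real.continuous_sin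
  exact intervalIntegral.integral_hasDerivAt_right (hc.intervalIntegrable _ _)
    (hc.stronglyMeasurableAtFilter _ _) hc.continuousAt

theorem hasDerivAt_claspRise (hσ : σ ∈ Ioc (0 : ℝ) 1) (hρ : ρ ∈ Icc (0 : ℝ) 1)
    (hθ : |θ| < Real.arcsin σ) :
    HasDerivAt (claspRise σ ρ) (claspSlope σ ρ (Real.sin θ) * Real.sin θ) θ := by
  have h := hasDerivAt_integral_arcSpeed hσ hρ θ
  rw [arcSpeed, clamp_of_abs_le hθ.le] at h
  refine h.congr_of_eventuallyEq ?_
  filter_upwards [continuous_abs.continuousAt.eventually_lt_const hθ] with x hx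
  exact claspRise_eq hσ hρ hx.le

theorem continuousOn_claspRise (hσ : σ ∈ Ioc (0 : ℝ) 1) (hρ : ρ ∈ Icc (0 : ℝ) 1) :
    ContinuousOn (claspRise σ ρ) (Icc (-Real.arcsin σ) (Real.arcsin σ)) :=
  (continuous_iff_continuousAt.2 fun θ =>
    (hasDerivAt_integral_arcSpeed hσ hρ θ).continuousAt).continuousOn.congr fun _ hθ =>
    claspRise_eq hσ hρ (abs_le.2 hθ)

theorem deriv_claspX_neg (σ ρ u : ℝ) : deriv (claspX σ ρ) (-u) = deriv (claspX σ ρ) u := by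
  have h := deriv_comp_neg (claspX σ ρ) u
  rw [funext (claspX_neg σ ρ), deriv.fun_neg] at h
  exact (neg_injective h).symm

theorem claspRise_neg (σ ρ θ : ℝ) : claspRise σ ρ (-θ) = claspRise σ ρ θ := by
  have := intervalIntegral.integral_comp_neg (a := 0) (b := θ)
    fun φ => deriv (claspX σ ρ) (Real.sin φ) * Real.sin φ
  simp only [Real.sin_neg, deriv_claspX_neg, neg_zero] at this
  rw [claspRise, claspRise, intervalIntegral.integral_symm, ← this,
    ← intervalIntegral.integral_neg]
  simp only [mul_neg, neg_neg]

theorem abs_le_of_mem_Icc_zero (h : t ∈ Icc 0 r) : |t| ≤ r := by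
  rw [abs_of_nonneg h.1]
  exact h.2

theorem sin_nonneg_of_mem_Icc_arcsin (h : t ∈ Icc 0 (Real.arcsin σ)) : 0 ≤ Real.sin t :=
  Real.sin_nonneg_of_nonneg_of_le_pi h.1
    (by linarith [h.2, Real.arcsin_le_pi_div_two σ, Real.pi_pos])

theorem monotoneOn_claspRise (hσ : σ ∈ Ioc (0 : ℝ) 1) (hρ : ρ ∈ Icc (0 : ℝ) 1) :
    MonotoneOn (claspRise σ ρ) (Icc 0 (Real.arcsin σ)) := by
  have hsub : Icc 0 (Real.arcsin σ) ⊆ Icc (-Real.arcsin σ) (Real.arcsin σ) :=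
    fun θ hθ => abs_le.1 (abs_le_of_mem_Icc_zero hθ)
  refine monotoneOn_of_hasDerivWithinAt_nonneg
    (f' := fun θ => claspSlope σ ρ (Real.sin θ) * Real.sin θ) (convex_Icc _ _)
    ((continuousOn_claspRise hσ hρ).mono hsub) (fun θ hθ => ?_) fun θ hθ => ?_
  all_goals rw [interior_Icc] at hθ
  · have hlt : |θ| < Real.arcsin σ := by
      rw [abs_of_pos hθ.1]
      exact hθ.2
    exact (hasDerivAt_claspRise hσ hρ hlt).hasDerivWithinAt
  · have hθ' := Ioo_subset_Icc_self hθ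
    exact mul_nonneg (claspSlope_nonneg hσ hρ (abs_sin_le (Ioc_subset_Icc_self hσ)
      (abs_le_of_mem_Icc_zero hθ'))) (sin_nonneg_of_mem_Icc_arcsin hθ')

theorem claspRise_nonneg (hσ : σ ∈ Ioc (0 : ℝ) 1) (hρ : ρ ∈ Icc (0 : ℝ) 1)
    (h : θ ∈ Icc 0 (Real.arcsin σ)) : 0 ≤ claspRise σ ρ θ := by
  have := monotoneOn_claspRise hσ hρ ⟨le_rfl, h.1.trans h.2⟩ h h.1
  rwa [claspRise_zero] at this

end ClaspCurve

/-! ### The struts between two clasped curves -/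

section Struts

variable {σ ρ q r s t θ : ℝ}

theorem mul_mem_Icc_of_mem_unitInterval (hσ : 0 ≤ σ) (hr : r ∈ Icc (0 : ℝ) 1) :
    σ * r ∈ Icc 0 σ :=
  ⟨mul_nonneg hσ hr.1, mul_le_of_le_one_right hσ hr.2⟩

theorem one_sub_mem_Icc (hr : r ∈ Icc (0 : ℝ) 1) : 1 - r ∈ Icc (0 : ℝ) 1 :=
  ⟨by linarith [hr.2], by linarith [hr.1]⟩

theorem one_sub_mem_Ioo (hr : r ∈ Ioo (0 : ℝ) 1) : 1 - r ∈ Ioo (0 : ℝ) 1 :=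
  ⟨by linarith [hr.2], by linarith [hr.1]⟩

theorem one_sub_mul_sq_nonneg (hσ : σ ∈ Icc (0 : ℝ) 1) (hr : r ∈ Icc (0 : ℝ) 1) :
    0 ≤ 1 - (σ * r) ^ 2 :=
  one_sub_sq_nonneg_of_abs_le hσ.2
    (abs_le_of_mem_Icc_zero (mul_mem_Icc_of_mem_unitInterval hσ.1 hr))

theorem one_sub_mul_sq_pos (hσ : σ ∈ Ioc (0 : ℝ) 1) (hr : r ∈ Ioo (0 : ℝ) 1) :
    0 < 1 - (σ * r) ^ 2 :=
  sub_pos.2 <| pow_lt_one₀ (mul_nonneg hσ.1.le hr.1.le)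
    ((mul_lt_of_lt_one_right hσ.1 hr.2).trans_le hσ.2) two_ne_zero

theorem mate_mul (hσ : 0 < σ) (hr : 0 ≤ r) : mate σ ρ (σ * r) = ρ * (1 - r) := by
  rw [mate, abs_of_nonneg (by positivity), mul_div_cancel_left₀ _ hσ.ne']

theorem one_sub_sq_mul_sq_pos (hσ : σ ∈ Ioc (0 : ℝ) 1) (hρ : ρ ∈ Ioc (0 : ℝ) 1)
    (hr : r ∈ Icc (0 : ℝ) 1) : 0 < 1 - (σ * r) ^ 2 * (ρ * (1 - r)) ^ 2 := by
  rw [← mate_mul hσ.1 hr.1]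
  exact one_sub_sq_mul_mate_sq_pos hσ (Ioc_subset_Icc_self hρ)
    (abs_le_of_mem_Icc_zero (mul_mem_Icc_of_mem_unitInterval hσ.1.le hr))

/-- The difference in height of the endpoints of the strut joining the point `u = σ r` of the
`σ`-curve to its mate `w = ρ (1 - r)` on the `ρ`-curve. -/
def strutHeight (σ ρ r : ℝ) : ℝ :=
  √((1 - (σ * r) ^ 2) * (1 - (ρ * (1 - r)) ^ 2) / (1 - (σ * r) ^ 2 * (ρ * (1 - r)) ^ 2))

/-- The height above the tip of the point `u = σ r` of the `σ`-curve. -/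
def strutRise (σ ρ r : ℝ) : ℝ := claspRise σ ρ (Real.arcsin (σ * r))

theorem strutHeight_one_sub (σ ρ r : ℝ) : strutHeight ρ σ (1 - r) = strutHeight σ ρ r := by
  rw [strutHeight, strutHeight, sub_sub_cancel, mul_comm (1 - (ρ * (1 - r)) ^ 2),
    mul_comm ((ρ * (1 - r)) ^ 2)]

theorem strutHeight_pos (hσ : σ ∈ Ioc (0 : ℝ) 1) (hρ : ρ ∈ Ioc (0 : ℝ) 1)
    (hr : r ∈ Ioo (0 : ℝ) 1) : 0 < strutHeight σ ρ r :=
  Real.sqrt_pos.2 (div_pos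
    (mul_pos (one_sub_mul_sq_pos hσ hr) (one_sub_mul_sq_pos hρ (one_sub_mem_Ioo hr)))
    (one_sub_sq_mul_sq_pos hσ hρ (Ioo_subset_Icc_self hr)))

theorem claspX_mul_sqrt (hσ : σ ∈ Ioc (0 : ℝ) 1) (ρ : ℝ) (hr : r ∈ Icc (0 : ℝ) 1) :
    claspX σ ρ (σ * r) * √(1 - (σ * r) ^ 2) = σ * r * strutHeight σ ρ r := by
  rw [claspX_eq, mate_mul hσ.1 hr.1, strutHeight, mul_div_assoc,
    Real.sqrt_mul (one_sub_mul_sq_nonneg (Ioc_subset_Icc_self hσ) hr)]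
  ring

theorem claspX_eq_mul_strutHeight (hσ : σ ∈ Ioc (0 : ℝ) 1) (ρ : ℝ) (hr : r ∈ Ioo (0 : ℝ) 1) :
    claspX σ ρ (σ * r) = σ * r * strutHeight σ ρ r / √(1 - (σ * r) ^ 2) := by
  rw [eq_div_iff (Real.sqrt_pos.2 (one_sub_mul_sq_pos hσ hr)).ne',
    claspX_mul_sqrt hσ ρ (Ioo_subset_Icc_self hr)]

/-- The struts have length one. -/
theorem claspX_sq_add_claspX_sq (hσ : σ ∈ Ioc (0 : ℝ) 1) (hρ : ρ ∈ Ioc (0 : ℝ) 1)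
    (hr : r ∈ Icc (0 : ℝ) 1) :
    claspX σ ρ (σ * r) ^ 2 + claspX ρ σ (ρ * (1 - r)) ^ 2 + strutHeight σ ρ r ^ 2 = 1 := by
  have h1 := one_sub_mul_sq_nonneg (Ioc_subset_Icc_self hσ) hr
  have h2 := one_sub_mul_sq_nonneg (Ioc_subset_Icc_self hρ) (one_sub_mem_Icc hr)
  have h3 := one_sub_sq_mul_sq_pos hσ hρ hr
  rw [claspX_eq, claspX_eq, mate_mul hσ.1 hr.1, mate_mul hρ.1 (one_sub_mem_Icc hr).1, strutHeight,
    sub_sub_cancel]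
  generalize σ * r = u at *
  generalize ρ * (1 - r) = w at *
  rw [mul_comm (w ^ 2) (u ^ 2), mul_pow, mul_pow, Real.sq_sqrt (div_nonneg h2 h3.le),
    Real.sq_sqrt (div_nonneg h1 h3.le), Real.sq_sqrt (div_nonneg (mul_nonneg h1 h2) h3.le)]
  field_simp
  ring

theorem strutHeight_eq_sqrt (hσ : σ ∈ Ioc (0 : ℝ) 1) (hρ : ρ ∈ Ioc (0 : ℝ) 1)
    (hr : r ∈ Icc (0 : ℝ) 1) :
    strutHeight σ ρ r = √(1 - (claspX σ ρ (σ * r) ^ 2 + claspX ρ σ (ρ * (1 - r)) ^ 2)) := by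
  rw [← eq_sub_of_add_eq' (claspX_sq_add_claspX_sq hσ hρ hr)]
  exact (Real.sqrt_sq (Real.sqrt_nonneg _)).symm

theorem hasDerivAt_claspX_mul (hσ : σ ∈ Ioc (0 : ℝ) 1) (hρ : ρ ∈ Icc (0 : ℝ) 1)
    (hr : r ∈ Icc (0 : ℝ) 1) :
    HasDerivAt (fun r => claspX σ ρ (σ * r)) (claspSlope σ ρ (σ * r) * σ) r := by
  have h := (hasDerivAt_claspX hσ hρ (abs_le_of_mem_Icc_zero
    (mul_mem_Icc_of_mem_unitInterval hσ.1.le hr))).comp r ((hasDerivAt_id r).const_mul σ)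
  rwa [mul_one] at h

theorem hasDerivAt_strutHeight (hσ : σ ∈ Ioc (0 : ℝ) 1) (hρ : ρ ∈ Ioc (0 : ℝ) 1)
    (hr : r ∈ Ioo (0 : ℝ) 1) :
    HasDerivAt (strutHeight σ ρ)
      (claspSlope ρ σ (ρ * (1 - r)) * (ρ * (1 - r)) * (ρ / √(1 - (ρ * (1 - r)) ^ 2)) -
        claspSlope σ ρ (σ * r) * (σ * r) * (σ / √(1 - (σ * r) ^ 2))) r := by
  have hr' := Ioo_subset_Icc_self hr
  have hX := hasDerivAt_claspX_mul hσ (Ioc_subset_Icc_self hρ) hr'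
  have hY : HasDerivAt (fun x => claspX ρ σ (ρ * (1 - x)))
      (-(claspSlope ρ σ (ρ * (1 - r)) * ρ)) r :=
    (hasDerivAt_claspX_mul hρ (Ioc_subset_Icc_self hσ) (one_sub_mem_Icc hr')).comp_const_sub 1 r
  have hH := strutHeight_pos hσ hρ hr
  have hsq : 1 - (claspX σ ρ (σ * r) ^ 2 + claspX ρ σ (ρ * (1 - r)) ^ 2) ≠ 0 := by
    have := claspX_sq_add_claspX_sq hσ hρ hr'
    nlinarith
  refine ((((hX.pow 2).add (hY.pow 2)).const_sub 1).sqrt hsq |>.congr_of_eventuallyEq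
    ?_).congr_deriv ?_
  · filter_upwards [Ioo_mem_nhds hr.1 hr.2] with x hx
    exact strutHeight_eq_sqrt hσ hρ (Ioo_subset_Icc_self hx)
  · simp only [Pi.add_apply, Pi.pow_apply]
    rw [← strutHeight_eq_sqrt hσ hρ hr', claspX_eq_mul_strutHeight hσ ρ hr,
      claspX_eq_mul_strutHeight hρ σ (one_sub_mem_Ioo hr), strutHeight_one_sub]
    push_cast
    field_simp
    ring

theorem hasDerivAt_arcsin_mul (hσ : σ ∈ Ioc (0 : ℝ) 1) (hr : r ∈ Ioo (0 : ℝ) 1) :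
    HasDerivAt (fun r => Real.arcsin (σ * r)) (σ / √(1 - (σ * r) ^ 2)) r := by
  have hlt := abs_lt.1 ((sq_lt_one_iff_abs_lt_one _).1 (sub_pos.1 (one_sub_mul_sq_pos hσ hr)))
  refine ((Real.hasDerivAt_arcsin hlt.1.ne' hlt.2.ne).comp r
    ((hasDerivAt_id r).const_mul σ)).congr_deriv ?_
  rw [mul_one, one_div_mul_eq_div]

theorem arcsin_mul_mem (hσ : 0 ≤ σ) (hr : r ∈ Icc (0 : ℝ) 1) :
    Real.arcsin (σ * r) ∈ Icc 0 (Real.arcsin σ) :=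
  ⟨Real.arcsin_nonneg.2 (mul_nonneg hσ hr.1),
    Real.monotone_arcsin (mul_le_of_le_one_right hσ hr.2)⟩

theorem sin_arcsin_mul (hσ : σ ∈ Icc (0 : ℝ) 1) (hr : r ∈ Icc (0 : ℝ) 1) :
    Real.sin (Real.arcsin (σ * r)) = σ * r := by
  have h := mul_mem_Icc_of_mem_unitInterval hσ.1 hr
  exact Real.sin_arcsin (by linarith [h.1]) (h.2.trans hσ.2)

theorem exists_arcsin_mul_eq (hσ : σ ∈ Ioc (0 : ℝ) 1) (ht : t ∈ Icc 0 (Real.arcsin σ)) :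
    ∃ r ∈ Icc (0 : ℝ) 1, Real.arcsin (σ * r) = t := by
  have hsin : Real.sin t ≤ σ :=
    (le_abs_self _).trans (abs_sin_le (Ioc_subset_Icc_self hσ) (abs_le_of_mem_Icc_zero ht))
  refine ⟨Real.sin t / σ, ⟨div_nonneg (sin_nonneg_of_mem_Icc_arcsin ht) hσ.1.le,
    (div_le_one hσ.1).2 hsin⟩, ?_⟩
  rw [mul_div_cancel₀ _ hσ.1.ne']
  exact Real.arcsin_sin (by linarith [ht.1, Real.pi_pos])
    (ht.2.trans (Real.arcsin_le_pi_div_two σ))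

theorem hasDerivAt_strutRise (hσ : σ ∈ Ioc (0 : ℝ) 1) (hρ : ρ ∈ Icc (0 : ℝ) 1)
    (hr : r ∈ Ioo (0 : ℝ) 1) :
    HasDerivAt (strutRise σ ρ) (claspSlope σ ρ (σ * r) * (σ * r) * (σ / √(1 - (σ * r) ^ 2))) r := by
  have h0 : 0 < σ * r := mul_pos hσ.1 hr.1
  have h1 : σ * r < σ := mul_lt_of_lt_one_right hσ.1 hr.2
  have hlt : |Real.arcsin (σ * r)| < Real.arcsin σ := by
    rw [abs_of_nonneg (Real.arcsin_nonneg.2 h0.le)]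
    exact Real.strictMonoOn_arcsin ⟨by linarith, by linarith [hσ.2]⟩ ⟨by linarith, hσ.2⟩ h1
  have h := (hasDerivAt_claspRise hσ hρ hlt).comp r (hasDerivAt_arcsin_mul hσ hr)
  rwa [sin_arcsin_mul (Ioc_subset_Icc_self hσ) (Ioo_subset_Icc_self hr)] at h

theorem continuousOn_strutRise (hσ : σ ∈ Ioc (0 : ℝ) 1) (hρ : ρ ∈ Icc (0 : ℝ) 1) :
    ContinuousOn (strutRise σ ρ) (Icc 0 1) :=
  (continuousOn_claspRise hσ hρ).comp
    (Real.continuous_arcsin.comp (continuous_const.mul continuous_id)).continuousOn fun _ hr =>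
    abs_le.1 (abs_le_of_mem_Icc_zero (arcsin_mul_mem hσ.1.le hr))

theorem monotoneOn_strutRise (hσ : σ ∈ Ioc (0 : ℝ) 1) (hρ : ρ ∈ Icc (0 : ℝ) 1) :
    MonotoneOn (strutRise σ ρ) (Icc 0 1) := fun _ hr _ hs hrs =>
  monotoneOn_claspRise hσ hρ (arcsin_mul_mem hσ.1.le hr) (arcsin_mul_mem hσ.1.le hs)
    (Real.monotone_arcsin (mul_le_mul_of_nonneg_left hrs hσ.1.le))

theorem continuousOn_strutHeight (hσ : σ ∈ Ioc (0 : ℝ) 1) (hρ : ρ ∈ Ioc (0 : ℝ) 1) :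
    ContinuousOn (strutHeight σ ρ) (Icc 0 1) :=
  ContinuousOn.sqrt (ContinuousOn.div (Continuous.continuousOn (by fun_prop))
    (Continuous.continuousOn (by fun_prop)) fun _ hr => (one_sub_sq_mul_sq_pos hσ hρ hr).ne')

theorem tipGap_eq (σ ρ : ℝ) :
    tipGap σ ρ = strutRise σ ρ 0 + strutRise ρ σ (1 - 0) + strutHeight σ ρ 0 := by
  simp [tipGap, strutRise, strutHeight, claspRise_zero, add_comm]

theorem tipGap_sub_strutRise (hσ : σ ∈ Ioc (0 : ℝ) 1) (hρ : ρ ∈ Ioc (0 : ℝ) 1)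
    (hr : r ∈ Icc (0 : ℝ) 1) :
    tipGap σ ρ - strutRise σ ρ r - strutRise ρ σ (1 - r) = strutHeight σ ρ r := by
  -- The three heights have a constant sum, since its derivative vanishes.
  set f : ℝ → ℝ := fun r => strutRise σ ρ r + strutRise ρ σ (1 - r) + strutHeight σ ρ r with hf
  have hσ' := Ioc_subset_Icc_self hσ
  have hρ' := Ioc_subset_Icc_self hρ
  have hcont : ContinuousOn f (Icc 0 1) :=
    ((continuousOn_strutRise hσ hρ').add ((continuousOn_strutRise hρ hσ').comp
      (continuous_const.sub continuous_id).continuousOn fun r hr => one_sub_mem_Icc hr)).add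
      (continuousOn_strutHeight hσ hρ)
  have hderiv : ∀ x ∈ Ioo (0 : ℝ) 1, HasDerivAt f 0 x := fun x hx =>
    (((hasDerivAt_strutRise hσ hρ' hx).add ((hasDerivAt_strutRise hρ hσ'
      (one_sub_mem_Ioo hx)).comp_const_sub 1 x)).add
      (hasDerivAt_strutHeight hσ hρ hx)).congr_deriv (by ring)
  have hconst : f r = f 0 := by
    have h := integral_eq_of_hasDerivAt_off_countable_of_le f (fun _ => 0) hr.1
      countable_empty (hcont.mono (Icc_subset_Icc_right hr.2))
      (fun x hx => hderiv x ⟨hx.1.1, hx.1.2.trans_le hr.2⟩) (by simp)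
    rw [intervalIntegral.integral_zero] at h
    linarith
  rw [tipGap_eq]
  simp only [hf] at hconst
  linarith

/-- The squared distance between the point `u = σ r` of the `σ`-curve and the point `u = ρ q` of
the `ρ`-curve it is clasped with. -/
def sqDistArcs (σ ρ r q : ℝ) : ℝ :=
  claspX σ ρ (σ * r) ^ 2 + claspX ρ σ (ρ * q) ^ 2 +
    (tipGap σ ρ - strutRise σ ρ r - strutRise ρ σ q) ^ 2

theorem sqDistArcs_one_sub (hσ : σ ∈ Ioc (0 : ℝ) 1) (hρ : ρ ∈ Ioc (0 : ℝ) 1)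
    (hr : r ∈ Icc (0 : ℝ) 1) : sqDistArcs σ ρ r (1 - r) = 1 := by
  rw [sqDistArcs, tipGap_sub_strutRise hσ hρ hr, claspX_sq_add_claspX_sq hσ hρ hr]

theorem hasDerivAt_sqDistArcs (hσ : σ ∈ Ioc (0 : ℝ) 1) (hρ : ρ ∈ Ioc (0 : ℝ) 1) (r : ℝ)
    (hq : q ∈ Ioo (0 : ℝ) 1) :
    HasDerivAt (sqDistArcs σ ρ r)
      (2 * (claspSlope ρ σ (ρ * q) * (ρ * q) * (ρ / √(1 - (ρ * q) ^ 2))) *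
        (strutRise σ ρ r - strutRise σ ρ (1 - q))) q := by
  have hq' := Ioo_subset_Icc_self hq
  have hX := (hasDerivAt_claspX_mul hρ (Ioc_subset_Icc_self hσ) hq').pow 2
  have hZ := ((hasDerivAt_strutRise hρ (Ioc_subset_Icc_self hσ) hq).const_sub
    (tipGap σ ρ - strutRise σ ρ r)).pow 2
  have hgap := tipGap_sub_strutRise hσ hρ (one_sub_mem_Icc hq')
  rw [sub_sub_cancel, ← strutHeight_one_sub, sub_sub_cancel] at hgap
  refine ((hX.const_add (claspX σ ρ (σ * r) ^ 2)).add hZ).congr_deriv ?_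
  rw [claspX_eq_mul_strutHeight hρ σ hq, ← hgap]
  push_cast
  ring

theorem continuousOn_sqDistArcs (hσ : σ ∈ Ioc (0 : ℝ) 1) (hρ : ρ ∈ Ioc (0 : ℝ) 1) (r : ℝ) :
    ContinuousOn (sqDistArcs σ ρ r) (Icc 0 1) := by
  have hX : ContinuousOn (fun q => claspX ρ σ (ρ * q)) (Icc 0 1) := fun q hq =>
    (hasDerivAt_claspX_mul hρ (Ioc_subset_Icc_self hσ) hq).continuousAt.continuousWithinAt
  exact (continuousOn_const.add (hX.pow 2)).add
    ((continuousOn_const.sub (continuousOn_strutRise hρ (Ioc_subset_Icc_self hσ))).pow 2)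

theorem one_le_sqDistArcs (hσ : σ ∈ Ioc (0 : ℝ) 1) (hρ : ρ ∈ Ioc (0 : ℝ) 1)
    (hr : r ∈ Icc (0 : ℝ) 1) (hq : q ∈ Icc (0 : ℝ) 1) : 1 ≤ sqDistArcs σ ρ r q := by
  have hmono := monotoneOn_strutRise hσ (Ioc_subset_Icc_self hρ)
  have hcont := continuousOn_sqDistArcs hσ hρ r
  have hfactor : ∀ x ∈ Ioo (0 : ℝ) 1,
      0 ≤ 2 * (claspSlope ρ σ (ρ * x) * (ρ * x) * (ρ / √(1 - (ρ * x) ^ 2))) := fun x hx => by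
    have hmem := mul_mem_Icc_of_mem_unitInterval hρ.1.le (Ioo_subset_Icc_self hx)
    have hslope := claspSlope_nonneg hρ (Ioc_subset_Icc_self hσ) (abs_le_of_mem_Icc_zero hmem)
    exact mul_nonneg zero_le_two
      (mul_nonneg (mul_nonneg hslope hmem.1) (div_nonneg hρ.1.le (Real.sqrt_nonneg _)))
  have hr' := one_sub_mem_Icc hr
  rw [← sqDistArcs_one_sub hσ hρ hr]
  rcases le_total q (1 - r) with hle | hle
  · have hanti : AntitoneOn (sqDistArcs σ ρ r) (Icc 0 (1 - r)) := by
      refine antitoneOn_of_deriv_nonpos (convex_Icc _ _)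
        (hcont.mono (Icc_subset_Icc_right hr'.2)) (fun x hx => ?_) fun x hx => ?_
      all_goals
        rw [interior_Icc] at hx
        have hx' : x ∈ Ioo (0 : ℝ) 1 := ⟨hx.1, hx.2.trans_le hr'.2⟩
      · exact (hasDerivAt_sqDistArcs hσ hρ r hx').differentiableAt.differentiableWithinAt
      · rw [(hasDerivAt_sqDistArcs hσ hρ r hx').deriv]
        exact mul_nonpos_of_nonneg_of_nonpos (hfactor x hx') (sub_nonpos.2
          (hmono hr (one_sub_mem_Icc (Ioo_subset_Icc_self hx')) (by linarith [hx.2])))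
    exact hanti ⟨hq.1, hle⟩ ⟨hr'.1, le_rfl⟩ hle
  · have hmon : MonotoneOn (sqDistArcs σ ρ r) (Icc (1 - r) 1) := by
      refine monotoneOn_of_deriv_nonneg (convex_Icc _ _)
        (hcont.mono (Icc_subset_Icc_left hr'.1)) (fun x hx => ?_) fun x hx => ?_
      all_goals
        rw [interior_Icc] at hx
        have hx' : x ∈ Ioo (0 : ℝ) 1 := ⟨hr'.1.trans_lt hx.1, hx.2⟩
      · exact (hasDerivAt_sqDistArcs hσ hρ r hx').differentiableAt.differentiableWithinAt
      · rw [(hasDerivAt_sqDistArcs hσ hρ r hx').deriv]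
        exact mul_nonneg (hfactor x hx') (sub_nonneg.2
          (hmono (one_sub_mem_Icc (Ioo_subset_Icc_self hx')) hr (by linarith [hx.1])))
    exact hmon ⟨le_rfl, hr'.2⟩ ⟨hle, hq.2⟩ hle

/-- The parameters of two clasped curves: both curved, or both straight. -/
def IsClaspPair (σ ρ : ℝ) : Prop :=
  (σ ∈ Ioc (0 : ℝ) 1 ∧ ρ ∈ Ioc (0 : ℝ) 1) ∨ (σ = 0 ∧ ρ = 0)

theorem IsClaspPair.symm (h : IsClaspPair σ ρ) : IsClaspPair ρ σ := h.imp And.symm And.symm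

theorem IsClaspPair.mem_Icc (h : IsClaspPair σ ρ) : σ ∈ Icc (0 : ℝ) 1 := by
  rcases h with ⟨hσ, -⟩ | ⟨rfl, -⟩
  · exact Ioc_subset_Icc_self hσ
  · exact left_mem_Icc.2 zero_le_one

theorem IsClaspPair.nonneg (h : IsClaspPair σ ρ) : 0 ≤ σ := h.mem_Icc.1

theorem IsClaspPair.le_one (h : IsClaspPair σ ρ) : σ ≤ 1 := h.mem_Icc.2

theorem IsClaspPair.arcsin_nonneg (h : IsClaspPair σ ρ) : 0 ≤ Real.arcsin σ :=
  Real.arcsin_nonneg.2 h.nonneg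

theorem IsClaspPair.tipGap_sub (h : IsClaspPair σ ρ) :
    tipGap σ ρ - claspRise σ ρ (Real.arcsin σ) = √(1 - σ ^ 2) := by
  rcases h with ⟨hσ, hρ⟩ | ⟨rfl, rfl⟩
  · have h := tipGap_sub_strutRise hσ hρ (r := 1) ⟨zero_le_one, le_rfl⟩
    simpa [strutRise, strutHeight, claspRise_zero] using h
  · simp [tipGap, claspRise_zero]

theorem IsClaspPair.tipGap_comm (h : IsClaspPair σ ρ) : tipGap ρ σ = tipGap σ ρ := by
  have := h.tipGap_sub
  rw [tipGap]
  linarith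

theorem IsClaspPair.claspRise_nonneg (h : IsClaspPair σ ρ) (hθ : θ ∈ Icc 0 (Real.arcsin σ)) :
    0 ≤ claspRise σ ρ θ := by
  rcases h with ⟨hσ, hρ⟩ | ⟨rfl, rfl⟩
  · exact Gehring.claspRise_nonneg hσ (Ioc_subset_Icc_self hρ) hθ
  · rw [Real.arcsin_zero, Icc_self, mem_singleton_iff] at hθ
    rw [hθ, claspRise_zero]

theorem IsClaspPair.one_le_sq_dist_arcs (h : IsClaspPair σ ρ) (ht : t ∈ Icc 0 (Real.arcsin σ))
    (hs : s ∈ Icc 0 (Real.arcsin ρ)) :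
    1 ≤ claspX σ ρ (Real.sin t) ^ 2 + claspX ρ σ (Real.sin s) ^ 2 +
      (tipGap σ ρ - claspRise σ ρ t - claspRise ρ σ s) ^ 2 := by
  rcases h with ⟨hσ, hρ⟩ | ⟨rfl, rfl⟩
  · obtain ⟨r, hr, rfl⟩ := exists_arcsin_mul_eq hσ ht
    obtain ⟨q, hq, rfl⟩ := exists_arcsin_mul_eq hρ hs
    rw [sin_arcsin_mul (Ioc_subset_Icc_self hσ) hr, sin_arcsin_mul (Ioc_subset_Icc_self hρ) hq]
    exact one_le_sqDistArcs hσ hρ hr hq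
  · rw [Real.arcsin_zero, Icc_self, mem_singleton_iff] at ht hs
    simp [ht, hs, tipGap, claspRise_zero, claspX_zero]

end Struts

/-! ### Clasp curves with straight ends, split at the tip -/

section SplitCurve

variable {σ ρ g g' c c' e t x z : ℝ}

theorem clamp_cases (hc : 0 ≤ c) (ht : 0 ≤ t) :
    clamp c t ∈ Icc 0 c ∧ 0 ≤ t - clamp c t ∧ (t - clamp c t = 0 ∨ clamp c t = c) := by
  rcases le_total t c with h | h
  · rw [clamp_of_abs_le (by rwa [abs_of_nonneg ht])]
    exact ⟨⟨ht, h⟩, (sub_self t).ge, .inl (sub_self t)⟩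
  · rw [clamp_of_le hc h]
    exact ⟨⟨hc, le_rfl⟩, sub_nonneg.2 h, .inr rfl⟩

theorem clamp_zero (hc : 0 ≤ c) : clamp c 0 = 0 := clamp_of_abs_le (by rwa [abs_zero])

theorem armX_neg (hσ : 0 ≤ σ) (ρ t : ℝ) : armX σ ρ (-t) = -armX σ ρ t := by
  rw [armX, armX, clamp_neg (Real.arcsin_nonneg.2 hσ), Real.sin_neg, claspX_neg]
  ring

theorem armZ_neg (hσ : 0 ≤ σ) (ρ t : ℝ) : armZ σ ρ (-t) = armZ σ ρ t := by
  rw [armZ, armZ, clamp_neg (Real.arcsin_nonneg.2 hσ), claspRise_neg, neg_sub_neg, abs_sub_comm]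

theorem armX_zero (hσ : 0 ≤ σ) (ρ : ℝ) : armX σ ρ 0 = 0 := by
  rw [armX, clamp_zero (Real.arcsin_nonneg.2 hσ), Real.sin_zero, claspX_zero, sub_zero, mul_zero,
    add_zero]

theorem armZ_abs (hσ : 0 ≤ σ) (ρ t : ℝ) : armZ σ ρ |t| = armZ σ ρ t := by
  rcases abs_choice t with h | h <;> simp only [h, armZ_neg hσ]

theorem sq_armX_abs (hσ : 0 ≤ σ) (ρ t : ℝ) : armX σ ρ |t| ^ 2 = armX σ ρ t ^ 2 := by
  rcases abs_choice t with h | h <;> simp only [h, armX_neg hσ, neg_sq]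

theorem armX_nonneg (hσ : 0 ≤ σ) (ρ : ℝ) (ht : 0 ≤ t) : 0 ≤ armX σ ρ t := by
  obtain ⟨hclamp, hrest, -⟩ := clamp_cases (Real.arcsin_nonneg.2 hσ) ht
  have := sin_nonneg_of_mem_Icc_arcsin hclamp
  rw [armX, claspX_eq]
  positivity

theorem IsClaspPair.armZ_nonneg (h : IsClaspPair σ ρ) (t : ℝ) : 0 ≤ armZ σ ρ t := by
  rw [← armZ_abs h.nonneg, armZ]
  exact add_nonneg (h.claspRise_nonneg (clamp_cases h.arcsin_nonneg (abs_nonneg t)).1)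
    (mul_nonneg h.nonneg (abs_nonneg _))

theorem IsClaspPair.sq_sqrt (h : IsClaspPair σ ρ) : √(1 - σ ^ 2) ^ 2 = 1 - σ ^ 2 :=
  Real.sq_sqrt (sub_nonneg.2 (pow_le_one₀ h.nonneg h.le_one))

theorem IsClaspPair.sin_arcsin (h : IsClaspPair σ ρ) : Real.sin (Real.arcsin σ) = σ :=
  Real.sin_arcsin (by linarith [h.nonneg]) h.le_one

/-- A straight end is perpendicular to the strut from the end of the arc to the tip of the other
curve, so moving outwards on it increases the distance to the points of that curve, whose heights
`z` are nonnegative. -/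
theorem IsClaspPair.sq_dist_clamp_le (h : IsClaspPair σ ρ) (ht : 0 ≤ t) (hz : 0 ≤ z) :
    claspX σ ρ (Real.sin (clamp (Real.arcsin σ) t)) ^ 2 +
        (tipGap σ ρ - claspRise σ ρ (clamp (Real.arcsin σ) t) - z) ^ 2 ≤
      armX σ ρ t ^ 2 + (tipGap σ ρ - armZ σ ρ t - z) ^ 2 := by
  obtain ⟨-, hrest, hcurved | hstraight⟩ := clamp_cases h.arcsin_nonneg ht
  · simp [armX, armZ, hcurved]
  · rw [armX, armZ, abs_of_nonneg hrest]
    generalize t - clamp (Real.arcsin σ) t = δ at hrest ⊢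
    rw [hstraight, h.sin_arcsin, claspX_self _ h.nonneg, ← sub_sub, h.tipGap_sub]
    have hsq := h.sq_sqrt
    generalize √(1 - σ ^ 2) = k at hsq ⊢
    have hcross : 0 ≤ σ * δ * z := mul_nonneg (mul_nonneg h.nonneg hrest) hz
    nlinarith [sq_nonneg δ]

theorem IsClaspPair.one_le_sq_dist (h : IsClaspPair σ ρ) (t s : ℝ) :
    1 ≤ armX σ ρ t ^ 2 + armX ρ σ s ^ 2 + (tipGap σ ρ - armZ σ ρ t - armZ ρ σ s) ^ 2 := by
  rw [← sq_armX_abs h.nonneg ρ t, ← sq_armX_abs h.symm.nonneg σ s, ← armZ_abs h.nonneg ρ t,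
    ← armZ_abs h.symm.nonneg σ s]
  have ht := clamp_cases h.arcsin_nonneg (abs_nonneg t)
  have hs := clamp_cases h.symm.arcsin_nonneg (abs_nonneg s)
  have hpull := h.sq_dist_clamp_le (abs_nonneg t) (h.symm.armZ_nonneg |s|)
  have hpull' := h.symm.sq_dist_clamp_le (abs_nonneg s) (h.claspRise_nonneg ht.1)
  rw [h.tipGap_comm, sub_right_comm, sub_right_comm (tipGap σ ρ) (armZ ρ σ |s|)] at hpull'
  linarith [h.one_le_sq_dist_arcs ht.1 hs.1]

theorem splitX_neg (hg : 0 ≤ g) (hσ : 0 ≤ σ) (ρ t : ℝ) :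
    splitX g σ ρ (-t) = -splitX g σ ρ t := by
  rw [splitX, splitX, clamp_neg (by positivity), neg_sub_neg, ← neg_sub t, armX_neg hσ]
  ring

theorem splitZ_neg (hg : 0 ≤ g) (hσ : 0 ≤ σ) (ρ t : ℝ) :
    splitZ g σ ρ (-t) = splitZ g σ ρ t := by
  rw [splitZ, splitZ, clamp_neg (by positivity), neg_sub_neg, ← neg_sub t, armZ_neg hσ]

theorem splitZ_abs (hg : 0 ≤ g) (hσ : 0 ≤ σ) (ρ t : ℝ) : splitZ g σ ρ |t| = splitZ g σ ρ t := by
  rcases abs_choice t with h | h <;> simp only [h, splitZ_neg hg hσ]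

theorem splitX_nonneg (hg : 0 ≤ g) (hσ : 0 ≤ σ) (ρ : ℝ) (ht : 0 ≤ t) : 0 ≤ splitX g σ ρ t := by
  obtain ⟨hclamp, hrest, -⟩ := clamp_cases (show 0 ≤ g / 2 by positivity) ht
  exact add_nonneg hclamp.1 (armX_nonneg hσ ρ hrest)

theorem abs_splitX (hg : 0 ≤ g) (hσ : 0 ≤ σ) (ρ t : ℝ) :
    |splitX g σ ρ t| = splitX g σ ρ |t| := by
  rcases le_total 0 t with h | h
  · rw [abs_of_nonneg h, abs_of_nonneg (splitX_nonneg hg hσ ρ h)]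
  · rw [abs_of_nonpos h, ← abs_of_nonneg (splitX_nonneg hg hσ ρ (neg_nonneg.2 h)),
      splitX_neg hg hσ, abs_neg]

theorem sq_armX_le_sq_splitX_sub_of_nonneg (hσ : 0 ≤ σ) (ρ : ℝ) (hc : |c| ≤ g / 2) (ht : 0 ≤ t) :
    armX σ ρ (t - clamp (g / 2) t) ^ 2 ≤ (splitX g σ ρ t - c) ^ 2 := by
  obtain ⟨-, hrest, hmid | hend⟩ := clamp_cases ((abs_nonneg c).trans hc) ht
  · rw [hmid, armX_zero hσ, zero_pow two_ne_zero]
    positivity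
  · rw [splitX, hend]
    rw [hend] at hrest
    exact pow_le_pow_left₀ (armX_nonneg hσ ρ hrest) (by linarith [(abs_le.1 hc).2]) 2

theorem sq_armX_le_sq_splitX_sub (hσ : 0 ≤ σ) (ρ t : ℝ) (hc : |c| ≤ g / 2) :
    armX σ ρ (t - clamp (g / 2) t) ^ 2 ≤ (splitX g σ ρ t - c) ^ 2 := by
  have hg : 0 ≤ g / 2 := (abs_nonneg c).trans hc
  rcases le_total 0 t with ht | ht
  · exact sq_armX_le_sq_splitX_sub_of_nonneg hσ ρ hc ht
  · have := sq_armX_le_sq_splitX_sub_of_nonneg hσ ρ (by rwa [abs_neg]) (neg_nonneg.2 ht)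
    rw [splitX_neg (by linarith) hσ, clamp_neg hg, neg_sub_neg, ← neg_sub t, armX_neg hσ] at this
    nlinarith

theorem IsClaspPair.one_le_sq_dist_split (h : IsClaspPair σ ρ) (hc : |c| ≤ g / 2)
    (hc' : |c'| ≤ g' / 2) (t s : ℝ) :
    1 ≤ (splitX g σ ρ t - c) ^ 2 + (splitX g' ρ σ s - c') ^ 2 +
      (tipGap σ ρ - splitZ g σ ρ t - splitZ g' ρ σ s) ^ 2 := by
  have hdist := h.one_le_sq_dist (t - clamp (g / 2) t) (s - clamp (g' / 2) s)
  have hX := sq_armX_le_sq_splitX_sub h.nonneg ρ t hc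
  have hX' := sq_armX_le_sq_splitX_sub h.symm.nonneg σ s hc'
  rw [splitZ, splitZ]
  linarith

theorem claspX_le (hσ : σ ∈ Ioc (0 : ℝ) 1) (hρ : ρ ∈ Icc (0 : ℝ) 1) (hx : x ∈ Icc 0 σ) :
    claspX σ ρ x ≤ x := by
  have hx' := abs_le_of_mem_Icc_zero hx
  rw [claspX_eq]
  refine mul_le_of_le_one_right hx.1 (Real.sqrt_le_one.2 ?_)
  rw [div_le_one (one_sub_sq_mul_mate_sq_pos hσ hρ hx')]
  nlinarith [sq_nonneg (mate σ ρ x), one_sub_sq_nonneg_of_abs_le hσ.2 hx']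

theorem IsClaspPair.claspX_sin_le (h : IsClaspPair σ ρ) (ht : t ∈ Icc 0 (Real.arcsin σ)) :
    claspX σ ρ (Real.sin t) ≤ σ := by
  rcases h with ⟨hσ, hρ⟩ | ⟨rfl, rfl⟩
  · have hsin : Real.sin t ∈ Icc 0 σ := ⟨sin_nonneg_of_mem_Icc_arcsin ht, (le_abs_self _).trans
      (abs_sin_le (Ioc_subset_Icc_self hσ) (abs_le_of_mem_Icc_zero ht))⟩
    exact (claspX_le hσ (Ioc_subset_Icc_self hρ) hsin).trans hsin.2
  · rw [Real.arcsin_zero, Icc_self, mem_singleton_iff] at ht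
    rw [ht, Real.sin_zero, claspX_zero]

theorem IsClaspPair.claspRise_le (h : IsClaspPair σ ρ) (ht : t ∈ Icc 0 (Real.arcsin σ)) :
    claspRise σ ρ t ≤ claspRise σ ρ (Real.arcsin σ) := by
  rcases h with ⟨hσ, hρ⟩ | ⟨rfl, rfl⟩
  · exact monotoneOn_claspRise hσ (Ioc_subset_Icc_self hρ) ht ⟨ht.1.trans ht.2, le_rfl⟩ ht.2
  · rw [Real.arcsin_zero, Icc_self, mem_singleton_iff] at ht
    rw [ht, Real.arcsin_zero]

theorem IsClaspPair.armX_add_armZ_le (h : IsClaspPair σ ρ) (he : 0 ≤ e) (ht : 0 ≤ t)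
    (hte : t ≤ Real.arcsin σ + e) :
    √(1 - σ ^ 2) * armX σ ρ t + σ * armZ σ ρ t ≤
      √(1 - σ ^ 2) * σ + σ * claspRise σ ρ (Real.arcsin σ) + e := by
  obtain ⟨hclamp, hrest, hcases⟩ := clamp_cases h.arcsin_nonneg ht
  have hX := mul_le_mul_of_nonneg_left (h.claspX_sin_le hclamp) (Real.sqrt_nonneg (1 - σ ^ 2))
  have hZ := mul_le_mul_of_nonneg_left (h.claspRise_le hclamp) h.nonneg
  rw [armX, armZ, abs_of_nonneg hrest]
  set θ := clamp (Real.arcsin σ) t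
  have hδ : t - θ ≤ e := by rcases hcases with hcurved | hstraight <;> linarith
  calc _ = √(1 - σ ^ 2) * claspX σ ρ (Real.sin θ) + σ * claspRise σ ρ θ +
        (√(1 - σ ^ 2) ^ 2 + σ ^ 2) * (t - θ) := by ring
    _ ≤ _ := by
      rw [h.sq_sqrt]
      linarith

theorem IsClaspPair.abs_splitX_add_splitZ_le (h : IsClaspPair σ ρ) (hg : 0 ≤ g) (he : 0 ≤ e)
    (ht : |t| ≤ g / 2 + Real.arcsin σ + e) :
    √(1 - σ ^ 2) * |splitX g σ ρ t| + σ * splitZ g σ ρ t ≤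
      √(1 - σ ^ 2) * (g / 2 + σ) + σ * claspRise σ ρ (Real.arcsin σ) + e := by
  obtain ⟨hclamp, hrest, hcases⟩ := clamp_cases (show 0 ≤ g / 2 by positivity) (abs_nonneg t)
  have hmid := mul_le_mul_of_nonneg_left hclamp.2 (Real.sqrt_nonneg (1 - σ ^ 2))
  have harm := h.armX_add_armZ_le he hrest
    (by rcases hcases with hmid | hend <;> linarith [h.arcsin_nonneg])
  rw [abs_splitX hg h.nonneg, ← splitZ_abs hg h.nonneg, splitX, splitZ]
  linarith

theorem IsClaspPair.split_end (h : IsClaspPair σ ρ) (hg : 0 ≤ g) (he : 0 ≤ e) :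
    splitX g σ ρ (g / 2 + Real.arcsin σ + e) = g / 2 + σ + √(1 - σ ^ 2) * e ∧
    splitZ g σ ρ (g / 2 + Real.arcsin σ + e) = claspRise σ ρ (Real.arcsin σ) + σ * e := by
  have hθ := h.arcsin_nonneg
  have hmid : clamp (g / 2) (g / 2 + Real.arcsin σ + e) = g / 2 :=
    clamp_of_le (by positivity) (by linarith)
  have hcurved : clamp (Real.arcsin σ) (Real.arcsin σ + e) = Real.arcsin σ :=
    clamp_of_le hθ (by linarith)
  rw [splitX, splitZ, hmid, add_assoc, add_sub_cancel_left, armX, armZ, hcurved,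
    add_sub_cancel_left, abs_of_nonneg he, h.sin_arcsin, claspX_self _ h.nonneg, add_assoc]
  exact ⟨rfl, rfl⟩

end SplitCurve

/-! ### Tangents of the split clasp curves -/

section Tangents

variable {σ ρ g t θ C : ℝ} {X Z X' Z' : ℝ → ℝ}

/-- The plane curve `(X, Z)` has tangent angle `θ` and positive speed at most `C` at `t`. -/
def HasTangentAngle (X Z : ℝ → ℝ) (C θ t : ℝ) : Prop :=
  ∃ s : ℝ, 0 < s ∧ s ≤ C ∧ HasDerivAt X (s * Real.cos θ) t ∧ HasDerivAt Z (s * Real.sin θ) t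

theorem HasTangentAngle.of_sub {d a : ℝ} (h : HasTangentAngle X Z C θ (t - d))
    (hX : X' =ᶠ[𝓝 t] fun x => a + X (x - d)) (hZ : Z' =ᶠ[𝓝 t] fun x => Z (x - d)) :
    HasTangentAngle X' Z' C θ t := by
  obtain ⟨s, hs, hsC, h1, h2⟩ := h
  exact ⟨s, hs, hsC, ((h1.comp_sub_const t d).const_add a).congr_of_eventuallyEq hX,
    (h2.comp_sub_const t d).congr_of_eventuallyEq hZ⟩

theorem HasTangentAngle.of_neg (h : HasTangentAngle X Z C θ (-t)) (hX : ∀ x, X (-x) = -X x)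
    (hZ : ∀ x, Z (-x) = Z x) : HasTangentAngle X Z C (-θ) t := by
  obtain ⟨s, hs, hsC, h1, h2⟩ := h
  refine ⟨s, hs, hsC, ?_, ?_⟩
  · simpa [Function.comp_def, hX] using (h1.comp t (hasDerivAt_neg t)).fun_neg
  · simpa [Function.comp_def, hZ] using h2.comp t (hasDerivAt_neg t)

theorem IsClaspPair.continuous_armX (h : IsClaspPair σ ρ) : Continuous (armX σ ρ) := by
  have hc := continuous_clamp (Real.arcsin σ)
  refine Continuous.add ?_ (by fun_prop)
  rcases h with ⟨hσ, hρ⟩ | ⟨rfl, rfl⟩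
  · rw [continuous_iff_continuousAt]
    intro t
    exact ContinuousAt.comp (f := fun t => Real.sin (clamp (Real.arcsin σ) t))
      (hasDerivAt_claspX hσ (Ioc_subset_Icc_self hρ) (abs_sin_le (Ioc_subset_Icc_self hσ)
        (abs_clamp_le (Real.arcsin_nonneg.2 hσ.1.le) t))).continuousAt
      (Real.continuous_sin.comp hc).continuousAt
  · simpa [clamp, claspX_zero] using continuous_const

theorem IsClaspPair.continuous_armZ (h : IsClaspPair σ ρ) : Continuous (armZ σ ρ) := by
  have hc := continuous_clamp (Real.arcsin σ)
  refine Continuous.add ?_ (by fun_prop)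
  rcases h with ⟨hσ, hρ⟩ | ⟨rfl, rfl⟩
  · exact (continuousOn_claspRise hσ (Ioc_subset_Icc_self hρ)).comp_continuous hc fun t =>
      abs_le.1 (abs_clamp_le (Real.arcsin_nonneg.2 hσ.1.le) t)
  · simpa [clamp, claspRise_zero] using continuous_const

theorem IsClaspPair.continuous_splitX (h : IsClaspPair σ ρ) (g : ℝ) :
    Continuous (splitX g σ ρ) :=
  (continuous_clamp _).add (h.continuous_armX.comp (continuous_id.sub (continuous_clamp _)))

theorem IsClaspPair.continuous_splitZ (h : IsClaspPair σ ρ) (g : ℝ) :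
    Continuous (splitZ g σ ρ) :=
  h.continuous_armZ.comp (continuous_id.sub (continuous_clamp _))

theorem hasTangentAngle_arm_of_lt (hσ : σ ∈ Ioc (0 : ℝ) 1) (hρ : ρ ∈ Icc (0 : ℝ) 1) (ht0 : 0 < t)
    (ht : t < Real.arcsin σ) :
    HasTangentAngle (armX σ ρ) (armZ σ ρ) (claspSlope σ ρ (Real.sin t)) t t := by
  have habs : |t| < Real.arcsin σ := by rwa [abs_of_pos ht0]
  have hsin := abs_sin_le (Ioc_subset_Icc_self hσ) habs.le
  have hsin0 : Real.sin t ≠ 0 := (Real.sin_pos_of_pos_of_lt_pi ht0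
    (by linarith [Real.arcsin_le_pi_div_two σ, Real.pi_pos])).ne'
  have hnear : ∀ᶠ x in 𝓝 t, clamp (Real.arcsin σ) x = x := by
    filter_upwards [continuous_abs.continuousAt.eventually_lt_const habs] with x hx
    exact clamp_of_abs_le hx.le
  refine ⟨_, claspSlope_pos hσ hρ hsin hsin0, le_rfl, ?_, ?_⟩
  · refine ((hasDerivAt_claspX hσ hρ hsin).comp t (Real.hasDerivAt_sin t)).congr_of_eventuallyEq ?_
    filter_upwards [hnear] with x hx
    rw [armX, hx, sub_self, mul_zero, add_zero, Function.comp]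
  · refine (hasDerivAt_claspRise hσ hρ habs).congr_of_eventuallyEq ?_
    filter_upwards [hnear] with x hx
    rw [armZ, hx, sub_self, abs_zero, mul_zero, add_zero]

theorem hasTangentAngle_arm_of_gt (hσ : σ ∈ Icc (0 : ℝ) 1) (ρ : ℝ) (ht : Real.arcsin σ < t) :
    HasTangentAngle (armX σ ρ) (armZ σ ρ) 1 (Real.arcsin σ) t := by
  have hnear : ∀ᶠ x in 𝓝 t, clamp (Real.arcsin σ) x = Real.arcsin σ ∧ 0 ≤ x - Real.arcsin σ := by
    filter_upwards [lt_mem_nhds ht] with x hx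
    exact ⟨clamp_of_le (Real.arcsin_nonneg.2 hσ.1) hx.le, sub_nonneg.2 hx.le⟩
  have hline : HasDerivAt (fun x => x - Real.arcsin σ) 1 t := (hasDerivAt_id t).sub_const _
  refine ⟨1, one_pos, le_rfl, ?_, ?_⟩
  · rw [Real.cos_arcsin, mul_comm]
    refine ((hline.const_mul _).const_add
      (claspX σ ρ (Real.sin (Real.arcsin σ)))).congr_of_eventuallyEq ?_
    filter_upwards [hnear] with x hx
    rw [armX, hx.1]
  · rw [Real.sin_arcsin (by linarith [hσ.1]) hσ.2, mul_comm]
    refine ((hline.const_mul _).const_add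
      (claspRise σ ρ (Real.arcsin σ))).congr_of_eventuallyEq ?_
    filter_upwards [hnear] with x hx
    rw [armZ, hx.1, abs_of_nonneg hx.2]

theorem HasTangentAngle.mono {C' : ℝ} (h : HasTangentAngle X Z C θ t) (hC : C ≤ C') :
    HasTangentAngle X Z C' θ t :=
  let ⟨s, hs, hsC, h⟩ := h
  ⟨s, hs, hsC.trans hC, h⟩

theorem IsClaspPair.exists_hasTangentAngle_arm (h : IsClaspPair σ ρ) :
    ∃ C, 1 ≤ C ∧ ∀ t, 0 < t → t ≠ Real.arcsin σ →
      HasTangentAngle (armX σ ρ) (armZ σ ρ) C (clamp (Real.arcsin σ) t) t := by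
  obtain ⟨C, hC⟩ : ∃ C, ∀ t, 0 < t → t < Real.arcsin σ →
      HasTangentAngle (armX σ ρ) (armZ σ ρ) C t t := by
    rcases h with ⟨hσ, hρ⟩ | ⟨rfl, rfl⟩
    · have hρ' := Ioc_subset_Icc_self hρ
      obtain ⟨C, hC⟩ := isCompact_Icc.bddAbove_image (continuousOn_claspSlope hσ hρ')
      refine ⟨C, fun t ht0 ht => (hasTangentAngle_arm_of_lt hσ hρ' ht0 ht).mono
        (hC (mem_image_of_mem _ (abs_le.1 (abs_sin_le (Ioc_subset_Icc_self hσ) ?_))))⟩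
      rw [abs_of_pos ht0]
      exact ht.le
    · exact ⟨0, fun t ht0 ht => absurd ht (by simpa using ht0.le)⟩
  refine ⟨max 1 C, le_max_left _ _, fun t ht0 ht => ?_⟩
  rcases ht.lt_or_gt with ht | ht
  · rw [clamp_of_abs_le ((abs_of_pos ht0).trans_le ht.le)]
    exact (hC t ht0 ht).mono (le_max_right _ _)
  · rw [clamp_of_le h.arcsin_nonneg ht.le]
    exact (hasTangentAngle_arm_of_gt h.mem_Icc ρ ht).mono (le_max_left _ _)

/-- The tangent angle of a split curve. -/
def splitAngle (g σ t : ℝ) : ℝ := clamp (Real.arcsin σ) (t - clamp (g / 2) t)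

/-- The derivative of the tangent angle of a split curve: the curved arcs are parametrized by the
tangent angle itself. -/
def splitTurn (g σ t : ℝ) : ℝ :=
  if g / 2 < |t| ∧ |t| < g / 2 + Real.arcsin σ then 1 else 0

/-- The parameters at which a split curve passes between straight segments and arcs. -/
def splitCorners (g σ : ℝ) : Set ℝ := {t | |t| = g / 2 ∨ |t| = g / 2 + Real.arcsin σ}

theorem countable_splitCorners (g σ : ℝ) : (splitCorners g σ).Countable := by
  have h (r : ℝ) : {t : ℝ | |t| = r}.Countable :=
    ((toFinite {r, -r}).subset fun t ht => eq_or_eq_neg_of_abs_eq ht).countable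
  exact (h _).union (h _)

theorem neg_mem_splitCorners_iff : -t ∈ splitCorners g σ ↔ t ∈ splitCorners g σ := by
  simp only [splitCorners, mem_ofPred_eq, abs_neg]

theorem splitAngle_neg (hg : 0 ≤ g) (hσ : 0 ≤ σ) (t : ℝ) :
    splitAngle g σ (-t) = -splitAngle g σ t := by
  rw [splitAngle, splitAngle, clamp_neg (by positivity), neg_sub_neg, ← neg_sub t,
    clamp_neg (Real.arcsin_nonneg.2 hσ)]

theorem splitTurn_neg (g σ t : ℝ) : splitTurn g σ (-t) = splitTurn g σ t := by
  rw [splitTurn, splitTurn, abs_neg]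

theorem continuous_splitAngle (g σ : ℝ) : Continuous (splitAngle g σ) :=
  (continuous_clamp _).comp (continuous_id.sub (continuous_clamp _))

theorem measurable_splitTurn (g σ : ℝ) : Measurable (splitTurn g σ) :=
  Measurable.ite ((measurableSet_lt measurable_const measurable_id.abs).inter
    (measurableSet_lt measurable_id.abs measurable_const)) measurable_const measurable_const

theorem splitAngle_of_mem (hg : 0 ≤ g) (ht : t ∈ Icc (g / 2) (g / 2 + Real.arcsin σ)) :
    splitAngle g σ t = t - g / 2 := by
  rw [splitAngle, clamp_of_le (by positivity) ht.1,
    clamp_of_abs_le (abs_le.2 ⟨by linarith [ht.1, ht.2], by linarith [ht.2]⟩)]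

theorem splitAngle_of_ge (hg : 0 ≤ g) (hσ : 0 ≤ σ) (ht : g / 2 + Real.arcsin σ ≤ t) :
    splitAngle g σ t = Real.arcsin σ := by
  have := Real.arcsin_nonneg.2 hσ
  have h1 : clamp (g / 2) t = g / 2 := clamp_of_le (by positivity) (by linarith)
  rw [splitAngle, h1, clamp_of_le this (by linarith)]

theorem splitAngle_of_abs_le (hσ : 0 ≤ σ) (ht : |t| ≤ g / 2) : splitAngle g σ t = 0 := by
  rw [splitAngle, clamp_of_abs_le ht, sub_self, clamp_zero (Real.arcsin_nonneg.2 hσ)]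

theorem hasDerivAt_splitAngle_of_nonneg (hg : 0 ≤ g) (hσ : 0 ≤ σ) (ht0 : 0 ≤ t)
    (ht : t ∉ splitCorners g σ) : HasDerivAt (splitAngle g σ) (splitTurn g σ t) t := by
  obtain ⟨h1, h2⟩ := not_or.1 ht
  rw [splitTurn]
  rcases lt_or_gt_of_ne h1 with h1 | h1
  · rw [if_neg fun h => h1.not_gt h.1]
    refine (hasDerivAt_const t (0 : ℝ)).congr_of_eventuallyEq ?_
    filter_upwards [continuous_abs.continuousAt.eventually_lt_const h1] with x hx
    exact splitAngle_of_abs_le hσ hx.le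
  · rw [abs_of_nonneg ht0] at h1 h2 ⊢
    rcases lt_or_gt_of_ne h2 with h2 | h2
    · rw [if_pos ⟨h1, h2⟩]
      refine ((hasDerivAt_id t).sub_const (g / 2)).congr_of_eventuallyEq ?_
      filter_upwards [Ioo_mem_nhds h1 h2] with x hx
      exact splitAngle_of_mem hg (Ioo_subset_Icc_self hx)
    · rw [if_neg fun h => by linarith [h.2]]
      refine (hasDerivAt_const t (Real.arcsin σ)).congr_of_eventuallyEq ?_
      filter_upwards [lt_mem_nhds h2] with x hx
      exact splitAngle_of_ge hg hσ hx.le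

theorem hasDerivAt_splitAngle (hg : 0 ≤ g) (hσ : 0 ≤ σ) (ht : t ∉ splitCorners g σ) :
    HasDerivAt (splitAngle g σ) (splitTurn g σ t) t := by
  rcases le_total 0 t with h | h
  · exact hasDerivAt_splitAngle_of_nonneg hg hσ h ht
  · have hneg := hasDerivAt_splitAngle_of_nonneg hg hσ (neg_nonneg.2 h)
      (neg_mem_splitCorners_iff.not.2 ht)
    simpa [Function.comp_def, splitAngle_neg hg hσ, splitTurn_neg]
      using (hneg.comp t (hasDerivAt_neg t)).fun_neg

theorem hasTangentAngle_split_of_abs_lt (hσ : 0 ≤ σ) (ρ : ℝ) (ht : |t| < g / 2) :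
    HasTangentAngle (splitX g σ ρ) (splitZ g σ ρ) 1 (splitAngle g σ t) t := by
  have hnear : ∀ᶠ x in 𝓝 t, clamp (g / 2) x = x := by
    filter_upwards [continuous_abs.continuousAt.eventually_lt_const ht] with x hx
    exact clamp_of_abs_le hx.le
  rw [splitAngle_of_abs_le hσ ht.le]
  refine ⟨1, one_pos, le_rfl, ?_, ?_⟩
  · rw [Real.cos_zero, one_mul]
    refine ((hasDerivAt_id t).add_const (armX σ ρ 0)).congr_of_eventuallyEq ?_
    filter_upwards [hnear] with x hx
    rw [splitX, hx, sub_self, id]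
  · rw [Real.sin_zero, mul_zero]
    refine (hasDerivAt_const t (armZ σ ρ 0)).congr_of_eventuallyEq ?_
    filter_upwards [hnear] with x hx
    rw [splitZ, hx, sub_self]

theorem IsClaspPair.exists_hasTangentAngle_split (h : IsClaspPair σ ρ) (hg : 0 ≤ g) :
    ∃ C, ∀ t ∉ splitCorners g σ,
      HasTangentAngle (splitX g σ ρ) (splitZ g σ ρ) C (splitAngle g σ t) t := by
  obtain ⟨C, hC1, hC⟩ := h.exists_hasTangentAngle_arm
  have hσ := h.nonneg
  have hright : ∀ t, 0 ≤ t → t ∉ splitCorners g σ →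
      HasTangentAngle (splitX g σ ρ) (splitZ g σ ρ) C (splitAngle g σ t) t := by
    intro t ht0 ht
    obtain ⟨h1, h2⟩ := not_or.1 ht
    rcases lt_or_gt_of_ne h1 with h1 | h1
    · exact (hasTangentAngle_split_of_abs_lt hσ ρ h1).mono hC1
    · rw [abs_of_nonneg ht0] at h1 h2
      have hnear : ∀ᶠ x in 𝓝 t, clamp (g / 2) x = g / 2 := by
        filter_upwards [lt_mem_nhds h1] with x hx
        exact clamp_of_le (by positivity) hx.le
      rw [splitAngle, hnear.self_of_nhds]
      refine (hC (t - g / 2) (sub_pos.2 h1) fun h => h2 (by linarith)).of_sub (a := g / 2) ?_ ?_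
      all_goals filter_upwards [hnear] with x hx
      · rw [splitX, hx]
      · rw [splitZ, hx]
  refine ⟨C, fun t ht => ?_⟩
  rcases le_total 0 t with h0 | h0
  · exact hright t h0 ht
  · have hneg := hright (-t) (neg_nonneg.2 h0) (neg_mem_splitCorners_iff.not.2 ht)
    rw [← neg_neg (splitAngle g σ t), ← splitAngle_neg hg hσ]
    exact hneg.of_neg (splitX_neg hg hσ ρ) (splitZ_neg hg hσ ρ)

end Tangents

section Planar

variable {E : Type*} [NormedAddCommGroup E] [InnerProductSpace ℝ E] {σ ρ g : ℝ} {p q : E}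

theorem norm_smul_add_smul_eq_one (hp : ‖p‖ = 1) (hq : ‖q‖ = 1) (hpq : ⟪p, q⟫ = 0)
    {c s : ℝ} (hcs : c ^ 2 + s ^ 2 = 1) : ‖c • p + s • q‖ = 1 := by
  rw [← pow_eq_one_iff_of_nonneg (norm_nonneg _) two_ne_zero, norm_add_sq_real, inner_smul_left,
    inner_smul_right, hpq, norm_smul, norm_smul, hp, hq]
  simpa using hcs

/-- The tangent of a split curve drawn in the plane of the orthonormal vectors `p` and `q`. -/
def splitTangent (g σ : ℝ) (p q : E) (t : ℝ) : E :=
  Real.cos (splitAngle g σ t) • p + Real.sin (splitAngle g σ t) • q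

/-- The derivative of `splitTangent`. -/
def splitNormal (g σ : ℝ) (p q : E) (t : ℝ) : E :=
  splitTurn g σ t • (-Real.sin (splitAngle g σ t) • p + Real.cos (splitAngle g σ t) • q)

theorem stronglyMeasurable_splitNormal (g σ : ℝ) (p q : E) :
    StronglyMeasurable (splitNormal g σ p q) := by
  have := continuous_splitAngle g σ
  exact (measurable_splitTurn g σ).stronglyMeasurable.smul
    (Continuous.stronglyMeasurable (by fun_prop))

theorem norm_splitNormal_le (hp : ‖p‖ = 1) (hq : ‖q‖ = 1) (hpq : ⟪p, q⟫ = 0) (t : ℝ) :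
    ‖splitNormal g σ p q t‖ ≤ 1 := by
  rw [splitNormal, norm_smul, norm_smul_add_smul_eq_one hp hq hpq
    (by rw [neg_sq, Real.sin_sq_add_cos_sq]), mul_one, splitTurn]
  split_ifs <;> simp

theorem IsClaspPair.isTurningCurve (h : IsClaspPair σ ρ) (hg : 0 ≤ g) (hp : ‖p‖ = 1) (hq : ‖q‖ = 1)
    (hpq : ⟪p, q⟫ = 0) (c : E) :
    IsTurningCurve (fun t => c + (splitX g σ ρ t • p + splitZ g σ ρ t • q))
      (splitTangent g σ p q) (splitNormal g σ p q) (splitCorners g σ) where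
  countable := countable_splitCorners g σ
  continuous := by
    have hX := h.continuous_splitX g
    have hZ := h.continuous_splitZ g
    fun_prop
  velocity := by
    obtain ⟨C, hC⟩ := h.exists_hasTangentAngle_split hg
    refine ⟨C, fun t ht => ?_⟩
    obtain ⟨s, hs0, hsC, hX, hZ⟩ := hC t ht
    refine ⟨s, hs0, hsC, ?_⟩
    rw [splitTangent, smul_add, smul_smul, smul_smul]
    exact ((hX.smul_const p).add (hZ.smul_const q)).const_add c
  norm_tangent _ := norm_smul_add_smul_eq_one hp hq hpq (Real.cos_sq_add_sin_sq _)
  continuous_tangent := by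
    have := continuous_splitAngle g σ
    unfold splitTangent
    fun_prop
  hasDerivAt_tangent t ht := by
    have hangle := hasDerivAt_splitAngle hg h.nonneg ht
    refine ((hangle.cos.smul_const p).add (hangle.sin.smul_const q)).congr_deriv ?_
    rw [splitNormal, smul_add, smul_smul, smul_smul, mul_comm, mul_comm (Real.cos _)]
  stronglyMeasurable_normal := stronglyMeasurable_splitNormal g σ p q
  norm_normal_le := norm_splitNormal_le hp hq hpq

end Planar

/-! ### Forces along the curved arcs -/

section ArcParam

variable {g σ ρ r t : ℝ}

/-- The parameter of the point of the right curved arc of a split curve at which the vertical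
component of the unit tangent is `σ * r`. -/
def arcParam (g σ r : ℝ) : ℝ := g / 2 + Real.arcsin (σ * r)

theorem continuous_arcParam (g σ : ℝ) : Continuous (arcParam g σ) :=
  continuous_const.add (Real.continuous_arcsin.comp (continuous_const_mul σ))

theorem arcParam_mem_Icc (hσ : 0 ≤ σ) (hr : r ∈ Icc (0 : ℝ) 1) :
    arcParam g σ r ∈ Icc (g / 2) (g / 2 + Real.arcsin σ) :=
  have h := arcsin_mul_mem hσ hr
  ⟨le_add_of_nonneg_right h.1, add_le_add_right h.2 _⟩

theorem arcParam_mem_Ioo (hσ : σ ∈ Ioc (0 : ℝ) 1) (hr : r ∈ Ioo (0 : ℝ) 1) :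
    arcParam g σ r ∈ Ioo (g / 2) (g / 2 + Real.arcsin σ) := by
  have h0 : 0 < σ * r := mul_pos hσ.1 hr.1
  have h1 : σ * r < σ := mul_lt_of_lt_one_right hσ.1 hr.2
  have hlt := Real.strictMonoOn_arcsin ⟨by linarith, by linarith [hσ.2]⟩
    ⟨by linarith [hσ.1], hσ.2⟩ h1
  exact ⟨lt_add_of_pos_right _ (Real.arcsin_pos.2 h0), add_lt_add_right hlt _⟩

theorem arcParam_injOn (hσ : σ ∈ Ioc (0 : ℝ) 1) : InjOn (arcParam g σ) (Icc 0 1) := by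
  intro r hr q hq h
  have hsin := congrArg Real.sin (add_left_cancel h)
  have hσ' := Ioc_subset_Icc_self hσ
  rw [sin_arcsin_mul hσ' hr, sin_arcsin_mul hσ' hq] at hsin
  exact mul_left_cancel₀ hσ.1.ne' hsin

theorem split_arcParam (hg : 0 ≤ g) (hσ : σ ∈ Icc (0 : ℝ) 1) (ρ : ℝ) (hr : r ∈ Icc (0 : ℝ) 1) :
    splitX g σ ρ (arcParam g σ r) = g / 2 + claspX σ ρ (σ * r) ∧
      splitZ g σ ρ (arcParam g σ r) = strutRise σ ρ r := by
  have harc := arcsin_mul_mem hσ.1 hr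
  have hsplit : clamp (g / 2) (arcParam g σ r) = g / 2 :=
    clamp_of_le (by positivity) (arcParam_mem_Icc hσ.1 hr).1
  have harm : clamp (Real.arcsin σ) (Real.arcsin (σ * r)) = Real.arcsin (σ * r) :=
    clamp_of_abs_le ((abs_of_nonneg harc.1).trans_le harc.2)
  rw [splitX, splitZ, hsplit, arcParam, add_sub_cancel_left, armX, armZ, harm,
    sin_arcsin_mul hσ hr, strutRise]
  simp

theorem hasDerivAt_arcParam (g : ℝ) (hσ : σ ∈ Ioc (0 : ℝ) 1) (hr : r ∈ Ioo (0 : ℝ) 1) :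
    HasDerivAt (arcParam g σ) (σ / √(1 - (σ * r) ^ 2)) r :=
  (hasDerivAt_arcsin_mul hσ hr).const_add _

theorem integral_comp_arcParam (g : ℝ) (hσ : σ ∈ Ioc (0 : ℝ) 1) {f : ℝ → ℝ}
    (hf : IntervalIntegrable f volume (g / 2) (g / 2 + Real.arcsin σ)) :
    IntegrableOn (fun r => f (arcParam g σ r) * (σ / √(1 - (σ * r) ^ 2))) (Ioo 0 1) ∧
      ∫ t in (g / 2)..(g / 2 + Real.arcsin σ), f t =
        ∫ r in Ioo (0 : ℝ) 1, f (arcParam g σ r) * (σ / √(1 - (σ * r) ^ 2)) := by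
  have hcont : ContinuousOn (arcParam g σ) (uIcc 0 1) := (continuous_arcParam g σ).continuousOn
  have hderiv : ∀ r ∈ Ioo (min (0 : ℝ) 1) (max 0 1),
      HasDerivAt (arcParam g σ) (σ / √(1 - (σ * r) ^ 2)) r := fun r hr =>
    hasDerivAt_arcParam g hσ (by rwa [min_eq_left zero_le_one, max_eq_right zero_le_one] at hr)
  have hnonneg : ∀ r ∈ Ioo (min (0 : ℝ) 1) (max 0 1), 0 ≤ σ / √(1 - (σ * r) ^ 2) := fun r _ =>
    div_nonneg hσ.1.le (Real.sqrt_nonneg _)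
  have h0 : arcParam g σ 0 = g / 2 := by simp [arcParam]
  have h1 : arcParam g σ 1 = g / 2 + Real.arcsin σ := by rw [arcParam, mul_one]
  have hint := intervalIntegral.integrable_comp_mul_deriv_iff_of_deriv_nonneg (g := f)
    hcont hderiv hnonneg
  have hsubst := intervalIntegral.integral_comp_mul_deriv_of_deriv_nonneg (g := f)
    hcont hderiv hnonneg
  rw [h0, h1] at hint hsubst
  refine ⟨(intervalIntegrable_iff_integrableOn_Ioo_of_le zero_le_one).1 (hint.2 hf), ?_⟩
  rw [← hsubst, intervalIntegral.integral_of_le zero_le_one, integral_Ioc_eq_integral_Ioo]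
  rfl

theorem integrableOn_deriv_arcParam (hσ : σ ∈ Ioc (0 : ℝ) 1) :
    IntegrableOn (fun r => σ / √(1 - (σ * r) ^ 2)) (Ioo 0 1) := by
  simpa using (integral_comp_arcParam 0 hσ (f := fun _ => 1) intervalIntegrable_const).1

end ArcParam

section SymmetricIntegrals

variable {f : ℝ → ℝ} {a b c : ℝ}

theorem integral_symm_eq_integral_add (hf : ∀ a b, IntervalIntegrable f volume a b) (c : ℝ) :
    ∫ t in (-c)..c, f t = ∫ t in (0 : ℝ)..c, (f t + f (-t)) := by
  have hneg : IntervalIntegrable (fun t => f (-t)) volume 0 c := by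
    simpa using (hf 0 (-c)).comp_mul_left (c := -1)
  rw [intervalIntegral.integral_add (hf 0 c) hneg, intervalIntegral.integral_comp_neg, neg_zero,
    add_comm, intervalIntegral.integral_add_adjacent_intervals (hf _ _) (hf _ _)]

theorem integral_symm_eq_integral_add_of_eq_zero (hf : ∀ a b, IntervalIntegrable f volume a b)
    (ha : 0 ≤ a) (hbc : b ≤ c) (hzero : ∀ t, |t| ≤ a ∨ b ≤ |t| → f t = 0) :
    ∫ t in (-c)..c, f t = ∫ t in a..b, (f t + f (-t)) := by
  have hinner : ∫ t in (-a)..a, f t = 0 := by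
    refine intervalIntegral.integral_zero_ae (.of_forall fun t ht => hzero t (.inl ?_))
    rw [uIoc_of_le (by linarith)] at ht
    exact abs_le.2 ⟨ht.1.le, ht.2⟩
  have houter : ∫ t in b..c, (f t + f (-t)) = 0 := by
    refine intervalIntegral.integral_zero_ae (.of_forall fun t ht => ?_)
    rw [uIoc_of_le hbc] at ht
    have hbt : b ≤ |t| := ht.1.le.trans (le_abs_self t)
    rw [hzero t (.inr hbt), hzero (-t) (.inr (by rwa [abs_neg])), add_zero]
  have hint (a b : ℝ) : IntervalIntegrable (fun t => f t + f (-t)) volume a b :=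
    (hf a b).add (by simpa using (hf (-a) (-b)).comp_mul_left (c := -1))
  rw [integral_symm_eq_integral_add hf] at hinner ⊢
  rw [← intervalIntegral.integral_add_adjacent_intervals (hint 0 a) (hint a c), hinner, zero_add,
    ← intervalIntegral.integral_add_adjacent_intervals (hint a b) (hint b c), houter, add_zero]

theorem integrableOn_comp_one_sub (hf : IntegrableOn f (Ioo 0 1)) :
    IntegrableOn (fun r => f (1 - r)) (Ioo 0 1) := by
  rw [← intervalIntegrable_iff_integrableOn_Ioo_of_le zero_le_one] at hf ⊢
  simpa using (hf.comp_sub_left 1).symm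

theorem integral_comp_one_sub (f : ℝ → ℝ) :
    ∫ r in Ioo (0 : ℝ) 1, f (1 - r) = ∫ r in Ioo (0 : ℝ) 1, f r := by
  rw [← integral_Ioc_eq_integral_Ioo, ← integral_Ioc_eq_integral_Ioo,
    ← intervalIntegral.integral_of_le zero_le_one, ← intervalIntegral.integral_of_le zero_le_one,
    intervalIntegral.integral_comp_sub_left, sub_self, sub_zero]

end SymmetricIntegrals

section CurvatureForce

variable {E : Type*} [NormedAddCommGroup E] [InnerProductSpace ℝ E] {σ g e r t : ℝ} {p q : E}

/-- The density in `r` of the horizontal component of the curvature force of a clasp curve at the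
point where the vertical component of the unit tangent is `σ * r`. The density of the vertical
component is the constant `σ`. -/
def sideForce (σ r : ℝ) : ℝ := σ * r * (σ / √(1 - (σ * r) ^ 2))

theorem splitNormal_eq_zero (p q : E) (ht : |t| ≤ g / 2 ∨ g / 2 + Real.arcsin σ ≤ |t|) :
    splitNormal g σ p q t = 0 := by
  rw [splitNormal, splitTurn, if_neg, zero_smul]
  exact fun h => ht.elim h.1.not_ge h.2.not_ge

theorem splitNormal_arcParam (hg : 0 ≤ g) (hσ : σ ∈ Ioc (0 : ℝ) 1) (hr : r ∈ Ioo (0 : ℝ) 1)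
    (p q : E) :
    splitNormal g σ p q (arcParam g σ r) = -(σ * r) • p + √(1 - (σ * r) ^ 2) • q ∧
      splitNormal g σ p q (-arcParam g σ r) = (σ * r) • p + √(1 - (σ * r) ^ 2) • q := by
  have hmem := arcParam_mem_Ioo (g := g) hσ hr
  have hturn : splitTurn g σ (arcParam g σ r) = 1 := by
    rw [splitTurn, abs_of_nonneg ((by positivity : 0 ≤ g / 2).trans hmem.1.le),
      if_pos (by exact hmem)]
  have hangle : splitAngle g σ (arcParam g σ r) = Real.arcsin (σ * r) := by
    rw [splitAngle_of_mem hg (Ioo_subset_Icc_self hmem), arcParam, add_sub_cancel_left]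
  have hsin := sin_arcsin_mul (Ioc_subset_Icc_self hσ) (Ioo_subset_Icc_self hr)
  constructor
  · rw [splitNormal, hturn, hangle, hsin, Real.cos_arcsin, one_smul]
  · rw [splitNormal, splitTurn_neg, splitAngle_neg hg hσ.1.le, hturn, hangle, Real.sin_neg, hsin,
      Real.cos_neg, Real.cos_arcsin, one_smul, neg_neg]

theorem inner_splitNormal_arcParam (hg : 0 ≤ g) (hσ : σ ∈ Ioc (0 : ℝ) 1)
    (hr : r ∈ Ioo (0 : ℝ) 1) (p q x y : E) :
    (⟪splitNormal g σ p q (arcParam g σ r), x⟫ + ⟪splitNormal g σ p q (-arcParam g σ r), y⟫) *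
        (σ / √(1 - (σ * r) ^ 2)) = σ * ⟪q, x + y⟫ - sideForce σ r * ⟪p, x - y⟫ := by
  have hc : 0 < √(1 - (σ * r) ^ 2) := Real.sqrt_pos.2 (one_sub_mul_sq_pos hσ hr)
  obtain ⟨hright, hleft⟩ := splitNormal_arcParam hg hσ hr p q
  rw [hright, hleft, sideForce]
  simp only [inner_add_left, real_inner_smul_left, inner_add_right, inner_sub_right, neg_smul,
    inner_neg_left]
  generalize √(1 - (σ * r) ^ 2) = c at hc
  field_simp
  ring

theorem integral_inner_splitNormal [SecondCountableTopology E] (hσ : σ ∈ Ioc (0 : ℝ) 1)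
    (hg : 0 ≤ g) (he : 0 ≤ e) (hp : ‖p‖ = 1) (hq : ‖q‖ = 1) (hpq : ⟪p, q⟫ = 0) {ξ : ℝ → E}
    (hξ : Continuous ξ) :
    IntegrableOn (fun r => σ * ⟪q, ξ (arcParam g σ r) + ξ (-arcParam g σ r)⟫ -
        sideForce σ r * ⟪p, ξ (arcParam g σ r) - ξ (-arcParam g σ r)⟫) (Ioo 0 1) ∧
      ∫ t in (-(g / 2 + Real.arcsin σ + e))..(g / 2 + Real.arcsin σ + e),
          ⟪splitNormal g σ p q t, ξ t⟫ =
        ∫ r in Ioo (0 : ℝ) 1, (σ * ⟪q, ξ (arcParam g σ r) + ξ (-arcParam g σ r)⟫ -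
          sideForce σ r * ⟪p, ξ (arcParam g σ r) - ξ (-arcParam g σ r)⟫) := by
  have hpair : IsClaspPair σ σ := .inl ⟨hσ, hσ⟩
  have hint := (hpair.isTurningCurve hg hp hq hpq 0).intervalIntegrable_inner_normal hξ
  have hint' (a b : ℝ) : IntervalIntegrable
      (fun t => ⟪splitNormal g σ p q t, ξ t⟫ + ⟪splitNormal g σ p q (-t), ξ (-t)⟫) volume a b :=
    (hint a b).add (by simpa using (hint (-a) (-b)).comp_mul_left (c := -1))
  have hpoint : EqOn _ _ (Ioo (0 : ℝ) 1) := fun r hr =>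
    inner_splitNormal_arcParam hg hσ hr p q (ξ (arcParam g σ r)) (ξ (-arcParam g σ r))
  obtain ⟨hsubst, hsubst'⟩ := integral_comp_arcParam g hσ (hint' _ _)
  refine ⟨hsubst.congr_fun hpoint measurableSet_Ioo, ?_⟩
  rw [integral_symm_eq_integral_add_of_eq_zero hint (a := g / 2)
    (b := g / 2 + Real.arcsin σ) (by positivity) (by linarith) fun t ht => by
      rw [splitNormal_eq_zero p q ht, inner_zero_left], hsubst']
  exact setIntegral_congr_fun measurableSet_Ioo hpoint

end CurvatureForce

section StrutForce

variable {σ ρ r : ℝ}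

theorem sideForce_pos (hσ : σ ∈ Ioc (0 : ℝ) 1) (hr : r ∈ Ioo (0 : ℝ) 1) : 0 < sideForce σ r :=
  mul_pos (mul_pos hσ.1 hr.1) (div_pos hσ.1 (Real.sqrt_pos.2 (one_sub_mul_sq_pos hσ hr)))

theorem integrableOn_sideForce (hσ : σ ∈ Ioc (0 : ℝ) 1) : IntegrableOn (sideForce σ) (Ioo 0 1) := by
  refine (integrableOn_deriv_arcParam hσ).bdd_mul (c := 1)
    (continuous_const_mul σ).aestronglyMeasurable ?_
  filter_upwards [ae_restrict_mem measurableSet_Ioo] with r hr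
  obtain ⟨h0, h1⟩ := mul_mem_Icc_of_mem_unitInterval hσ.1.le (Ioo_subset_Icc_self hr)
  exact abs_le.2 ⟨by linarith, h1.trans hσ.2⟩

/-- The density in `r` of the force on the strut joining the points with parameters `σ * r` and
`ρ * (1 - r)` of two clasped curves; it makes the vertical component of the force equal to `σ`. -/
def strutForce (σ ρ r : ℝ) : ℝ := σ / strutHeight σ ρ r

theorem strutForce_pos (hσ : σ ∈ Ioc (0 : ℝ) 1) (hρ : ρ ∈ Ioc (0 : ℝ) 1)
    (hr : r ∈ Ioo (0 : ℝ) 1) : 0 < strutForce σ ρ r :=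
  div_pos hσ.1 (strutHeight_pos hσ hρ hr)

theorem strutForce_mul_strutHeight (hσ : σ ∈ Ioc (0 : ℝ) 1) (hρ : ρ ∈ Ioc (0 : ℝ) 1)
    (hr : r ∈ Ioo (0 : ℝ) 1) : strutForce σ ρ r * strutHeight σ ρ r = σ :=
  div_mul_cancel₀ _ (strutHeight_pos hσ hρ hr).ne'

theorem strutForce_mul_claspX (hσ : σ ∈ Ioc (0 : ℝ) 1) (hρ : ρ ∈ Ioc (0 : ℝ) 1)
    (hr : r ∈ Ioo (0 : ℝ) 1) : strutForce σ ρ r * claspX σ ρ (σ * r) = sideForce σ r := by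
  have hheight := strutHeight_pos hσ hρ hr
  rw [claspX_eq_mul_strutHeight hσ ρ hr, strutForce, sideForce]
  field_simp

theorem strutForce_mul_claspX_mate (hσ : σ ∈ Ioc (0 : ℝ) 1) (hρ : ρ ∈ Ioc (0 : ℝ) 1)
    (hr : r ∈ Ioo (0 : ℝ) 1) :
    strutForce σ ρ r * claspX ρ σ (ρ * (1 - r)) = σ / ρ * sideForce ρ (1 - r) := by
  have hρ0 := hρ.1.ne'
  rw [← strutForce_mul_claspX hρ hσ (one_sub_mem_Ioo hr), strutForce, strutForce,
    strutHeight_one_sub]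
  field_simp

theorem half_le_sqrt_one_sub_sq {x : ℝ} (h0 : 0 ≤ x) (h1 : x ≤ 1 / 2) : 1 / 2 ≤ √(1 - x ^ 2) :=
  Real.le_sqrt_of_sq_le (by nlinarith)

theorem strutForce_le (hσ : σ ∈ Ioc (0 : ℝ) 1) (hρ : ρ ∈ Ioc (0 : ℝ) 1)
    (hr : r ∈ Ioo (0 : ℝ) 1) :
    strutForce σ ρ r ≤ 2 * (σ / √(1 - (σ * r) ^ 2)) +
      2 * (σ / ρ) * (ρ / √(1 - (ρ * (1 - r)) ^ 2)) := by
  have hr1 := one_sub_mem_Ioo hr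
  have hu := one_sub_mul_sq_pos hσ hr
  have hw := one_sub_mul_sq_pos hρ hr1
  have hA := Real.sqrt_pos.2 hu
  have hC := Real.sqrt_pos.2 hw
  have hAC : 1 / 2 ≤ √(1 - (σ * r) ^ 2) + √(1 - (ρ * (1 - r)) ^ 2) := by
    rcases le_total r (1 / 2) with h | h
    · linarith [half_le_sqrt_one_sub_sq (mul_nonneg hσ.1.le hr.1.le)
        ((mul_le_of_le_one_left hr.1.le hσ.2).trans h)]
    · linarith [half_le_sqrt_one_sub_sq (mul_nonneg hρ.1.le hr1.1.le)
        ((mul_le_of_le_one_left hr1.1.le hρ.2).trans (by linarith))]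
  have hB : √(1 - (σ * r) ^ 2 * (ρ * (1 - r)) ^ 2) ≤ 1 :=
    Real.sqrt_le_one.2 (sub_le_self _ (by positivity))
  rw [strutForce, strutHeight, Real.sqrt_div (by positivity), Real.sqrt_mul hu.le,
    div_div_eq_mul_div]
  calc _ ≤ σ * (2 * (√(1 - (σ * r) ^ 2) + √(1 - (ρ * (1 - r)) ^ 2))) /
        (√(1 - (σ * r) ^ 2) * √(1 - (ρ * (1 - r)) ^ 2)) := by
        have := hσ.1.le
        gcongr
        linarith
    _ = _ := by
        have := hρ.1.ne'
        generalize √(1 - (σ * r) ^ 2) = A at hA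
        generalize √(1 - (ρ * (1 - r)) ^ 2) = C at hC
        field_simp
        ring

theorem integrableOn_strutForce (hσ : σ ∈ Ioc (0 : ℝ) 1) (hρ : ρ ∈ Ioc (0 : ℝ) 1) :
    IntegrableOn (strutForce σ ρ) (Ioo 0 1) := by
  have hbound := ((integrableOn_deriv_arcParam hσ).const_mul 2).add
    ((integrableOn_comp_one_sub (integrableOn_deriv_arcParam hρ)).const_mul (2 * (σ / ρ)))
  have hmeas : Measurable (strutForce σ ρ) := by
    unfold strutForce strutHeight
    fun_prop
  refine hbound.mono' hmeas.aestronglyMeasurable ?_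
  filter_upwards [ae_restrict_mem measurableSet_Ioo] with r hr
  rw [Real.norm_of_nonneg (strutForce_pos hσ hρ hr).le]
  exact strutForce_le hσ hρ hr

end StrutForce

/-! ### The configuration is a generalized link of thickness one -/

section Coordinates

variable {v : E3}

theorem inner_toLp (v : E3) (x y z : ℝ) : ⟪!₂[x, y, z], v⟫ = x * v 0 + y * v 1 + z * v 2 := by
  rw [PiLp.inner_apply, Fin.sum_univ_three]
  simp
  ring

theorem norm_eq_one_of_sq (h : v 0 ^ 2 + v 1 ^ 2 + v 2 ^ 2 = 1) : ‖v‖ = 1 := by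
  simp only [EuclideanSpace.norm_eq, Fin.sum_univ_three, Real.norm_eq_abs, sq_abs, h,
    Real.sqrt_one]

theorem one_le_norm_of_sq (h : 1 ≤ v 0 ^ 2 + v 1 ^ 2 + v 2 ^ 2) : 1 ≤ ‖v‖ := by
  simpa only [EuclideanSpace.norm_eq, Fin.sum_univ_three, Real.norm_eq_abs, sq_abs,
    Real.one_le_sqrt] using h

theorem abs_offset_two (i : Fin 2) : |offset 2 i| = 1 / 2 := by
  fin_cases i <;> norm_num [offset, abs_of_nonneg, abs_of_neg]

theorem one_le_abs_offset_sub {n : ℕ} {i j : Fin n} (hij : i ≠ j) :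
    1 ≤ |offset n i - offset n j| := by
  have hcast : offset n i - offset n j = ((i.val - j.val : ℤ) : ℝ) := by
    simp [offset]
  have hne : (i.val - j.val : ℤ) ≠ 0 :=
    sub_ne_zero.2 fun h => hij (Fin.ext (by exact_mod_cast h))
  rw [hcast]
  exact_mod_cast Int.one_le_abs hne

end Coordinates

variable {m : ℕ} {τ a b : ℝ}

/-- The cases of the configuration `L^m(τ)` covered by the theorem. -/
structure IsClaspCase (m : ℕ) (τ a b : ℝ) : Prop where
  eq_one_or_eq_two : m = 1 ∨ m = 2
  mem_Icc : τ ∈ Icc (0 : ℝ) m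
  pos_a : 0 < a
  pos_b : 0 < b

section Walls

variable {v : E3} {y t : ℝ}

theorem IsClaspCase.gap_nonneg (h : IsClaspCase m τ a b) : 0 ≤ (m : ℝ) - 1 := by
  rcases h.eq_one_or_eq_two with rfl | rfl <;> norm_num

theorem IsClaspCase.abs_offset (h : IsClaspCase m τ a b) (i : Fin m) :
    |offset m i| = ((m : ℝ) - 1) / 2 := by
  rcases h.eq_one_or_eq_two with rfl | rfl
  · simp [offset]
  · rw [abs_offset_two]
    norm_num

theorem IsClaspCase.isClaspPair (h : IsClaspCase m τ a b) : IsClaspPair (τ / 2) (τ / m) := by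
  obtain ⟨hτ0, hτm⟩ := h.mem_Icc
  have hm : (0 : ℝ) < m := by linarith [h.gap_nonneg]
  have hm2 : (m : ℝ) ≤ 2 := by rcases h.eq_one_or_eq_two with rfl | rfl <;> norm_num
  rcases hτ0.eq_or_lt with rfl | hτ
  · exact .inr ⟨zero_div _, zero_div _⟩
  · exact .inl ⟨⟨by positivity, by linarith⟩, by positivity, (div_le_one hm).2 hτm⟩

theorem IsClaspCase.betaEnd_pos (h : IsClaspCase m τ a b) : 0 < betaEnd m τ a := by
  have := h.gap_nonneg
  have := h.isClaspPair.arcsin_nonneg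
  have := h.pos_a
  rw [betaEnd]
  positivity

theorem IsClaspCase.gammaEnd_pos (h : IsClaspCase m τ a b) : 0 < gammaEnd m τ b := by
  have := h.isClaspPair.symm.arcsin_nonneg
  have := h.pos_b
  rw [gammaEnd]
  positivity

theorem inner_wallNormal (m : ℕ) (τ : ℝ) (v : E3) :
    ⟪wallNormal m τ 0, v⟫ = -√(1 - (τ / 2) ^ 2) * v 0 - τ / 2 * v 2 ∧
    ⟪wallNormal m τ 1, v⟫ = √(1 - (τ / 2) ^ 2) * v 0 - τ / 2 * v 2 ∧
    ⟪wallNormal m τ 2, v⟫ = -√(1 - (τ / m) ^ 2) * v 1 + τ / m * v 2 ∧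
    ⟪wallNormal m τ 3, v⟫ = √(1 - (τ / m) ^ 2) * v 1 + τ / m * v 2 := by
  simp only [wallNormal, inner_toLp, Matrix.cons_val]
  refine ⟨?_, ?_, ?_, ?_⟩ <;> ring

theorem IsClaspCase.norm_wallNormal (h : IsClaspCase m τ a b) (j : Fin 4) :
    ‖wallNormal m τ j‖ = 1 := by
  have hσ := h.isClaspPair.sq_sqrt
  have hρ := h.isClaspPair.symm.sq_sqrt
  refine norm_eq_one_of_sq ?_
  match j with
  | 0 | 1 | 2 | 3 =>
    simp only [wallNormal, Matrix.cons_val, neg_sq, hσ, hρ]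
    ring

theorem IsClaspCase.mem_wall (h : IsClaspCase m τ a b) (j : Fin 4)
    (hv : ⟪wallNormal m τ j, v⟫ = wallDist m τ a b j) : v ∈ wall m τ a b j := by
  rw [wall, AffineSubspace.mem_mk', Submodule.mem_orthogonal_singleton_iff_inner_right,
    vsub_eq_sub, inner_sub_right, inner_smul_right, real_inner_self_eq_norm_sq, hv,
    h.norm_wallNormal]
  ring

theorem mem_direction_wall {j : Fin 4} :
    v ∈ (wall m τ a b j).direction ↔ ⟪wallNormal m τ j, v⟫ = 0 := by
  rw [wall, AffineSubspace.direction_mk', Submodule.mem_orthogonal_singleton_iff_inner_right]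

theorem IsClaspCase.wallDist_one (h : IsClaspCase m τ a b) :
    wallDist m τ a b 1 = √(1 - (τ / 2) ^ 2) * (((m : ℝ) - 1) / 2) + a := by
  obtain ⟨hX, hZ⟩ := h.isClaspPair.split_end h.gap_nonneg h.pos_a.le
  change ⟪wallNormal m τ 1, beta m τ 0 (betaEnd m τ a)⟫ = _
  rw [beta, betaEnd, hX, hZ, (inner_wallNormal m τ _).2.1]
  simp only [Matrix.cons_val]
  linear_combination a * h.isClaspPair.sq_sqrt - τ / 2 * h.isClaspPair.tipGap_sub

theorem IsClaspCase.wallDist_three (h : IsClaspCase m τ a b) :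
    wallDist m τ a b 3 = √(1 - (τ / m) ^ 2) * (1 / 2) + τ / m * tipGap (τ / 2) (τ / m) + b := by
  obtain ⟨hX, hZ⟩ := h.isClaspPair.symm.split_end zero_le_one h.pos_b.le
  change ⟪wallNormal m τ 3, gamma m τ 0 (gammaEnd m τ b)⟫ = _
  rw [gamma, gammaEnd, hX, hZ, (inner_wallNormal m τ _).2.2.2, ← h.isClaspPair.tipGap_comm]
  simp only [Matrix.cons_val]
  linear_combination b * h.isClaspPair.symm.sq_sqrt - τ / m * h.isClaspPair.symm.tipGap_sub

theorem IsClaspCase.inner_wallNormal_le (h : IsClaspCase m τ a b)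
    (hside : √(1 - (τ / 2) ^ 2) * |v 0| - τ / 2 * v 2 ≤
      √(1 - (τ / 2) ^ 2) * (((m : ℝ) - 1) / 2) + a)
    (hside' : √(1 - (τ / m) ^ 2) * |v 1| + τ / m * v 2 ≤
      √(1 - (τ / m) ^ 2) * (1 / 2) + τ / m * tipGap (τ / 2) (τ / m) + b) (j : Fin 4) :
    ⟪wallNormal m τ j, v⟫ ≤ wallDist m τ a b j := by
  obtain ⟨h0, h1, h2, h3⟩ := inner_wallNormal m τ v
  have hscale {c : ℝ} (x : ℝ) : √c * x ≤ √c * |x| ∧ -√c * x ≤ √c * |x| := by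
    rw [neg_mul, ← mul_neg]
    exact ⟨mul_le_mul_of_nonneg_left (le_abs_self x) (Real.sqrt_nonneg c),
      mul_le_mul_of_nonneg_left (neg_le_abs x) (Real.sqrt_nonneg c)⟩
  rw [← h.wallDist_one] at hside
  rw [← h.wallDist_three] at hside'
  match j with
  | 0 => exact h0 ▸ (sub_le_sub_right (hscale (v 0)).2 _).trans hside
  | 1 => exact h1 ▸ (sub_le_sub_right (hscale (v 0)).1 _).trans hside
  | 2 => exact h2 ▸ (add_le_add_left (hscale (v 1)).2 _).trans hside'
  | 3 => exact h3 ▸ (add_le_add_left (hscale (v 1)).1 _).trans hside'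

theorem IsClaspCase.inner_wallNormal_beta_le (h : IsClaspCase m τ a b) (j : Fin 4)
    (hy : |y| ≤ 1 / 2) (ht : |t| ≤ betaEnd m τ a) :
    ⟪wallNormal m τ j, beta m τ y t⟫ ≤ wallDist m τ a b j := by
  refine h.inner_wallNormal_le ?_ ?_ j <;> simp only [beta, Matrix.cons_val]
  · have := h.isClaspPair.abs_splitX_add_splitZ_le h.gap_nonneg h.pos_a.le ht
    linear_combination this - τ / 2 * h.isClaspPair.tipGap_sub
  · have hZ : 0 ≤ τ / m * splitZ ((m : ℝ) - 1) (τ / 2) (τ / m) t :=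
      mul_nonneg h.isClaspPair.symm.nonneg (h.isClaspPair.armZ_nonneg _)
    linarith [mul_le_mul_of_nonneg_left hy (Real.sqrt_nonneg (1 - (τ / m) ^ 2)), h.pos_b]

theorem IsClaspCase.inner_wallNormal_gamma_le (h : IsClaspCase m τ a b) (j : Fin 4)
    (hy : |y| ≤ ((m : ℝ) - 1) / 2) (ht : |t| ≤ gammaEnd m τ b) :
    ⟪wallNormal m τ j, gamma m τ y t⟫ ≤ wallDist m τ a b j := by
  have hpair := h.isClaspPair.symm
  refine h.inner_wallNormal_le ?_ ?_ j <;> simp only [gamma, Matrix.cons_val]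
  · have hZ : 0 ≤ τ / 2 * splitZ 1 (τ / m) (τ / 2) t :=
      mul_nonneg h.isClaspPair.nonneg (hpair.armZ_nonneg _)
    linarith [mul_le_mul_of_nonneg_left hy (Real.sqrt_nonneg (1 - (τ / 2) ^ 2)), h.pos_a]
  · have := hpair.abs_splitX_add_splitZ_le zero_le_one h.pos_b.le ht
    rw [← h.isClaspPair.tipGap_comm]
    linear_combination this - τ / m * hpair.tipGap_sub

theorem IsClaspCase.inner_wallNormal_beta_end (h : IsClaspCase m τ a b) (y : ℝ) :
    ⟪wallNormal m τ 1, beta m τ y (betaEnd m τ a)⟫ = wallDist m τ a b 1 ∧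
      ⟪wallNormal m τ 0, beta m τ y (-betaEnd m τ a)⟫ = wallDist m τ a b 0 := by
  change _ = ⟪wallNormal m τ 1, beta m τ 0 (betaEnd m τ a)⟫ ∧
    _ = ⟪wallNormal m τ 1, beta m τ 0 (betaEnd m τ a)⟫
  simp [beta, wallNormal, inner_toLp, splitX_neg h.gap_nonneg h.isClaspPair.nonneg,
    splitZ_neg h.gap_nonneg h.isClaspPair.nonneg]

theorem IsClaspCase.inner_wallNormal_gamma_end (h : IsClaspCase m τ a b) (y : ℝ) :
    ⟪wallNormal m τ 3, gamma m τ y (gammaEnd m τ b)⟫ = wallDist m τ a b 3 ∧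
      ⟪wallNormal m τ 2, gamma m τ y (-gammaEnd m τ b)⟫ = wallDist m τ a b 2 := by
  change _ = ⟪wallNormal m τ 3, gamma m τ 0 (gammaEnd m τ b)⟫ ∧
    _ = ⟪wallNormal m τ 3, gamma m τ 0 (gammaEnd m τ b)⟫
  simp [gamma, wallNormal, inner_toLp, splitX_neg zero_le_one h.isClaspPair.symm.nonneg,
    splitZ_neg zero_le_one h.isClaspPair.symm.nonneg]

theorem IsClaspCase.fderiv_obstacle_ne_zero (h : IsClaspCase m τ a b) (j : Fin 4) (p : E3) :
    fderiv ℝ ((claspProblem m τ a b).obstacle j) p ≠ 0 := by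
  have hderiv : HasFDerivAt ((claspProblem m τ a b).obstacle j) (-innerSL ℝ (wallNormal m τ j)) p :=
    (innerSL ℝ (wallNormal m τ j)).hasFDerivAt.const_sub _
  rw [hderiv.fderiv, neg_ne_zero, ← norm_ne_zero_iff, innerSL_apply_norm, h.norm_wallNormal]
  exact one_ne_zero

end Walls

section Link

theorem IsClaspCase.one_le_dist_beta_gamma (h : IsClaspCase m τ a b) {y y' : ℝ}
    (hy : |y| ≤ 1 / 2) (hy' : |y'| ≤ ((m : ℝ) - 1) / 2) (t s : ℝ) :
    1 ≤ dist (beta m τ y t) (gamma m τ y' s) := by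
  rw [dist_eq_norm]
  refine one_le_norm_of_sq ?_
  have := h.isClaspPair.one_le_sq_dist_split hy' hy t s
  simp only [beta, gamma, PiLp.sub_apply, Matrix.cons_val]
  rwa [sub_sq_comm y]

theorem IsClaspCase.one_le_dist (h : IsClaspCase m τ a b) {x y : (claspProblem m τ a b).Point}
    (hxy : x.1 ≠ y.1) :
    1 ≤ dist (splitClasp m τ a b x.1 x.2) (splitClasp m τ a b y.1 y.2) := by
  obtain ⟨i, t⟩ := x
  obtain ⟨j, s⟩ := y
  rcases i with i | i <;> rcases j with j | j
  · have hij : i ≠ j := fun e => hxy (by rw [e])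
    rw [dist_eq_norm]
    exact (one_le_abs_offset_sub hij).trans
      (PiLp.norm_apply_le (beta m τ (offset 2 i) t - beta m τ (offset 2 j) s) 1)
  · exact h.one_le_dist_beta_gamma (abs_offset_two i).le (h.abs_offset j).le _ _
  · rw [dist_comm]
    exact h.one_le_dist_beta_gamma (abs_offset_two j).le (h.abs_offset i).le _ _
  · have hij : i ≠ j := fun e => hxy (by rw [e])
    rw [dist_eq_norm]
    exact (one_le_abs_offset_sub hij).trans
      (PiLp.norm_apply_le (gamma m τ (offset m i) t - gamma m τ (offset m j) s) 0)

theorem IsClaspCase.lo_lt_hi (h : IsClaspCase m τ a b) (i : Fin 2 ⊕ Fin m) :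
    (claspProblem m τ a b).lo i < (claspProblem m τ a b).hi i := by
  rcases i with _ | _
  · exact neg_lt_self h.betaEnd_pos
  · exact neg_lt_self h.gammaEnd_pos

/-- The curves of the configuration, parametrized by the whole real line. -/
def claspCurve (m : ℕ) (τ : ℝ) : Fin 2 ⊕ Fin m → ℝ → E3 :=
  Sum.elim (fun i t => beta m τ (offset 2 i) t) fun i t => gamma m τ (offset m i) t

theorem splitClasp_eq (i : Fin 2 ⊕ Fin m) (t : (claspProblem m τ a b).Dom i) :
    splitClasp m τ a b i t = claspCurve m τ i t := by
  rcases i with i | i <;> rfl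

/-- The length of the segment inserted in a component. -/
def claspGap (m : ℕ) : Fin 2 ⊕ Fin m → ℝ := Sum.elim (fun _ => (m : ℝ) - 1) fun _ => 1

/-- The parameter `τ₁` or `τ₂` of a component. -/
def claspOwn (m : ℕ) (τ : ℝ) : Fin 2 ⊕ Fin m → ℝ := Sum.elim (fun _ => τ / 2) fun _ => τ / m

/-- The length of the straight ends of a component. -/
def claspTail (m : ℕ) (a b : ℝ) : Fin 2 ⊕ Fin m → ℝ := Sum.elim (fun _ => a) fun _ => b

/-- The horizontal direction of the plane in which a component is drawn. -/
def claspSide : Fin 2 ⊕ Fin m → E3 := Sum.elim (fun _ => !₂[1, 0, 0]) fun _ => !₂[0, 1, 0]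

/-- The vertical direction in which a component opens. -/
def claspUp : Fin 2 ⊕ Fin m → E3 := Sum.elim (fun _ => !₂[0, 0, -1]) fun _ => !₂[0, 0, 1]

/-- The unit tangent of a component. -/
def claspTangent (m : ℕ) (τ : ℝ) (i : Fin 2 ⊕ Fin m) : ℝ → E3 :=
  splitTangent (claspGap m i) (claspOwn m τ i) (claspSide i) (claspUp i)

/-- The derivative of the unit tangent of a component. -/
def claspNormal (m : ℕ) (τ : ℝ) (i : Fin 2 ⊕ Fin m) : ℝ → E3 :=
  splitNormal (claspGap m i) (claspOwn m τ i) (claspSide i) (claspUp i)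

theorem norm_claspSide (i : Fin 2 ⊕ Fin m) : ‖claspSide i‖ = 1 := by
  rcases i with i | i <;> exact norm_eq_one_of_sq (by simp [claspSide])

theorem norm_claspUp (i : Fin 2 ⊕ Fin m) : ‖claspUp i‖ = 1 := by
  rcases i with i | i <;> exact norm_eq_one_of_sq (by simp [claspUp])

theorem inner_claspSide_claspUp (i : Fin 2 ⊕ Fin m) : ⟪claspSide i, claspUp i⟫ = 0 := by
  rcases i with i | i <;> simp [claspSide, claspUp, inner_toLp]

theorem beta_eq (y t : ℝ) : beta m τ y t = !₂[0, y, tipGap (τ / 2) (τ / m)] +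
    (splitX ((m : ℝ) - 1) (τ / 2) (τ / m) t • !₂[1, 0, 0] +
      splitZ ((m : ℝ) - 1) (τ / 2) (τ / m) t • !₂[0, 0, -1]) := by
  ext i
  fin_cases i <;> simp [beta, sub_eq_add_neg]

theorem gamma_eq (y t : ℝ) : gamma m τ y t = !₂[y, 0, 0] +
    (splitX 1 (τ / m) (τ / 2) t • !₂[0, 1, 0] + splitZ 1 (τ / m) (τ / 2) t • !₂[0, 0, 1]) := by
  ext i
  fin_cases i <;> simp [gamma]

theorem IsClaspCase.claspGap_nonneg (h : IsClaspCase m τ a b) (i : Fin 2 ⊕ Fin m) :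
    0 ≤ claspGap m i := by
  rcases i with _ | _
  · exact h.gap_nonneg
  · exact zero_le_one

theorem IsClaspCase.isTurningCurve (h : IsClaspCase m τ a b) (i : Fin 2 ⊕ Fin m) :
    IsTurningCurve (claspCurve m τ i) (claspTangent m τ i) (claspNormal m τ i)
      (splitCorners (claspGap m i) (claspOwn m τ i)) := by
  have hplane {ρ : ℝ} (hpair : IsClaspPair (claspOwn m τ i) ρ) := hpair.isTurningCurve
    (h.claspGap_nonneg i) (norm_claspSide i) (norm_claspUp i) (inner_claspSide_claspUp i)
  rcases i with i | i
  · rw [show claspCurve m τ (.inl i) = _ from funext (beta_eq (offset 2 i))]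
    exact hplane h.isClaspPair _
  · rw [show claspCurve m τ (.inr i) = _ from funext (gamma_eq (offset m i))]
    exact hplane h.isClaspPair.symm _

theorem IsClaspCase.isGeneralizedLink (h : IsClaspCase m τ a b) :
    IsGeneralizedLink (claspProblem m τ a b) (splitClasp m τ a b) where
  lo_lt_hi := h.lo_lt_hi
  continuous i := ((h.isTurningCurve i).continuous.comp continuous_subtype_val).congr fun t =>
    (splitClasp_eq i t).symm
  disjoint x y hxy heq := by
    have := h.one_le_dist hxy
    rw [heq, dist_self] at this
    linarith
  start_mem i t ht := by
    rw [splitClasp_eq, ht]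
    rcases i with i | i
    · exact h.mem_wall 0 (h.inner_wallNormal_beta_end _).2
    · exact h.mem_wall 2 (h.inner_wallNormal_gamma_end _).2
  end_mem i t ht := by
    rw [splitClasp_eq, ht]
    rcases i with i | i
    · exact h.mem_wall 1 (h.inner_wallNormal_beta_end _).1
    · exact h.mem_wall 3 (h.inner_wallNormal_gamma_end _).1
  obstacle_contDiff j := contDiff_const.sub (contDiff_const.inner ℝ contDiff_id)
  obstacle_regular j p _ := h.fderiv_obstacle_ne_zero j p
  avoids j x := by
    obtain ⟨i, t⟩ := x
    rw [splitClasp_eq]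
    rcases i with i | i
    · exact sub_nonneg.2 (h.inner_wallNormal_beta_le j (abs_offset_two i).le (abs_le.2 t.2))
    · exact sub_nonneg.2 (h.inner_wallNormal_gamma_le j (h.abs_offset i).le (abs_le.2 t.2))

theorem IsClaspCase.gThi_eq (h : IsClaspCase m τ a b) :
    gThi (claspProblem m τ a b) (splitClasp m τ a b) = 1 := by
  have hmem : (0 : ℝ) ∈ Icc (-betaEnd m τ a) (betaEnd m τ a) :=
    ⟨by linarith [h.betaEnd_pos], h.betaEnd_pos.le⟩
  let tip (i : Fin 2) : (claspProblem m τ a b).Point := ⟨.inl i, ⟨0, hmem⟩⟩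
  have htips : (tip 0).1 ≠ (tip 1).1 := by simp [tip]
  have : Nonempty {q : (claspProblem m τ a b).Point × (claspProblem m τ a b).Point //
    q.1.1 ≠ q.2.1} := ⟨⟨(tip 0, tip 1), htips⟩⟩
  refine le_antisymm ((gThi_le_dist htips).trans_eq ?_) (le_ciInf fun q => h.one_le_dist q.2)
  have hsub : offset 2 0 - offset 2 1 = -1 := by norm_num [offset]
  rw [dist_eq_norm]
  exact norm_eq_one_of_sq (by simp [tip, splitClasp, beta, hsub])

end Link

/-! ### The polygons of struts -/

section Variation

variable {m : ℕ} {τ a b : ℝ}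

theorem IsClaspCase.exists_isClaspPair_own (h : IsClaspCase m τ a b) (i : Fin 2 ⊕ Fin m) :
    ∃ ρ, IsClaspPair (claspOwn m τ i) ρ := by
  rcases i with _ | _
  exacts [⟨_, h.isClaspPair⟩, ⟨_, h.isClaspPair.symm⟩]

theorem claspProblem_hi (i : Fin 2 ⊕ Fin m) : (claspProblem m τ a b).hi i =
    claspGap m i / 2 + Real.arcsin (claspOwn m τ i) + claspTail m a b i := by
  rcases i with _ | _ <;> rfl

theorem claspProblem_lo (i : Fin 2 ⊕ Fin m) :
    (claspProblem m τ a b).lo i = -(claspProblem m τ a b).hi i := by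
  rcases i with _ | _ <;> rfl

theorem IsClaspCase.claspTail_pos (h : IsClaspCase m τ a b) (i : Fin 2 ⊕ Fin m) :
    0 < claspTail m a b i := by
  rcases i with _ | _
  exacts [h.pos_a, h.pos_b]

theorem claspTangent_eq_wallNormal (h : IsClaspCase m τ a b) (i : Fin 2 ⊕ Fin m) :
    claspTangent m τ i ((claspProblem m τ a b).hi i) =
        wallNormal m τ (Sum.elim (fun _ => 1) (fun _ => 3) i) ∧
      claspTangent m τ i ((claspProblem m τ a b).lo i) =
        -wallNormal m τ (Sum.elim (fun _ => 0) (fun _ => 2) i) := by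
  obtain ⟨ρ, hpair⟩ := h.exists_isClaspPair_own i
  have hangle := splitAngle_of_ge (h.claspGap_nonneg i) hpair.nonneg
    (t := (claspProblem m τ a b).hi i) (by
      rw [claspProblem_hi]
      linarith [h.claspTail_pos i])
  rw [claspProblem_lo, claspTangent, splitTangent, splitTangent,
    splitAngle_neg (h.claspGap_nonneg i) hpair.nonneg, hangle, Real.sin_neg, Real.cos_neg,
    Real.cos_arcsin, Real.sin_arcsin (by linarith [hpair.nonneg]) hpair.le_one]
  rcases i with _ | _ <;> constructor <;> ext k <;> fin_cases k <;>
    simp [claspOwn, claspSide, claspUp, wallNormal]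

theorem IsCompatible.inner_claspTangent_eq_zero (h : IsClaspCase m τ a b)
    {ξ : (claspProblem m τ a b).Field} (hξ : IsCompatible _ ξ) (i : Fin 2 ⊕ Fin m)
    (t : (claspProblem m τ a b).Dom i)
    (ht : (t : ℝ) = (claspProblem m τ a b).hi i ∨ (t : ℝ) = (claspProblem m τ a b).lo i) :
    ⟪claspTangent m τ i t, ξ i t⟫ = 0 := by
  obtain ⟨hhi, hlo⟩ := claspTangent_eq_wallNormal h i
  rcases ht with ht | ht
  · rw [ht, hhi]
    rcases i with _ | _ <;> exact mem_direction_wall.1 ((hξ _ t).2 ht)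
  · rw [ht, hlo, inner_neg_left, neg_eq_zero]
    rcases i with _ | _ <;> exact mem_direction_wall.1 ((hξ _ t).1 ht)

theorem IsClaspCase.exists_isLengthVariation (h : IsClaspCase m τ a b) :
    ∃ D : (claspProblem m τ a b).Field →L[ℝ] ℝ, IsLengthVariation _ (splitClasp m τ a b) D ∧
      ∀ ξ, IsCompatible _ ξ → D ξ =
        -∑ i, ∫ t in (claspProblem m τ a b).lo i..(claspProblem m τ a b).hi i,
          ⟪claspNormal m τ i t, ξ i (projIcc _ _ (h.lo_lt_hi i).le t)⟫ := by
  obtain ⟨D, hD, hDξ⟩ := Gehring.exists_isLengthVariation h.isTurningCurve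
    (fun i => (h.lo_lt_hi i).le) (splitClasp_eq (τ := τ))
  refine ⟨D, hD, fun ξ hξ => ?_⟩
  rw [hDξ, ← Finset.sum_neg_distrib]
  refine Finset.sum_congr rfl fun i _ => ?_
  rw [hξ.inner_claspTangent_eq_zero h i ⟨_, _⟩ (.inl rfl),
    hξ.inner_claspTangent_eq_zero h i ⟨_, _⟩ (.inr rfl)]
  ring

theorem IsClaspCase.stronglyCritical_zero (h : IsClaspCase m 0 a b) :
    StronglyCritical (claspProblem m 0 a b) (splitClasp m 0 a b) := by
  obtain ⟨D, hD, hDξ⟩ := h.exists_isLengthVariation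
  refine ⟨D, hD, 1, one_pos, fun ξ hξ hneg => ?_⟩
  have hown (i : Fin 2 ⊕ Fin m) : claspOwn m 0 i = 0 := by rcases i with _ | _ <;> simp [claspOwn]
  have hstraight (i : Fin 2 ⊕ Fin m) (t : ℝ) : claspNormal m 0 i t = 0 :=
    splitNormal_eq_zero _ _ (by
      rw [hown, Real.arcsin_zero, add_zero]
      exact le_total _ _)
  rw [hDξ ξ hξ] at hneg
  simp [hstraight] at hneg

end Variation

section Vertices

variable {m : ℕ} {τ a b : ℝ}

/-- The phase in `(0, 1)` at which a component takes part in the polygon number `r`: the `β`s run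
through their arcs from the tip to the end while the `γ`s run from the end to the tip. -/
def strutPhase : Fin 2 ⊕ Fin m → ℝ → ℝ := Sum.elim (fun _ r => r) fun _ r => 1 - r

/-- The parameter on the right half of a component of its vertex of the polygon number `r`. -/
def strutParam (m : ℕ) (τ : ℝ) (i : Fin 2 ⊕ Fin m) (r : ℝ) : ℝ :=
  arcParam (claspGap m i) (claspOwn m τ i) (strutPhase i r)

/-- The sign of a half of a curve, `true` denoting the right half. -/
def halfSign (s : Bool) : ℝ := if s then 1 else -1

/-- The vertex of the polygon number `r` on a half of a component. -/
def strutPoint (h : IsClaspCase m τ a b) (x : (Fin 2 ⊕ Fin m) × Bool) (r : ℝ) :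
    (claspProblem m τ a b).Point :=
  ⟨x.1, projIcc _ _ (h.lo_lt_hi x.1).le (halfSign x.2 * strutParam m τ x.1 r)⟩

theorem halfSign_sq (s : Bool) : halfSign s ^ 2 = 1 := by cases s <;> simp [halfSign]

theorem strutPhase_mem_Ioo (i : Fin 2 ⊕ Fin m) {r : ℝ} (hr : r ∈ Ioo (0 : ℝ) 1) :
    strutPhase i r ∈ Ioo (0 : ℝ) 1 := by
  rcases i with _ | _
  exacts [hr, one_sub_mem_Ioo hr]

theorem strutPhase_injective (i : Fin 2 ⊕ Fin m) : Function.Injective (strutPhase i) := by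
  rcases i with _ | _
  exacts [Function.injective_id, sub_right_injective]

theorem continuous_strutPhase (i : Fin 2 ⊕ Fin m) : Continuous (strutPhase i) := by
  rcases i with _ | _
  exacts [continuous_id, continuous_const.sub continuous_id]

theorem IsClaspCase.half_mem_Ioc (h : IsClaspCase m τ a b) (hτ : 0 < τ) :
    τ / 2 ∈ Ioc (0 : ℝ) 1 :=
  ⟨half_pos hτ, h.isClaspPair.le_one⟩

theorem IsClaspCase.div_mem_Ioc (h : IsClaspCase m τ a b) (hτ : 0 < τ) :
    τ / m ∈ Ioc (0 : ℝ) 1 :=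
  ⟨div_pos hτ (by linarith [h.gap_nonneg]), h.isClaspPair.symm.le_one⟩

theorem IsClaspCase.claspOwn_mem_Ioc (h : IsClaspCase m τ a b) (hτ : 0 < τ)
    (i : Fin 2 ⊕ Fin m) : claspOwn m τ i ∈ Ioc (0 : ℝ) 1 := by
  rcases i with _ | _
  exacts [h.half_mem_Ioc hτ, h.div_mem_Ioc hτ]

theorem IsClaspCase.strutParam_mem_Ioo (h : IsClaspCase m τ a b) (hτ : 0 < τ)
    (i : Fin 2 ⊕ Fin m) {r : ℝ} (hr : r ∈ Ioo (0 : ℝ) 1) :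
    strutParam m τ i r ∈ Ioo 0 ((claspProblem m τ a b).hi i) := by
  have hmem := arcParam_mem_Ioo (g := claspGap m i) (h.claspOwn_mem_Ioc hτ i)
    (strutPhase_mem_Ioo i hr)
  rw [claspProblem_hi, strutParam]
  exact ⟨by linarith [h.claspGap_nonneg i, hmem.1], by linarith [h.claspTail_pos i, hmem.2]⟩

theorem coe_strutPoint (h : IsClaspCase m τ a b) (hτ : 0 < τ) (x : (Fin 2 ⊕ Fin m) × Bool)
    {r : ℝ} (hr : r ∈ Ioo (0 : ℝ) 1) :
    ((strutPoint h x r).2 : ℝ) = halfSign x.2 * strutParam m τ x.1 r := by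
  obtain ⟨hpos, hlt⟩ := h.strutParam_mem_Ioo hτ x.1 hr
  rw [strutPoint, projIcc_of_mem]
  rw [claspProblem_lo]
  rcases x with ⟨i, _ | _⟩ <;> simp only [halfSign] <;> constructor <;> simp <;> linarith

theorem continuous_strutPoint (h : IsClaspCase m τ a b) (x : (Fin 2 ⊕ Fin m) × Bool) :
    Continuous (strutPoint h x) :=
  continuous_sigmaMk.comp (continuous_projIcc.comp (continuous_const.mul
    ((continuous_arcParam _ _).comp (continuous_strutPhase x.1))))

theorem injOn_strutPoint (h : IsClaspCase m τ a b) (hτ : 0 < τ) :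
    InjOn (fun x : ((Fin 2 ⊕ Fin m) × Bool) × ℝ => strutPoint h x.1 x.2)
      (univ ×ˢ Ioo 0 1) := by
  rintro ⟨⟨i, s⟩, r⟩ ⟨-, hr : r ∈ Ioo 0 1⟩ ⟨⟨i', s'⟩, r'⟩ ⟨-, hr' : r' ∈ Ioo 0 1⟩
    (heq : strutPoint h _ r = strutPoint h _ r')
  obtain rfl : i = i' := congrArg Sigma.fst heq
  have hcoe := coe_strutPoint h hτ (i, s) hr
  rw [heq, coe_strutPoint h hτ (i, s') hr'] at hcoe
  have hpos := (h.strutParam_mem_Ioo hτ i hr).1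
  have hpos' := (h.strutParam_mem_Ioo hτ i hr').1
  obtain ⟨rfl, hparam⟩ : s = s' ∧ strutParam m τ i r = strutParam m τ i r' := by
    cases s <;> cases s' <;> simp [halfSign] at hcoe ⊢ <;> linarith
  have hphase := arcParam_injOn (h.claspOwn_mem_Ioc hτ i)
    (Ioo_subset_Icc_self (strutPhase_mem_Ioo i hr))
    (Ioo_subset_Icc_self (strutPhase_mem_Ioo i hr')) hparam
  rw [strutPhase_injective i hphase]

theorem split_halfSign_mul_arcParam {g σ r : ℝ} (hg : 0 ≤ g) (hσ : σ ∈ Icc (0 : ℝ) 1) (ρ : ℝ)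
    (hr : r ∈ Icc (0 : ℝ) 1) (s : Bool) :
    splitX g σ ρ (halfSign s * arcParam g σ r) = halfSign s * (g / 2 + claspX σ ρ (σ * r)) ∧
      splitZ g σ ρ (halfSign s * arcParam g σ r) = strutRise σ ρ r := by
  obtain ⟨hX, hZ⟩ := split_arcParam hg hσ ρ hr
  cases s <;> simp [halfSign, splitX_neg hg hσ.1, splitZ_neg hg hσ.1, hX, hZ]

theorem splitClasp_strutPoint_beta (h : IsClaspCase m τ a b) (hτ : 0 < τ) (i : Fin 2) (s : Bool)
    {r : ℝ} (hr : r ∈ Ioo (0 : ℝ) 1) :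
    splitClasp m τ a b (strutPoint h (.inl i, s) r).1 (strutPoint h (.inl i, s) r).2 =
      !₂[halfSign s * (((m : ℝ) - 1) / 2 + claspX (τ / 2) (τ / m) (τ / 2 * r)), offset 2 i,
        tipGap (τ / 2) (τ / m) - strutRise (τ / 2) (τ / m) r] := by
  obtain ⟨hX, hZ⟩ := split_halfSign_mul_arcParam h.gap_nonneg h.isClaspPair.mem_Icc (τ / m)
    (Ioo_subset_Icc_self hr) s
  rw [splitClasp_eq, coe_strutPoint h hτ _ hr, ← hX, ← hZ]
  rfl

theorem splitClasp_strutPoint_gamma (h : IsClaspCase m τ a b) (hτ : 0 < τ) (i : Fin m) (s : Bool)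
    {r : ℝ} (hr : r ∈ Ioo (0 : ℝ) 1) :
    splitClasp m τ a b (strutPoint h (.inr i, s) r).1 (strutPoint h (.inr i, s) r).2 =
      !₂[offset m i, halfSign s * (1 / 2 + claspX (τ / m) (τ / 2) (τ / m * (1 - r))),
        strutRise (τ / m) (τ / 2) (1 - r)] := by
  obtain ⟨hX, hZ⟩ := split_halfSign_mul_arcParam zero_le_one h.isClaspPair.symm.mem_Icc (τ / 2)
    (one_sub_mem_Icc (Ioo_subset_Icc_self hr)) s
  rw [splitClasp_eq, coe_strutPoint h hτ _ hr, ← hX, ← hZ]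
  rfl

end Vertices

section Struts

variable {ι κ : Type} {P : LinkProblem ι κ} {L : P.Arcs}

/-- The first variation of the length of the unit segment between two points of a link. -/
def edgeVariation (L : P.Arcs) (ξ : P.Field) (x y : P.Point) : ℝ :=
  ⟪ξ x.1 x.2 - ξ y.1 y.2, L x.1 x.2 - L y.1 y.2⟫

theorem edgeVariation_comm (L : P.Arcs) (ξ : P.Field) (x y : P.Point) :
    edgeVariation L ξ x y = edgeVariation L ξ y x := by
  rw [edgeVariation, edgeVariation, ← neg_sub, ← neg_sub (L y.1 y.2), inner_neg_neg]

theorem IsGStrut.symm {x y : P.Point} (h : IsGStrut P L x y) : IsGStrut P L y x :=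
  ⟨h.1.symm, by rw [dist_comm, h.2]⟩

variable {m : ℕ} {τ a b r : ℝ}

/-- The halves of a `β` and of a `γ` which are joined by struts. -/
def AreClasped (m : ℕ) (i : Fin 2) (j : Fin m) (s s' : Bool) : Prop :=
  offset m j = halfSign s * (((m : ℝ) - 1) / 2) ∧ offset 2 i = halfSign s' * (1 / 2)

theorem strutPoint_beta_sub_gamma (h : IsClaspCase m τ a b) (hτ : 0 < τ) {i : Fin 2} {j : Fin m}
    {s s' : Bool} (hij : AreClasped m i j s s') (hr : r ∈ Ioo (0 : ℝ) 1) :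
    splitClasp m τ a b (strutPoint h (.inl i, s) r).1 (strutPoint h (.inl i, s) r).2 -
      splitClasp m τ a b (strutPoint h (.inr j, s') r).1 (strutPoint h (.inr j, s') r).2 =
    !₂[halfSign s * claspX (τ / 2) (τ / m) (τ / 2 * r),
      -(halfSign s' * claspX (τ / m) (τ / 2) (τ / m * (1 - r))),
      strutHeight (τ / 2) (τ / m) r] := by
  rw [splitClasp_strutPoint_beta h hτ i s hr, splitClasp_strutPoint_gamma h hτ j s' hr,
    ← tipGap_sub_strutRise (h.half_mem_Ioc hτ) (h.div_mem_Ioc hτ) (Ioo_subset_Icc_self hr),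
    hij.1, hij.2]
  ext k
  fin_cases k <;> simp <;> ring

theorem isGStrut_beta_gamma (h : IsClaspCase m τ a b) (hτ : 0 < τ) {i : Fin 2} {j : Fin m}
    {s s' : Bool} (hij : AreClasped m i j s s') (hr : r ∈ Ioo (0 : ℝ) 1) :
    IsGStrut _ (splitClasp m τ a b) (strutPoint h (.inl i, s) r) (strutPoint h (.inr j, s') r) := by
  refine ⟨Sum.inl_ne_inr, ?_⟩
  rw [h.gThi_eq, dist_eq_norm, strutPoint_beta_sub_gamma h hτ hij hr]
  refine norm_eq_one_of_sq ?_
  simp only [Matrix.cons_val, neg_sq, mul_pow, halfSign_sq, one_mul]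
  exact claspX_sq_add_claspX_sq (h.half_mem_Ioc hτ) (h.div_mem_Ioc hτ) (Ioo_subset_Icc_self hr)

theorem strutForce_mul_edgeVariation (h : IsClaspCase m τ a b) (hτ : 0 < τ) {i : Fin 2}
    {j : Fin m} {s s' : Bool} (hij : AreClasped m i j s s') (hr : r ∈ Ioo (0 : ℝ) 1)
    (ξ : (claspProblem m τ a b).Field) :
    let v := ξ _ (strutPoint h (.inl i, s) r).2 - ξ _ (strutPoint h (.inr j, s') r).2
    strutForce (τ / 2) (τ / m) r * edgeVariation (splitClasp m τ a b) ξ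
      (strutPoint h (.inl i, s) r) (strutPoint h (.inr j, s') r) =
    halfSign s * sideForce (τ / 2) r * v 0 -
      halfSign s' * (m / 2 * sideForce (τ / m) (1 - r)) * v 1 + τ / 2 * v 2 := by
  intro v
  have hσ := h.half_mem_Ioc hτ
  have hρ := h.div_mem_Ioc hτ
  have hratio : (m : ℝ) / 2 = τ / 2 / (τ / m) := by field_simp
  rw [edgeVariation, strutPoint_beta_sub_gamma h hτ hij hr, real_inner_comm, inner_toLp,
    ← strutForce_mul_claspX hσ hρ hr, hratio, ← strutForce_mul_claspX_mate hσ hρ hr]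
  change strutForce (τ / 2) (τ / m) r * (_ * v 0 + _ * v 1 + _ * v 2) = _
  linear_combination v 2 * strutForce_mul_strutHeight hσ hρ hr

theorem strutPoint_beta_sub_beta (h : IsClaspCase m τ a b) (hτ : 0 < τ) (s : Bool)
    (hr : r ∈ Ioo (0 : ℝ) 1) :
    splitClasp m τ a b (strutPoint h (.inl 1, s) r).1 (strutPoint h (.inl 1, s) r).2 -
      splitClasp m τ a b (strutPoint h (.inl 0, s) r).1 (strutPoint h (.inl 0, s) r).2 =
    !₂[0, 1, 0] := by
  rw [splitClasp_strutPoint_beta h hτ 1 s hr, splitClasp_strutPoint_beta h hτ 0 s hr]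
  ext k
  fin_cases k <;> simp [offset]

theorem isGStrut_beta_beta (h : IsClaspCase m τ a b) (hτ : 0 < τ) (s : Bool)
    (hr : r ∈ Ioo (0 : ℝ) 1) :
    IsGStrut _ (splitClasp m τ a b) (strutPoint h (.inl 1, s) r) (strutPoint h (.inl 0, s) r) := by
  refine ⟨by simp [strutPoint], ?_⟩
  rw [h.gThi_eq, dist_eq_norm, strutPoint_beta_sub_beta h hτ s hr]
  exact norm_eq_one_of_sq (by simp)

theorem edgeVariation_beta_beta (h : IsClaspCase m τ a b) (hτ : 0 < τ) (s : Bool)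
    (hr : r ∈ Ioo (0 : ℝ) 1) (ξ : (claspProblem m τ a b).Field) :
    edgeVariation (splitClasp m τ a b) ξ (strutPoint h (.inl 1, s) r)
        (strutPoint h (.inl 0, s) r) =
      (ξ _ (strutPoint h (.inl 1, s) r).2 - ξ _ (strutPoint h (.inl 0, s) r).2) 1 := by
  rw [edgeVariation, strutPoint_beta_sub_beta h hτ s hr, real_inner_comm, inner_toLp]
  ring_nf

theorem strutPoint_gamma_sub_gamma (h : IsClaspCase 2 τ a b) (hτ : 0 < τ) (s : Bool)
    (hr : r ∈ Ioo (0 : ℝ) 1) :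
    splitClasp 2 τ a b (strutPoint h (.inr 1, s) r).1 (strutPoint h (.inr 1, s) r).2 -
      splitClasp 2 τ a b (strutPoint h (.inr 0, s) r).1 (strutPoint h (.inr 0, s) r).2 =
    !₂[1, 0, 0] := by
  rw [splitClasp_strutPoint_gamma h hτ 1 s hr, splitClasp_strutPoint_gamma h hτ 0 s hr]
  ext k
  fin_cases k <;> simp [offset]

theorem isGStrut_gamma_gamma (h : IsClaspCase 2 τ a b) (hτ : 0 < τ) (s : Bool)
    (hr : r ∈ Ioo (0 : ℝ) 1) :
    IsGStrut _ (splitClasp 2 τ a b) (strutPoint h (.inr 1, s) r) (strutPoint h (.inr 0, s) r) := by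
  refine ⟨by simp [strutPoint], ?_⟩
  rw [h.gThi_eq, dist_eq_norm, strutPoint_gamma_sub_gamma h hτ s hr]
  exact norm_eq_one_of_sq (by simp)

theorem edgeVariation_gamma_gamma (h : IsClaspCase 2 τ a b) (hτ : 0 < τ) (s : Bool)
    (hr : r ∈ Ioo (0 : ℝ) 1) (ξ : (claspProblem 2 τ a b).Field) :
    edgeVariation (splitClasp 2 τ a b) ξ (strutPoint h (.inr 1, s) r)
        (strutPoint h (.inr 0, s) r) =
      (ξ _ (strutPoint h (.inr 1, s) r).2 - ξ _ (strutPoint h (.inr 0, s) r).2) 0 := by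
  rw [edgeVariation, strutPoint_gamma_sub_gamma h hτ s hr, real_inner_comm, inner_toLp]
  ring_nf

end Struts

/-! ### The balance of forces -/

section Balance

/-- The function `w` is a positive integrable force density. -/
structure IsForceDensity (w : ℝ → ℝ) : Prop where
  pos : ∀ r ∈ Ioo (0 : ℝ) 1, 0 < w r
  integrableOn : IntegrableOn w (Ioo 0 1)

theorem isForceDensity_sideForce {σ : ℝ} (hσ : σ ∈ Ioc (0 : ℝ) 1) :
    IsForceDensity (sideForce σ) :=
  ⟨fun _ => sideForce_pos hσ, integrableOn_sideForce hσ⟩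

theorem isForceDensity_strutForce {σ ρ : ℝ} (hσ : σ ∈ Ioc (0 : ℝ) 1) (hρ : ρ ∈ Ioc (0 : ℝ) 1) :
    IsForceDensity (strutForce σ ρ) :=
  ⟨fun _ => strutForce_pos hσ hρ, integrableOn_strutForce hσ hρ⟩

theorem IsForceDensity.comp_one_sub {w : ℝ → ℝ} (hw : IsForceDensity w) :
    IsForceDensity fun r => w (1 - r) :=
  ⟨fun _ hr => hw.pos _ (one_sub_mem_Ioo hr), integrableOn_comp_one_sub hw.integrableOn⟩

theorem IsForceDensity.const_mul {w : ℝ → ℝ} (hw : IsForceDensity w) {c : ℝ} (hc : 0 < c) :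
    IsForceDensity fun r => c * w r :=
  ⟨fun _ hr => mul_pos hc (hw.pos _ hr), hw.integrableOn.const_mul c⟩

variable {m : ℕ} {τ a b r : ℝ}

/-- The work of the curvature force of a component at its two vertices of the polygon number `r`. -/
def curvatureWork (h : IsClaspCase m τ a b) (ξ : (claspProblem m τ a b).Field) (i : Fin 2 ⊕ Fin m)
    (r : ℝ) : ℝ :=
  claspOwn m τ i *
      ⟪claspUp i, ξ _ (strutPoint h (i, true) r).2 + ξ _ (strutPoint h (i, false) r).2⟫ -
    sideForce (claspOwn m τ i) (strutPhase i r) *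
      ⟪claspSide i, ξ _ (strutPoint h (i, true) r).2 - ξ _ (strutPoint h (i, false) r).2⟫

theorem integral_curvatureWork (h : IsClaspCase m τ a b) (hτ : 0 < τ)
    (ξ : (claspProblem m τ a b).Field) (i : Fin 2 ⊕ Fin m) :
    IntegrableOn (curvatureWork h ξ i) (Ioo 0 1) ∧
    ∫ t in (claspProblem m τ a b).lo i..(claspProblem m τ a b).hi i,
      ⟪claspNormal m τ i t, ξ i (projIcc _ _ (h.lo_lt_hi i).le t)⟫ =
    ∫ r in Ioo (0 : ℝ) 1, curvatureWork h ξ i r := by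
  have hξ : Continuous fun t => ξ i (projIcc _ _ (h.lo_lt_hi i).le t) :=
    (ξ i).continuous.comp continuous_projIcc
  have key := integral_inner_splitNormal (h.claspOwn_mem_Ioc hτ i) (h.claspGap_nonneg i)
    (h.claspTail_pos i).le (norm_claspSide i) (norm_claspUp i) (inner_claspSide_claspUp i) hξ
  rw [← claspProblem_hi, ← claspProblem_lo] at key
  set F : ℝ → ℝ := _ with hF
  change IntegrableOn F _ ∧ _ = ∫ r in _, F r at key
  have hwork : curvatureWork h ξ i = fun r => F (strutPhase i r) := funext fun r => by
    simp only [curvatureWork, hF, strutPoint, halfSign, strutParam, if_true, one_mul, neg_one_mul,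
      Bool.false_eq_true, if_false]
    rfl
  rw [hwork, claspNormal, key.2]
  rcases i with _ | _
  · exact ⟨key.1, rfl⟩
  · exact ⟨integrableOn_comp_one_sub key.1, (integral_comp_one_sub F).symm⟩

theorem exists_isLengthVariation_curvatureWork (h : IsClaspCase m τ a b) (hτ : 0 < τ) :
    ∃ D : (claspProblem m τ a b).Field →L[ℝ] ℝ, IsLengthVariation _ (splitClasp m τ a b) D ∧
      ∀ ξ, IsCompatible _ ξ → D ξ = ∫ r in Ioo (0 : ℝ) 1, -∑ i, curvatureWork h ξ i r := by
  obtain ⟨D, hD, hDξ⟩ := h.exists_isLengthVariation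
  refine ⟨D, hD, fun ξ hξ => ?_⟩
  rw [hDξ ξ hξ, integral_neg, integral_finsetSum _ fun i _ => (integral_curvatureWork h hτ ξ i).1]
  exact congrArg _ (Finset.sum_congr rfl fun i _ => (integral_curvatureWork h hτ ξ i).2)

theorem balancedByPolygons_of_cycle (h : IsClaspCase m τ a b) (hτ : 0 < τ) {N : ℕ} [NeZero N]
    {q : Fin N → (Fin 2 ⊕ Fin m) × Bool} (hq : Function.Injective q) {w : Fin N → ℝ → ℝ}
    (hstrut : ∀ k, ∀ r ∈ Ioo (0 : ℝ) 1,
      IsGStrut _ (splitClasp m τ a b) (strutPoint h (q k) r) (strutPoint h (q (k + 1)) r))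
    (hw : ∀ k, IsForceDensity (w k))
    (hbal : ∀ ξ, ∀ r ∈ Ioo (0 : ℝ) 1, -∑ i, curvatureWork h ξ i r =
      ∑ k, w k r * edgeVariation (splitClasp m τ a b) ξ (strutPoint h (q k) r)
        (strutPoint h (q (k + 1)) r)) :
    BalancedByPolygons (claspProblem m τ a b) (splitClasp m τ a b) N := by
  obtain ⟨D, hD, hDξ⟩ := exists_isLengthVariation_curvatureWork h hτ
  refine ⟨D, hD, fun k => strutPoint h (q k), w, fun k => (continuous_strutPoint h _).continuousOn,
    ?_, hstrut, fun k => (hw k).pos, fun k => (hw k).integrableOn, fun ξ hξ => ?_⟩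
  · exact (injOn_strutPoint h hτ).comp (hq.prodMap Function.injective_id).injOn
      fun x hx => ⟨mem_univ _, hx.2⟩
  · rw [hDξ ξ hξ]
    exact setIntegral_congr_fun measurableSet_Ioo (hbal ξ)

/-- The cyclic sequence of half-curves on which the vertices of a hexagon lie. -/
def hexagon : Fin 6 → (Fin 2 ⊕ Fin 1) × Bool :=
  ![(.inl 1, true), (.inr 0, true), (.inl 1, false), (.inl 0, false), (.inr 0, false),
    (.inl 0, true)]

/-- The force densities on the edges of the hexagons. -/
def hexagonForce (τ : ℝ) : Fin 6 → ℝ → ℝ :=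
  ![strutForce (τ / 2) (τ / (1 : ℕ)), strutForce (τ / 2) (τ / (1 : ℕ)),
    fun r => 1 / 2 * sideForce (τ / (1 : ℕ)) (1 - r),
    strutForce (τ / 2) (τ / (1 : ℕ)), strutForce (τ / 2) (τ / (1 : ℕ)),
    fun r => 1 / 2 * sideForce (τ / (1 : ℕ)) (1 - r)]

theorem areClasped_one (s : Bool) : AreClasped 1 1 0 s true ∧ AreClasped 1 0 0 s false := by
  norm_num [AreClasped, offset, halfSign]

theorem isGStrut_hexagon (h : IsClaspCase 1 τ a b) (hτ : 0 < τ) (k : Fin 6)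
    (hr : r ∈ Ioo (0 : ℝ) 1) :
    IsGStrut _ (splitClasp 1 τ a b) (strutPoint h (hexagon k) r)
      (strutPoint h (hexagon (k + 1)) r) := by
  have hupper s := isGStrut_beta_gamma h hτ (areClasped_one s).1 hr
  have hlower s := isGStrut_beta_gamma h hτ (areClasped_one s).2 hr
  have hside s := isGStrut_beta_beta h hτ s hr
  fin_cases k
  exacts [hupper true, (hupper false).symm, hside false, hlower false, (hlower true).symm,
    (hside true).symm]

theorem isForceDensity_hexagonForce (h : IsClaspCase 1 τ a b) (hτ : 0 < τ) (k : Fin 6) :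
    IsForceDensity (hexagonForce τ k) := by
  have hclasp := isForceDensity_strutForce (h.half_mem_Ioc hτ) (h.div_mem_Ioc hτ)
  have hbeta := (isForceDensity_sideForce (h.div_mem_Ioc hτ)).comp_one_sub.const_mul one_half_pos
  fin_cases k
  exacts [hclasp, hclasp, hbeta, hclasp, hclasp, hbeta]

theorem neg_sum_curvatureWork_eq_hexagon (h : IsClaspCase 1 τ a b) (hτ : 0 < τ)
    (ξ : (claspProblem 1 τ a b).Field) (hr : r ∈ Ioo (0 : ℝ) 1) :
    -∑ i, curvatureWork h ξ i r = ∑ k, hexagonForce τ k r *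
      edgeVariation (splitClasp 1 τ a b) ξ (strutPoint h (hexagon k) r)
        (strutPoint h (hexagon (k + 1)) r) := by
  have hupper s := strutForce_mul_edgeVariation h hτ (areClasped_one s).1 hr ξ
  have hlower s := strutForce_mul_edgeVariation h hτ (areClasped_one s).2 hr ξ
  have hside s := edgeVariation_beta_beta h hτ s hr ξ
  simp only [hexagon, hexagonForce, Fin.sum_univ_six, Fin.isValue, Fin.reduceAdd, Matrix.cons_val]
  rw [edgeVariation_comm _ ξ (strutPoint h (.inr 0, true) r),
    edgeVariation_comm _ ξ (strutPoint h (.inr 0, false) r),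
    edgeVariation_comm _ ξ (strutPoint h (.inl 0, true) r) (strutPoint h (.inl 1, true) r),
    hupper, hupper, hlower, hlower, hside, hside]
  simp only [Fintype.sum_sum_type, Fin.sum_univ_two, Fin.sum_univ_one,
    curvatureWork, claspUp, claspSide, claspOwn, strutPhase, Sum.elim_inl, Sum.elim_inr,
    inner_toLp, PiLp.sub_apply, PiLp.add_apply, halfSign, if_true, Bool.false_eq_true, if_false]
  push_cast
  ring

theorem balancedByPolygons_hexagon (h : IsClaspCase 1 τ a b) (hτ : 0 < τ) :
    BalancedByPolygons (claspProblem 1 τ a b) (splitClasp 1 τ a b) 6 :=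
  balancedByPolygons_of_cycle h hτ (q := hexagon) (by decide)
    (fun k _ => isGStrut_hexagon h hτ k) (isForceDensity_hexagonForce h hτ)
    fun ξ _ => neg_sum_curvatureWork_eq_hexagon h hτ ξ

/-- The cyclic sequence of half-curves on which the vertices of an octagon lie. -/
def octagon : Fin 8 → (Fin 2 ⊕ Fin 2) × Bool :=
  ![(.inl 1, true), (.inr 1, true), (.inr 0, true), (.inl 1, false), (.inl 0, false),
    (.inr 0, false), (.inr 1, false), (.inl 0, true)]

/-- The force densities on the edges of the octagons. -/
def octagonForce (τ : ℝ) : Fin 8 → ℝ → ℝ :=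
  ![strutForce (τ / 2) (τ / (2 : ℕ)), sideForce (τ / 2), strutForce (τ / 2) (τ / (2 : ℕ)),
    fun r => sideForce (τ / (2 : ℕ)) (1 - r),
    strutForce (τ / 2) (τ / (2 : ℕ)), sideForce (τ / 2), strutForce (τ / 2) (τ / (2 : ℕ)),
    fun r => sideForce (τ / (2 : ℕ)) (1 - r)]

theorem areClasped_two : AreClasped 2 1 1 true true ∧ AreClasped 2 1 0 false true ∧
    AreClasped 2 0 0 false false ∧ AreClasped 2 0 1 true false := by
  norm_num [AreClasped, offset, halfSign]

theorem isGStrut_octagon (h : IsClaspCase 2 τ a b) (hτ : 0 < τ) (k : Fin 8)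
    (hr : r ∈ Ioo (0 : ℝ) 1) :
    IsGStrut _ (splitClasp 2 τ a b) (strutPoint h (octagon k) r)
      (strutPoint h (octagon (k + 1)) r) := by
  obtain ⟨h11, h10, h00, h01⟩ := areClasped_two
  have hbeta s := isGStrut_beta_beta h hτ s hr
  have hgamma s := isGStrut_gamma_gamma h hτ s hr
  fin_cases k
  exacts [isGStrut_beta_gamma h hτ h11 hr, hgamma true, (isGStrut_beta_gamma h hτ h10 hr).symm,
    hbeta false, isGStrut_beta_gamma h hτ h00 hr, (hgamma false).symm,
    (isGStrut_beta_gamma h hτ h01 hr).symm, (hbeta true).symm]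

theorem isForceDensity_octagonForce (h : IsClaspCase 2 τ a b) (hτ : 0 < τ) (k : Fin 8) :
    IsForceDensity (octagonForce τ k) := by
  have hclasp := isForceDensity_strutForce (h.half_mem_Ioc hτ) (h.div_mem_Ioc hτ)
  have hbeta := (isForceDensity_sideForce (h.div_mem_Ioc hτ)).comp_one_sub
  have hgamma := isForceDensity_sideForce (h.half_mem_Ioc hτ)
  fin_cases k
  exacts [hclasp, hgamma, hclasp, hbeta, hclasp, hgamma, hclasp, hbeta]

theorem neg_sum_curvatureWork_eq_octagon (h : IsClaspCase 2 τ a b) (hτ : 0 < τ)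
    (ξ : (claspProblem 2 τ a b).Field) (hr : r ∈ Ioo (0 : ℝ) 1) :
    -∑ i, curvatureWork h ξ i r = ∑ k, octagonForce τ k r *
      edgeVariation (splitClasp 2 τ a b) ξ (strutPoint h (octagon k) r)
        (strutPoint h (octagon (k + 1)) r) := by
  obtain ⟨h11, h10, h00, h01⟩ := areClasped_two
  have hbeta s := edgeVariation_beta_beta h hτ s hr ξ
  have hgamma s := edgeVariation_gamma_gamma h hτ s hr ξ
  simp only [octagon, octagonForce, Fin.sum_univ_eight, Fin.isValue, Fin.reduceAdd,
    Matrix.cons_val]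
  rw [edgeVariation_comm _ ξ (strutPoint h (.inr 0, true) r),
    edgeVariation_comm _ ξ (strutPoint h (.inr 0, false) r),
    edgeVariation_comm _ ξ (strutPoint h (.inr 1, false) r) (strutPoint h (.inl 0, true) r),
    edgeVariation_comm _ ξ (strutPoint h (.inl 0, true) r) (strutPoint h (.inl 1, true) r),
    strutForce_mul_edgeVariation h hτ h11 hr, strutForce_mul_edgeVariation h hτ h10 hr,
    strutForce_mul_edgeVariation h hτ h00 hr, strutForce_mul_edgeVariation h hτ h01 hr,
    hbeta, hbeta, hgamma, hgamma]
  simp only [Fintype.sum_sum_type, Fin.sum_univ_two,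
    curvatureWork, claspUp, claspSide, claspOwn, strutPhase, Sum.elim_inl, Sum.elim_inr,
    inner_toLp, PiLp.sub_apply, PiLp.add_apply, halfSign, if_true, Bool.false_eq_true, if_false]
  push_cast
  ring

theorem balancedByPolygons_octagon (h : IsClaspCase 2 τ a b) (hτ : 0 < τ) :
    BalancedByPolygons (claspProblem 2 τ a b) (splitClasp 2 τ a b) 8 :=
  balancedByPolygons_of_cycle h hτ (q := octagon) (by decide)
    (fun k _ => isGStrut_octagon h hτ k) (isForceDensity_octagonForce h hτ)
    fun ξ _ => neg_sum_curvatureWork_eq_octagon h hτ ξ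

end Balance

section Criticality

variable {m : ℕ} {τ a b : ℝ}

theorem IsClaspCase.stronglyCritical (h : IsClaspCase m τ a b) {N : ℕ} [NeZero N]
    (hbal : 0 < τ → BalancedByPolygons (claspProblem m τ a b) (splitClasp m τ a b) N) :
    StronglyCritical (claspProblem m τ a b) (splitClasp m τ a b) := by
  rcases h.mem_Icc.1.eq_or_lt with rfl | hτ
  · exact h.stronglyCritical_zero
  · exact (hbal hτ).stronglyCritical h.isGeneralizedLink (h.gThi_eq.symm ▸ one_pos)

end Criticality

end Gehring

end

theorem theorem5p1 (τ a b : ℝ) (hτ : 0 ≤ τ) (ha : 0 < a) (hb : 0 < b) :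
    (τ ≤ 1 →
      Gehring.IsGeneralizedLink (Gehring.claspProblem 1 τ a b) (Gehring.splitClasp 1 τ a b) ∧
      Gehring.gThi (Gehring.claspProblem 1 τ a b) (Gehring.splitClasp 1 τ a b) = 1 ∧
      Gehring.StronglyCritical (Gehring.claspProblem 1 τ a b) (Gehring.splitClasp 1 τ a b) ∧
      (0 < τ → Gehring.BalancedByPolygons
        (Gehring.claspProblem 1 τ a b) (Gehring.splitClasp 1 τ a b) 6)) ∧
    (τ ≤ 2 →
      Gehring.IsGeneralizedLink (Gehring.claspProblem 2 τ a b) (Gehring.splitClasp 2 τ a b) ∧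
      Gehring.gThi (Gehring.claspProblem 2 τ a b) (Gehring.splitClasp 2 τ a b) = 1 ∧
      Gehring.StronglyCritical (Gehring.claspProblem 2 τ a b) (Gehring.splitClasp 2 τ a b) ∧
      (0 < τ → Gehring.BalancedByPolygons
        (Gehring.claspProblem 2 τ a b) (Gehring.splitClasp 2 τ a b) 8)) := by
  refine ⟨fun h => ?_, fun h => ?_⟩
  · have hc : Gehring.IsClaspCase 1 τ a b := ⟨.inl rfl, ⟨hτ, mod_cast h⟩, ha, hb⟩
    have hbal := Gehring.balancedByPolygons_hexagon hc
    exact ⟨hc.isGeneralizedLink, hc.gThi_eq, hc.stronglyCritical hbal, hbal⟩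
  · have hc : Gehring.IsClaspCase 2 τ a b := ⟨.inr rfl, ⟨hτ, mod_cast h⟩, ha, hb⟩
    have hbal := Gehring.balancedByPolygons_octagon hc
    exact ⟨hc.isGeneralizedLink, hc.gThi_eq, hc.stronglyCritical hbal, hbal⟩
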